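/- **Notation (multiple zeta values).** An index is a (possibly empty) tuple $\mathbf k=(k_1,\dots,k_r)$ of positive integers; it is admissible if $r=0$ or $k_r\ge 2$. For admissible $\mathbf k$ put $\zeta(\mathbf k)=\lim_{M\to\infty}\sum_{0<m_1<\cdots<m_r<M}\prod_i m_i^{-k_i}$, and let $\mathcal Z\subset\mathbb R$ be the $\mathbb Q$-algebra spanned by these values. Let $\mathfrak h=\mathbb Q\langle x,y\rangle$, $z_k=yx^{k-1}$, $z_{\mathbf k}=z_{k_1}\cdots z_{k_r}$, and $\mathfrak h^1=\mathbb Q\langle z_1,z_2,\dots\rangle\subset\mathfrak h$ with the harmonic product $\ast$ and the shuffle product $\mathrm{sh}$. For $\bullet\in\{\ast,\mathrm{sh}\}$ let $Z^\bullet:(\mathfrak h^1,\bullet)\to\mathcal Z[T]$ be the unique $\mathbb Q$-algebra homomorphism with $Z^\bullet(z_{\mathbf k})=\zeta(\mathbf k)$ for admissible $\mathbf k$ and $Z^\bullet(y)=T$; put $\zeta^\bullet(\mathbf k)=Z^\bullet(z_{\mathbf k})|_{T=0}$ and $$\zeta^{\mathcal S,\bullet}(\mathbf k)=\sum_{i=0}^r(-1)^{k_{i+1}+\cdots+k_r}\,\zeta^\bullet(k_1,\dots,k_i)\,\zeta^\bullet(k_r,\dots,k_{i+1})\in\mathcal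 Z .$$ The symmetric multiple zeta value (SMZV) $\zeta^{\mathcal S}(\mathbf k)$ is the class of $\zeta^{\mathcal S,\bullet}(\mathbf k)$ in $\mathcal Z/\zeta(2)\mathcal Z$. **Notation ($q$-analogue).** Let $\mathcal C=\mathbb Q[\hbar]$, $g_k=ba^k$ and $e_k=b(a+\hbar)a^{k-1}$ ($k\ge1$) in $\mathfrak H=\mathcal C\langle a,b\rangle$, and let $\mathcal C\langle A\rangle\subset\mathfrak H$ be the (free) $\mathcal C$-subalgebra generated by $A=\{\hbar b\}\cup\{g_k\mid k\ge1\}$, where $\hbar b=e_1-g_1$. * The product $\ast_\hbar$ on $\mathcal C\langle A\rangle$ is $\mathcal C$-bilinear with unit $1$ and $(wu)\ast_\hbar(w'v)=(w\ast_\hbar w'v)u+(wu\ast_\hbar w')v+(w\ast_\hbar w')(u\circ_\hbar v)$ for $u,v\in A$, where $\hbar b\circ_\hbar\hbar b=\hbar\cdot\hbar b$, $\hbar b\circ_\hbar g_k=g_k\circ_\hbar\hbar b=\hbar g_k$, $g_k\circ_\hbar g_l=g_{k+l}$. * The product $\mathrm{sh}_\hbar$ on $\mathfrak H$ (which restricts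 to $\mathcal C\langle A\rangle$) is $\mathcal C$-bilinear with unit $1$, $wb\,\mathrm{sh}_\hbar\,w'=w\,\mathrm{sh}_\hbar\,w'b=(w\,\mathrm{sh}_\hbar\,w')b$ and $wa\,\mathrm{sh}_\hbar\,w'a=(wa\,\mathrm{sh}_\hbar\,w'+w\,\mathrm{sh}_\hbar\,w'a+\hbar\,w\,\mathrm{sh}_\hbar\,w')a$. * $\psi^\ast,\psi^{\mathrm{sh}}$ are the $\mathcal C$-algebra anti-involutions of $\mathcal C\langle A\rangle$ fixing $\hbar b$, with $\psi^\ast(ba^k)=b(-a)^k$ and $\psi^{\mathrm{sh}}(ba^k)=b(-a-\hbar)^k$; and $w_\hbar^{\mathcal S,\bullet}$ is the $\mathcal C$-linear map $u_1\cdots u_r\mapsto\sum_{i=0}^r u_1\cdots u_i\bullet_\hbar\psi^\bullet(u_{i+1}\cdots u_r)$, $u_j\in A$. * $g_{\mathbf k}=g_{k_1}\cdots g_{k_r}$; $E_{1^m}=\frac1{(m+1)!}\sum_{j=0}^m g_1^{\mathrm{sh}_\hbar j}\,\mathrm{sh}_\hbar\,e_1^{\mathrm{sh}_\hbar(m-j)}$;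 and $E_{\mathbf k}=E_{1^{s_0}}e_{t_1+2}E_{1^{s_1}}\cdots e_{t_n+2}E_{1^{s_n}}$ if $\mathbf k=(1^{s_0},t_1+2,1^{s_1},\dots,t_n+2,1^{s_n})$ with $1^s$ denoting $s$ ones. * $\widehat{\mathfrak H^0}=\mathcal C+\sum_{k\ge1}\mathcal C\langle A\rangle g_k$; $\mathfrak n_0$ is the $\mathcal C$-span of the elements $(\hbar b)^{\alpha_1}g_{\beta_1+1}\cdots(\hbar b)^{\alpha_r}g_{\beta_r+1}$ with $\alpha_s,\beta_t\ge1$ for some $s\le t$; $\mathfrak n=\mathfrak n_0+\hbar\widehat{\mathfrak H^0}$; $\mathfrak H^0=\mathcal C+\sum_{k\ge2}\mathcal C\langle A\rangle g_k+\mathfrak n$. For complex $q$ with $0<|q|<1$ let $\hbar$ act on $\mathbb C$ as $1-q$, put $[m]=\frac{1-q^m}{1-q}$, $F_q(m;\hbar b)=1-q$, $F_q(m;g_k)=q^{km}/[m]^k$, let $Z_{q,M}:\mathcal C\langle A\rangle\to\mathbb C$ be the $\mathcal C$-linear map with $Z_{q,M}(u_1\cdots u_r)=\sum_{0<m_1<\cdots<m_r<M}\prod_iF_q(m_i;u_i)$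 for $u_i\in A$, and $Z_q(w)=\lim_{M\to\infty}Z_{q,M}(w)$ for $w\in\widehat{\mathfrak H^0}$. Put $Z_q^{\mathcal S,\ast}(g_{\mathbf k})=Z_q(w_\hbar^{\mathcal S,\ast}(g_{\mathbf k}))$ and $Z_q^{\mathcal S,\mathrm{sh}}(E_{\mathbf k})=Z_q(w_\hbar^{\mathcal S,\mathrm{sh}}(E_{\mathbf k}))$. Regarding $Z_q(w)$ as a function of $q$ on the punctured unit disc, let $\mathcal Z_q=Z_q(\mathfrak H^0)$, $\mathcal N_q=Z_q(\mathfrak n)$, and let $\mathcal P_q$ be the ideal of $\mathcal Z_q$ generated by $Z_q(g_{2k})$, $k\ge1$. The $q$-analogue $\zeta_q^{\mathcal S}(\mathbf k)$ of the SMZV ($q$SMZV) is the class of $Z_q^{\mathcal S,\ast}(g_{\mathbf k})$, represented also by $Z_q^{\mathcal S,\mathrm{sh}}(E_{\mathbf k})$, in $\mathcal Z_q/(\mathcal N_q+\mathcal P_q)$. **Theorem.** The objects above are well defined: the limits defining $\zeta(\mathbf k)$ for admissible $\mathbf k$, and $Z_q(w)$ for $w\in\widehat{\mathfrak H^0}$,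 exist; the span of the $\zeta(\mathbf k)$ is a $\mathbb Q$-algebra; $Z^\ast$ and $Z^{\mathrm{sh}}$ exist and are unique; and $w_\hbar^{\mathcal S,\ast}(g_{\mathbf k}),\,w_\hbar^{\mathcal S,\mathrm{sh}}(E_{\mathbf k})\in\mathfrak H^0$ for every index $\mathbf k$. For every index $\mathbf k$, as $q\to1-0$ along real $q$, $$\lim_{q\to1-0}Z_q^{\mathcal S,\ast}(g_{\mathbf k})=\zeta^{\mathcal S,\ast}(\mathbf k),\qquad \lim_{q\to1-0}Z_q^{\mathcal S,\mathrm{sh}}(E_{\mathbf k})=\zeta^{\mathcal S,\mathrm{sh}}(\mathbf k).$$ Moreover, every $f\in\mathcal Z_q$ has a limit in $\mathcal Z$ as $q\to1-0$, and $f\mapsto\lim_{q\to1-0}f(q)$ induces a well-defined $\mathbb Q$-linear map $\mathcal Z_q/(\mathcal N_q+\mathcal P_q)\to\mathcal Z/\zeta(2)\mathcal Z$. For every index $\mathbf k$ this map sends the $q$SMZV $\zeta_q^{\mathcal S}(\mathbf k)$ to the SMZV $\zeta^{\mathcal S}(\mathbf k)$: it sends the class of $Z_q^{\mathcal S,\ast}(g_{\mathbf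 k})$ to that of $\zeta^{\mathcal S,\ast}(\mathbf k)$, and the class of $Z_q^{\mathcal S,\mathrm{sh}}(E_{\mathbf k})$ to that of $\zeta^{\mathcal S,\mathrm{sh}}(\mathbf k)$. -/

import Mathlib

open Filter Topology

namespace QSMZV

noncomputable section

/-! ### Words, bilinear extension, truncated nested sums -/

section Generic

variable {R : Type} [CommRing R] {X Y : Type}

/-- The monomial `u₁ u₂ ⋯ u_r` of the free algebra attached to the list `[u₁, …, u_r]`. -/
def word (R : Type) [CommRing R] {X : Type} (u : List X) : FreeAlgebra R X :=
  (u.map (FreeAlgebra.ι R)).prod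

/-- The monomials form a basis of the free algebra. -/
def wordBasis (R : Type) [CommRing R] (X : Type) : Module.Basis (List X) R (FreeAlgebra R X) :=
  FreeAlgebra.basisFreeMonoid R X

theorem wordBasis_apply (u : List X) : wordBasis R X u = word R u := by
  have h : ∀ v : FreeMonoid X, FreeAlgebra.equivMonoidAlgebraFreeMonoid.symm
      (MonoidAlgebra.single v (1 : R)) = (v.toList.map (FreeAlgebra.ι R)).prod := by
    intro v
    simp [FreeAlgebra.equivMonoidAlgebraFreeMonoid, FreeMonoid.lift_apply]
  have := h (FreeMonoid.ofList u)
  change FreeAlgebra.basisFreeMonoid R X (FreeMonoid.ofList u) = _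
  rw [FreeAlgebra.basisFreeMonoid, Module.Basis.map_apply, Finsupp.coe_basisSingleOne]
  simpa [word] using this

@[simp] theorem word_nil : word R ([] : List X) = 1 := rfl

theorem word_cons (a : X) (u : List X) : word R (a :: u) = FreeAlgebra.ι R a * word R u := by
  simp [word]

theorem word_append (u v : List X) : word R (u ++ v) = word R u * word R v := by
  simp [word]

theorem word_snoc (u : List X) (a : X) : word R (u ++ [a]) = word R u * FreeAlgebra.ι R a := by
  simp [word]

/-- The linear map with prescribed values on monomials. -/
def linExt {N : Type} [AddCommGroup N] [Module R N] (f : List X → N) : FreeAlgebra R X →ₗ[R] N :=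
  (wordBasis R X).constr R f

@[simp] theorem linExt_word {N : Type} [AddCommGroup N] [Module R N] (f : List X → N)
    (u : List X) : linExt (R := R) f (word R u) = f u := by
  rw [linExt, ← wordBasis_apply, Module.Basis.constr_basis]

/-- The bilinear map with prescribed values on pairs of monomials. -/
def bilinExt {N : Type} [AddCommGroup N] [Module R N] (f : List X → List X → N) :
    FreeAlgebra R X →ₗ[R] FreeAlgebra R X →ₗ[R] N :=
  linExt fun u => linExt fun v => f u v

@[simp] theorem bilinExt_word {N : Type} [AddCommGroup N] [Module R N] (f : List X → List X → N)
    (u v : List X) : bilinExt (R := R) f (word R u) (word R v) = f u v := by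
  simp [bilinExt]

theorem induction_word {p : FreeAlgebra R X → Prop} (w : FreeAlgebra R X)
    (hw : ∀ u, p (word R u)) (h0 : p 0) (hadd : ∀ x y, p x → p y → p (x + y))
    (hsmul : ∀ (c : R) x, p x → p (c • x)) : p w := by
  have hmem : w ∈ Submodule.span R (Set.range (wordBasis R X)) := by
    rw [(wordBasis R X).span_eq]; trivial
  induction hmem using Submodule.span_induction with
  | mem x hx => obtain ⟨u, rfl⟩ := hx; rw [wordBasis_apply]; exact hw u
  | zero => exact h0
  | add x y _ _ hx hy => exact hadd x y hx hy
  | smul c x _ hx => exact hsmul c x hx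

/-- The product of words with `(w a) * (w' b) = (w * w' b) a + (w a * w') b + (w * w') (a ∘ b)`
and unit `1`. Words are read here from right to left: the head of a list is the last letter. -/
def quasiShuffleRev (circ : X → X → FreeAlgebra R X) : List X → List X → FreeAlgebra R X
  | [], v => word R v.reverse
  | a :: u, [] => word R (a :: u).reverse
  | a :: u, b :: v =>
      quasiShuffleRev circ u (b :: v) * FreeAlgebra.ι R a
        + quasiShuffleRev circ (a :: u) v * FreeAlgebra.ι R b
        + quasiShuffleRev circ u v * circ a b
termination_by u v => u.length + v.length

/-- The quasi-shuffle product on a free algebra attached to `circ`, see `quasiShuffle_snoc`. -/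
def quasiShuffle (circ : X → X → FreeAlgebra R X) :
    FreeAlgebra R X →ₗ[R] FreeAlgebra R X →ₗ[R] FreeAlgebra R X :=
  bilinExt fun u v => quasiShuffleRev circ u.reverse v.reverse

theorem quasiShuffle_one_left (circ : X → X → FreeAlgebra R X) (w : FreeAlgebra R X) :
    quasiShuffle circ 1 w = w := by
  induction w using induction_word with
  | hw u => rw [← word_nil, quasiShuffle, bilinExt_word]; simp [quasiShuffleRev]
  | h0 => simp
  | hadd x y hx hy => rw [map_add, hx, hy]
  | hsmul c x hx => rw [map_smul, hx]

theorem quasiShuffle_one_right (circ : X → X → FreeAlgebra R X) (w : FreeAlgebra R X) :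
    quasiShuffle circ w 1 = w := by
  induction w using induction_word with
  | hw u =>
    rw [← word_nil, quasiShuffle, bilinExt_word]
    rcases h : u.reverse with _ | ⟨a, v⟩
    · simp [quasiShuffleRev, List.reverse_eq_nil_iff.mp h]
    · have : u = (a :: v).reverse := by rw [← h, List.reverse_reverse]
      subst this
      simp [quasiShuffleRev]
  | h0 => simp
  | hadd x y hx hy => rw [map_add, LinearMap.add_apply, hx, hy]
  | hsmul c x hx => rw [map_smul, LinearMap.smul_apply, hx]

theorem quasiShuffle_snoc (circ : X → X → FreeAlgebra R X) (w w' : FreeAlgebra R X) (a b : X) :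
    quasiShuffle circ (w * FreeAlgebra.ι R a) (w' * FreeAlgebra.ι R b) =
      quasiShuffle circ w (w' * FreeAlgebra.ι R b) * FreeAlgebra.ι R a
        + quasiShuffle circ (w * FreeAlgebra.ι R a) w' * FreeAlgebra.ι R b
        + quasiShuffle circ w w' * circ a b := by
  induction w using induction_word with
  | hw u =>
    induction w' using induction_word with
    | hw v =>
      simp only [← word_snoc, quasiShuffle, bilinExt_word]
      simp [quasiShuffleRev]
    | h0 => simp
    | hadd x y hx hy => simp only [add_mul, map_add, hx, hy]; abel
    | hsmul c x hx => simp only [smul_mul_assoc, map_smul, hx, smul_add]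
  | h0 => simp
  | hadd x y hx hy => simp only [add_mul, map_add, LinearMap.add_apply, hx, hy]; abel
  | hsmul c x hx => simp only [smul_mul_assoc, map_smul, LinearMap.smul_apply, hx, smul_add]

/-- Transport of a bilinear product along an injective linear map whose range is closed under it. -/
def pullback {V U : Type} [AddCommGroup V] [Module R V] [AddCommGroup U] [Module R U]
    (j : V →ₗ[R] U) (hj : Function.Injective j) (B : U →ₗ[R] U →ₗ[R] U)
    (hB : ∀ v v', B (j v) (j v') ∈ LinearMap.range j) : V →ₗ[R] V →ₗ[R] V :=
  LinearMap.mk₂ R (fun v v' => (LinearEquiv.ofInjective j hj).symm ⟨B (j v) (j v'), hB v v'⟩)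
    (by intro v₁ v₂ v'; rw [← map_add]; congr 1; ext; simp)
    (by intro c v v'; rw [← map_smul]; congr 1; ext; simp)
    (by intro v v₁ v₂; rw [← map_add]; congr 1; ext; simp)
    (by intro c v v'; rw [← map_smul]; congr 1; ext; simp)

theorem pullback_spec {V U : Type} [AddCommGroup V] [Module R V] [AddCommGroup U] [Module R U]
    (j : V →ₗ[R] U) (hj : Function.Injective j) (B : U →ₗ[R] U →ₗ[R] U)
    (hB : ∀ v v', B (j v) (j v') ∈ LinearMap.range j) (v v' : V) :
    j (pullback j hj B hB v v') = B (j v) (j v') := by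
  have := (LinearEquiv.ofInjective j hj).apply_symm_apply ⟨B (j v) (j v'), hB v v'⟩
  exact congrArg Subtype.val this

/-- A linear map between free algebras which sends distinct monomials to nonzero multiples of
distinct monomials is injective. -/
theorem injective_of_word [IsDomain R] (j : FreeAlgebra R Y →ₗ[R] FreeAlgebra R X)
    (c : List Y → R) (hc : ∀ u, c u ≠ 0) (φ : List Y → List X) (hφ : Function.Injective φ)
    (h : ∀ u, j (word R u) = c u • word R (φ u)) : Function.Injective j := by
  classical
  have key : ∀ (u : List Y) (w : FreeAlgebra R Y),
      (wordBasis R X).repr (j w) (φ u) = c u * (wordBasis R Y).repr w u := by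
    intro u w
    induction w using induction_word with
    | hw v =>
      rw [h, ← wordBasis_apply, ← wordBasis_apply, map_smul, Module.Basis.repr_self,
        Module.Basis.repr_self]
      by_cases huv : v = u
      · subst huv; simp
      · have : φ v ≠ φ u := fun e => huv (hφ e)
        simp [huv, this]
    | h0 => simp
    | hadd x y hx hy => simp [hx, hy, mul_add]
    | hsmul d x hx => simp [hx]; ring
  intro w w' hww
  apply (wordBasis R Y).repr.injective
  ext u
  have := (key u w).symm.trans ((congrArg (fun z => (wordBasis R X).repr z (φ u)) hww).trans
    (key u w'))
  exact mul_left_cancel₀ (hc u) this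

/-- The encoding of natural numbers `n₁, n₂, …` by the word `s t^{n₁} s t^{n₂} ⋯` is injective. -/
theorem code_injective {s t : X} (hst : s ≠ t) :
    Function.Injective (fun l : List ℕ => l.flatMap fun n => s :: List.replicate n t) := by
  have aux : ∀ (n m : ℕ) (l l' : List ℕ),
      List.replicate n t ++ l.flatMap (fun n => s :: List.replicate n t) =
        List.replicate m t ++ l'.flatMap (fun n => s :: List.replicate n t) →
      n = m ∧ l.flatMap (fun n => s :: List.replicate n t) =
        l'.flatMap (fun n => s :: List.replicate n t) := by
    intro n
    induction n with
    | zero =>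
      intro m l l' h
      cases m with
      | zero => exact ⟨rfl, by simpa using h⟩
      | succ m =>
        exfalso
        cases l with
        | nil => simp [List.replicate_succ] at h
        | cons p l => simp [List.replicate_succ] at h; exact hst h.1
    | succ n ih =>
      intro m l l' h
      cases m with
      | zero =>
        exfalso
        cases l' with
        | nil => simp [List.replicate_succ] at h
        | cons p l' => simp [List.replicate_succ] at h; exact hst h.1.symm
      | succ m =>
        simp only [List.replicate_succ, List.cons_append, List.cons.injEq, true_and] at h
        obtain ⟨h1, h2⟩ := ih m l l' h
        exact ⟨by rw [h1], h2⟩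
  intro l
  induction l with
  | nil => intro l' h; cases l' with
    | nil => rfl
    | cons p l' => simp at h
  | cons n l ih =>
    intro l' h
    cases l' with
    | nil => simp at h
    | cons m l' =>
      simp only [List.flatMap_cons, List.cons_append, List.cons.injEq, true_and] at h
      obtain ⟨h1, h2⟩ := aux n m l l' h
      rw [h1, ih h2]

open Classical in
/-- `∑_{0 < m₁ < ⋯ < m_r < M} ∏ᵢ F(mᵢ, uᵢ)` for the word `u₁ ⋯ u_r`. -/
def nestedSum {K : Type} [CommRing K] (F : ℕ → X → K) (M : ℕ) (u : List X) : K :=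
  ∑ m ∈ (Fintype.piFinset fun _ : Fin u.length => Finset.Ioo 0 M).filter StrictMono,
    ∏ i, F (m i) (u.get i)

end Generic

/-! ### Multiple zeta values and their regularizations -/

/-- Indices: tuples of positive integers, possibly empty. -/
abbrev Index := List ℕ+

/-- An index is admissible if it is empty or its last component is at least two. -/
def Admissible (k : Index) : Prop := ∀ a ∈ k.getLast?, 2 ≤ a

/-- `ζ_M(k)`. -/
def truncMZV (M : ℕ) (k : Index) : ℝ :=
  nestedSum (fun m (a : ℕ+) => 1 / (m : ℝ) ^ (a : ℕ)) M k

/-- `ζ(k) = lim_{M → ∞} ζ_M(k)`, used for admissible `k`. -/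
def mzv (k : Index) : ℝ := limUnder atTop fun M => truncMZV M k

/-- The `ℚ`-algebra `𝒵` of multiple zeta values. -/
def MZVAlg : Subalgebra ℚ ℝ := Algebra.adjoin ℚ {x | ∃ k, Admissible k ∧ x = mzv k}

/-- The MZV of an admissible index as an element of `𝒵`. -/
def mzvEl (k : Index) (hk : Admissible k) : MZVAlg :=
  ⟨mzv k, Algebra.subset_adjoin ⟨k, hk, rfl⟩⟩

/-- `ζ(2)` as an element of `𝒵`. -/
def zetaTwo : MZVAlg := mzvEl [2] (by simp [Admissible])

/-- The ideal `ζ(2) 𝒵` of `𝒵`. -/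
def zetaTwoIdeal : Ideal MZVAlg := Ideal.span {zetaTwo}

/-- The letters `x, y` of `𝔥 = ℚ⟨x, y⟩`. -/
inductive XY
  | x
  | y

/-- `𝔥 = ℚ⟨x, y⟩`. -/
abbrev H := FreeAlgebra ℚ XY

/-- `𝔥¹ = ℚ + y𝔥`, as the free algebra on the letters `z_k`, `k ≥ 1`; the inclusion into `𝔥`
is `toH`. The monomial `z_k = z_{k₁} ⋯ z_{k_r}` is `word ℚ k`. -/
abbrev H1 := FreeAlgebra ℚ ℕ+

/-- The inclusion `𝔥¹ → 𝔥`, `z_k ↦ y x^{k-1}`. -/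
def toH : H1 →ₐ[ℚ] H :=
  FreeAlgebra.lift ℚ fun k : ℕ+ =>
    FreeAlgebra.ι ℚ XY.y * FreeAlgebra.ι ℚ XY.x ^ ((k : ℕ) - 1)

/-- The harmonic product on `𝔥¹`. -/
def harmonic : H1 →ₗ[ℚ] H1 →ₗ[ℚ] H1 := quasiShuffle fun k l => FreeAlgebra.ι ℚ (k + l)

/-- The shuffle product on `𝔥`. -/
def shuffleH : H →ₗ[ℚ] H →ₗ[ℚ] H := quasiShuffle fun _ _ => 0

theorem shuffleH_snoc (w w' : H) (u v : XY) :
    shuffleH (w * FreeAlgebra.ι ℚ u) (w' * FreeAlgebra.ι ℚ v) =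
      shuffleH w (w' * FreeAlgebra.ι ℚ v) * FreeAlgebra.ι ℚ u
        + shuffleH (w * FreeAlgebra.ι ℚ u) w' * FreeAlgebra.ι ℚ v := by
  simp [shuffleH, quasiShuffle_snoc]

theorem toH_ι (k : ℕ+) : toH (FreeAlgebra.ι ℚ k) =
    FreeAlgebra.ι ℚ XY.y * FreeAlgebra.ι ℚ XY.x ^ ((k : ℕ) - 1) := by
  simp [toH]

theorem toH_injective : Function.Injective toH := by
  refine injective_of_word toH.toLinearMap (fun _ => 1) (fun _ => one_ne_zero)
    (fun u => (u.map fun k : ℕ+ => (k : ℕ) - 1).flatMap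
      fun n => XY.y :: List.replicate n XY.x) ?_ ?_
  · refine (code_injective (by simp)).comp (List.map_injective_iff.mpr ?_)
    intro k l h
    have := k.pos
    have := l.pos
    exact PNat.eq (by simp only at h; omega)
  · intro u
    induction u with
    | nil => simp
    | cons k u ih =>
      simp only [AlgHom.toLinearMap_apply, one_smul] at ih ⊢
      rw [word_cons, map_mul, ih, toH_ι]
      simp only [List.map_cons, List.flatMap_cons, word_append, word_cons]
      simp [word, mul_assoc]

theorem shuffleH_closed_aux (p r : H) (T S : Submodule ℚ H)
    (hT : ∀ t ∈ T, t * FreeAlgebra.ι ℚ XY.x ∈ T)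
    (hS : ∀ t ∈ S, t * FreeAlgebra.ι ℚ XY.y ∈ T)
    (h1 : ∀ l : ℕ, shuffleH p (r * FreeAlgebra.ι ℚ XY.y * FreeAlgebra.ι ℚ XY.x ^ l) ∈ S)
    (h2 : ∀ l : ℕ, shuffleH (p * FreeAlgebra.ι ℚ XY.y * FreeAlgebra.ι ℚ XY.x ^ l) r ∈ S) :
    ∀ n k l : ℕ, k + l = n →
      shuffleH (p * FreeAlgebra.ι ℚ XY.y * FreeAlgebra.ι ℚ XY.x ^ k)
        (r * FreeAlgebra.ι ℚ XY.y * FreeAlgebra.ι ℚ XY.x ^ l) ∈ T := by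
  intro n
  induction n with
  | zero =>
    intro k l h
    obtain ⟨rfl, rfl⟩ : k = 0 ∧ l = 0 := by omega
    have a1 := hS _ (h1 0)
    have a2 := hS _ (h2 0)
    simp only [pow_zero, mul_one] at a1 a2 ⊢
    rw [shuffleH_snoc]
    exact T.add_mem a1 a2
  | succ n ih =>
    intro k l h
    rcases k with _ | k <;> rcases l with _ | l
    · omega
    · have a1 := hS _ (h1 (l + 1))
      have a2 := hT _ (ih 0 l (by omega))
      simp only [pow_zero, mul_one, pow_succ, ← mul_assoc] at a1 a2 ⊢
      rw [shuffleH_snoc]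
      exact T.add_mem a1 a2
    · have a1 := hT _ (ih k 0 (by omega))
      have a2 := hS _ (h2 (k + 1))
      simp only [pow_zero, mul_one, pow_succ, ← mul_assoc] at a1 a2 ⊢
      rw [shuffleH_snoc]
      exact T.add_mem a1 a2
    · have a1 := hT _ (ih k (l + 1) (by omega))
      have a2 := hT _ (ih (k + 1) l (by omega))
      simp only [pow_succ, ← mul_assoc] at a1 a2 ⊢
      rw [shuffleH_snoc]
      exact T.add_mem a1 a2

theorem shuffleH_closed_word (u v : List ℕ+) :
    shuffleH (toH (word ℚ u)) (toH (word ℚ v)) ∈ LinearMap.range toH.toLinearMap := by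
  set S := LinearMap.range toH.toLinearMap with hSdef
  have hSmul : ∀ t ∈ S, ∀ n : ℕ,
      t * FreeAlgebra.ι ℚ XY.y * FreeAlgebra.ι ℚ XY.x ^ n ∈ S := by
    rintro t ⟨s, rfl⟩ n
    refine ⟨s * FreeAlgebra.ι ℚ n.succPNat, ?_⟩
    simp [toH_ι, mul_assoc]
  let T : Submodule ℚ H :=
    { carrier := {t | ∀ n : ℕ, t * FreeAlgebra.ι ℚ XY.x ^ n ∈ S}
      add_mem' := fun {s t} hs ht n => by
        have := S.add_mem (hs n) (ht n)
        rwa [← add_mul] at this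
      zero_mem' := fun n => by simp
      smul_mem' := fun c t ht n => by
        have := S.smul_mem c (ht n)
        rwa [← smul_mul_assoc] at this }
  have hT : ∀ t ∈ T, t * FreeAlgebra.ι ℚ XY.x ∈ T := fun t ht n => by
    rw [mul_assoc, ← pow_succ']
    exact ht (n + 1)
  have hST : ∀ t ∈ S, t * FreeAlgebra.ι ℚ XY.y ∈ T := fun t ht n => hSmul t ht n
  have hTS : ∀ t ∈ T, t ∈ S := fun t ht => by
    have := ht 0
    rwa [pow_zero, mul_one] at this
  induction u using List.reverseRecOn generalizing v with
  | nil =>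
    rw [word_nil, map_one, shuffleH, quasiShuffle_one_left]
    exact ⟨_, rfl⟩
  | append_singleton u k ihu =>
    -- strengthen the last component to an arbitrary positive integer
    suffices h : ∀ m : ℕ, shuffleH
        (toH (word ℚ u) * FreeAlgebra.ι ℚ XY.y * FreeAlgebra.ι ℚ XY.x ^ m)
        (toH (word ℚ v)) ∈ S by
      have := h ((k : ℕ) - 1)
      rwa [mul_assoc, ← toH_ι, ← map_mul, ← word_snoc] at this
    induction v using List.reverseRecOn with
    | nil =>
      intro m
      rw [word_nil, map_one, shuffleH, quasiShuffle_one_right]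
      exact hSmul _ ⟨_, rfl⟩ m
    | append_singleton v l ihv =>
      intro m
      rw [word_snoc, map_mul toH, toH_ι, ← mul_assoc]
      refine hTS _ (shuffleH_closed_aux _ _ T S hT hST ?_ ihv _ m _ rfl)
      intro n
      have := ihu (v ++ [n.succPNat])
      rw [word_snoc, map_mul, toH_ι, ← mul_assoc] at this
      simpa using this

theorem shuffleH_closed (w w' : H1) :
    shuffleH (toH.toLinearMap w) (toH.toLinearMap w') ∈ LinearMap.range toH.toLinearMap := by
  induction w using induction_word with
  | hw u =>
    induction w' using induction_word with
    | hw v => exact shuffleH_closed_word u v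
    | h0 => simp
    | hadd x y hx hy => simp only [map_add]; exact Submodule.add_mem _ hx hy
    | hsmul c x hx => simp only [map_smul]; exact Submodule.smul_mem _ c hx
  | h0 => simp
  | hadd x y hx hy => simp only [map_add, LinearMap.add_apply]; exact Submodule.add_mem _ hx hy
  | hsmul c x hx =>
    simp only [map_smul, LinearMap.smul_apply]; exact Submodule.smul_mem _ c hx

/-- The shuffle product on `𝔥¹`, the restriction of the one on `𝔥`. -/
def shuffle : H1 →ₗ[ℚ] H1 →ₗ[ℚ] H1 :=
  pullback toH.toLinearMap toH_injective shuffleH shuffleH_closed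

theorem toH_shuffle (w w' : H1) : toH (shuffle w w') = shuffleH (toH w) (toH w') :=
  pullback_spec toH.toLinearMap toH_injective shuffleH shuffleH_closed w w'

/-- `Φ` is a `ℚ`-algebra homomorphism from `𝔥¹`, with the product `mul`, to `𝒵[T]` which extends
`z_k ↦ ζ(k)` (`k` admissible) and sends `y = z₁` to `T`. -/
structure IsRegularization (mul : H1 →ₗ[ℚ] H1 →ₗ[ℚ] H1) (Φ : H1 →ₗ[ℚ] Polynomial MZVAlg) :
    Prop where
  map_one : Φ 1 = 1
  map_mul : ∀ w w', Φ (mul w w') = Φ w * Φ w'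
  map_y : Φ (FreeAlgebra.ι ℚ 1) = Polynomial.X
  map_admissible : ∀ k (hk : Admissible k), Φ (word ℚ k) = Polynomial.C (mzvEl k hk)

/-- The regularization `Z^•` for the product `mul`: the unique map with `IsRegularization`. -/
def regMap (mul : H1 →ₗ[ℚ] H1 →ₗ[ℚ] H1) : H1 →ₗ[ℚ] Polynomial MZVAlg :=
  Classical.epsilon (IsRegularization mul)

/-- The regularized value `ζ^•(k) = Z^•(z_k)|_{T = 0}`. -/
def regMZV (mul : H1 →ₗ[ℚ] H1 →ₗ[ℚ] H1) (k : Index) : MZVAlg :=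
  (regMap mul (word ℚ k)).eval 0

/-- The weight of an index. -/
def weight (k : Index) : ℕ := (k.map fun a : ℕ+ => (a : ℕ)).sum

/-- `∑_{i=0}^r (-1)^{k_{i+1}+⋯+k_r} ζ^•(k₁, …, k_i) ζ^•(k_r, …, k_{i+1})`. -/
def symMZV (mul : H1 →ₗ[ℚ] H1 →ₗ[ℚ] H1) (k : Index) : MZVAlg :=
  ∑ i ∈ Finset.range (k.length + 1),
    (-1) ^ weight (k.drop i) * regMZV mul (k.take i) * regMZV mul (k.drop i).reverse

/-- `ζ^{𝒮,∗}(k)`. -/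
def symMZVStar (k : Index) : MZVAlg := symMZV harmonic k

/-- `ζ^{𝒮,sh}(k)`. -/
def symMZVSh (k : Index) : MZVAlg := symMZV shuffle k

/-! ### The algebraic side of the `q`-analogue -/

/-- `𝒞 = ℚ[ħ]`. -/
abbrev C := Polynomial ℚ

/-- The formal variable `ħ`. -/
def hbar : C := Polynomial.X

/-- The letters `a, b` of `ℌ = 𝒞⟨a, b⟩`. -/
inductive AB
  | a
  | b

/-- `ℌ = 𝒞⟨a, b⟩`. -/
abbrev HH := FreeAlgebra C AB

/-- The element `a` of `ℌ`. -/
def la : HH := FreeAlgebra.ι C AB.a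

/-- The element `b` of `ℌ`. -/
def lb : HH := FreeAlgebra.ι C AB.b

/-- The set `A = {ħb} ∪ {g_k | k ≥ 1}`, with `hb` standing for `ħb = e₁ - g₁`
and `g k` for `g_k = b a^k`. -/
inductive Letter
  | hb
  | g (k : ℕ+)

/-- `𝒞⟨A⟩`: as `A` is algebraically independent, the free algebra on `A`; its embedding into `ℌ`
is `toHH`. -/
abbrev CA := FreeAlgebra C Letter

/-- The element `ħb = e₁ - g₁` of `𝒞⟨A⟩`. -/
def hb : CA := FreeAlgebra.ι C Letter.hb

/-- The element `g_k = b a^k` of `𝒞⟨A⟩`. -/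
def g (k : ℕ+) : CA := FreeAlgebra.ι C (Letter.g k)

/-- The value of a letter in `ℌ`. -/
def letterHH : Letter → HH
  | Letter.hb => hbar • lb
  | Letter.g k => lb * la ^ (k : ℕ)

/-- The embedding `𝒞⟨A⟩ → ℌ`. -/
def toHH : CA →ₐ[C] HH := FreeAlgebra.lift C letterHH

theorem toHH_ι (u : Letter) : toHH (FreeAlgebra.ι C u) = letterHH u := by simp [toHH]

theorem toHH_hb : toHH hb = hbar • lb := toHH_ι _

theorem toHH_g (k : ℕ+) : toHH (g k) = lb * la ^ (k : ℕ) := toHH_ι _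

/-- The exponent of `a` in a letter of `A`. -/
def Letter.exponent : Letter → ℕ
  | Letter.hb => 0
  | Letter.g k => k

theorem toHH_injective : Function.Injective toHH := by
  refine injective_of_word toHH.toLinearMap
    (fun u => (u.map fun p : Letter => match p with
      | Letter.hb => hbar
      | Letter.g _ => 1).prod) ?_
    (fun u => (u.map Letter.exponent).flatMap fun n => AB.b :: List.replicate n AB.a) ?_ ?_
  · intro u h
    rw [List.prod_eq_zero_iff, List.mem_map] at h
    obtain ⟨p, -, hp⟩ := h
    cases p with
    | hb => exact Polynomial.X_ne_zero hp
    | g k => exact one_ne_zero hp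
  · refine (code_injective (by simp)).comp (List.map_injective_iff.mpr ?_)
    intro p q h
    cases p with
    | hb => cases q with
      | hb => rfl
      | g l => exact absurd h.symm l.pos.ne'
    | g k => cases q with
      | hb => exact absurd h k.pos.ne'
      | g l => exact congrArg Letter.g (PNat.eq h)
  · intro u
    induction u with
    | nil => simp
    | cons p u ih =>
      simp only [AlgHom.toLinearMap_apply] at ih ⊢
      rw [word_cons, map_mul, ih, toHH_ι]
      simp only [List.map_cons, List.flatMap_cons, word_append, word_cons, List.prod_cons]
      cases p with
      | hb =>
        simp only [letterHH, Letter.exponent, lb, mul_smul, List.replicate_zero, word_nil, mul_one,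
          smul_mul_assoc, mul_smul_comm]
        rw [smul_comm]
      | g k => simp [letterHH, Letter.exponent, lb, la, word, mul_assoc]

/-- The element `e_k = b(a + ħ)a^{k-1}` of `𝒞⟨A⟩`: `e₁ = ħb + g₁` and `e_k = g_k + ħ g_{k-1}`
for `k ≥ 2`, see `toHH_e`. -/
def e (k : ℕ+) : CA := if k = 1 then hb + g 1 else g k + hbar • g (k - 1)

theorem toHH_e (k : ℕ+) :
    toHH (e k) = lb * (la + algebraMap C HH hbar) * la ^ ((k : ℕ) - 1) := by
  by_cases hk : k = 1
  · subst hk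
    simp [e, toHH_hb, toHH_g, mul_add, Algebra.smul_def, (Algebra.commutes hbar lb).symm, add_comm]
  · have h1 : 1 < k := lt_of_le_of_ne one_le (Ne.symm hk)
    have h2 : ((k - 1 : ℕ+) : ℕ) = (k : ℕ) - 1 := by
      rw [PNat.sub_coe, if_pos h1]; rfl
    have h3 : (k : ℕ) = ((k : ℕ) - 1) + 1 := by have := k.pos; omega
    rw [e, if_neg hk, map_add, map_smul, toHH_g, toHH_g, h2]
    conv_lhs => rw [h3]
    rw [Algebra.smul_def, pow_succ', Nat.add_sub_cancel, mul_add, add_mul,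
      ← mul_assoc, ← mul_assoc, (Algebra.commutes hbar lb)]

/-- The map `∘_ħ` on letters. -/
def circ : Letter → Letter → CA
  | Letter.hb, Letter.hb => hbar • hb
  | Letter.hb, Letter.g k => hbar • g k
  | Letter.g k, Letter.hb => hbar • g k
  | Letter.g k, Letter.g l => g (k + l)

/-- The harmonic product `∗_ħ` on `𝒞⟨A⟩`. -/
def qHarmonic : CA →ₗ[C] CA →ₗ[C] CA := quasiShuffle circ

/-- The shuffle product `sh_ħ` of two words of `ℌ`, read from right to left. -/
def qShuffleRev : List AB → List AB → HH
  | [], v => word C v.reverse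
  | u, [] => word C u.reverse
  | AB.b :: u, p :: v => qShuffleRev u (p :: v) * lb
  | AB.a :: u, AB.b :: v => qShuffleRev (AB.a :: u) v * lb
  | AB.a :: u, AB.a :: v =>
      (qShuffleRev (AB.a :: u) v + qShuffleRev u (AB.a :: v) + hbar • qShuffleRev u v) * la
termination_by u v => u.length + v.length

/-- The shuffle product `sh_ħ` on `ℌ`; its defining properties are proved below. -/
def qShuffleHH : HH →ₗ[C] HH →ₗ[C] HH :=
  bilinExt fun u v => qShuffleRev u.reverse v.reverse

theorem qShuffleRev_nil (u : List AB) : qShuffleRev u [] = word C u.reverse := by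
  cases u <;> simp [qShuffleRev]

theorem qShuffleRev_b_left (u v : List AB) :
    qShuffleRev (AB.b :: u) v = qShuffleRev u v * lb := by
  cases v with
  | nil => simp [qShuffleRev_nil, word, lb]
  | cons p v => simp [qShuffleRev]

theorem qShuffleRev_b_right (u v : List AB) :
    qShuffleRev u (AB.b :: v) = qShuffleRev u v * lb := by
  induction u with
  | nil => simp [qShuffleRev, word, lb]
  | cons p u ih =>
    cases p with
    | a => simp [qShuffleRev]
    | b => rw [qShuffleRev_b_left, qShuffleRev_b_left, ih]

theorem qShuffle_one_left (w : HH) : qShuffleHH 1 w = w := by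
  induction w using induction_word with
  | hw u => rw [← word_nil, qShuffleHH, bilinExt_word]; simp [qShuffleRev]
  | h0 => simp
  | hadd x y hx hy => rw [map_add, hx, hy]
  | hsmul c x hx => rw [map_smul, hx]

theorem qShuffle_one_right (w : HH) : qShuffleHH w 1 = w := by
  induction w using induction_word with
  | hw u => rw [← word_nil, qShuffleHH, bilinExt_word]; simp [qShuffleRev_nil]
  | h0 => simp
  | hadd x y hx hy => rw [map_add, LinearMap.add_apply, hx, hy]
  | hsmul c x hx => rw [map_smul, LinearMap.smul_apply, hx]

theorem qShuffle_b_left (w w' : HH) : qShuffleHH (w * lb) w' = qShuffleHH w w' * lb := by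
  induction w using induction_word with
  | hw u =>
    induction w' using induction_word with
    | hw v =>
      rw [lb, ← word_snoc, qShuffleHH, bilinExt_word, bilinExt_word]
      simp [qShuffleRev_b_left, lb]
    | h0 => simp
    | hadd x y hx hy => simp only [map_add, add_mul, hx, hy]
    | hsmul c x hx => simp only [map_smul, smul_mul_assoc, hx]
  | h0 => simp
  | hadd x y hx hy => simp only [map_add, add_mul, LinearMap.add_apply, hx, hy]
  | hsmul c x hx => simp only [map_smul, smul_mul_assoc, LinearMap.smul_apply, hx]

theorem qShuffle_b_right (w w' : HH) : qShuffleHH w (w' * lb) = qShuffleHH w w' * lb := by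
  induction w using induction_word with
  | hw u =>
    induction w' using induction_word with
    | hw v =>
      rw [lb, ← word_snoc, qShuffleHH, bilinExt_word, bilinExt_word]
      simp [qShuffleRev_b_right, lb]
    | h0 => simp
    | hadd x y hx hy => simp only [map_add, add_mul, hx, hy]
    | hsmul c x hx => simp only [map_smul, smul_mul_assoc, hx]
  | h0 => simp
  | hadd x y hx hy => simp only [map_add, add_mul, LinearMap.add_apply, hx, hy]
  | hsmul c x hx => simp only [map_smul, smul_mul_assoc, LinearMap.smul_apply, hx]

theorem qShuffle_a (w w' : HH) : qShuffleHH (w * la) (w' * la) =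
    (qShuffleHH (w * la) w' + qShuffleHH w (w' * la) + hbar • qShuffleHH w w') * la := by
  induction w using induction_word with
  | hw u =>
    induction w' using induction_word with
    | hw v =>
      simp only [la, ← word_snoc, qShuffleHH, bilinExt_word]
      simp [qShuffleRev, la]
    | h0 => simp
    | hadd x y hx hy => simp only [map_add, add_mul, smul_add, hx, hy]; abel
    | hsmul c x hx =>
      simp only [map_smul, smul_mul_assoc, hx, smul_add, add_mul, smul_comm hbar c]
  | h0 => simp
  | hadd x y hx hy =>
    simp only [map_add, add_mul, smul_add, LinearMap.add_apply, hx, hy]; abel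
  | hsmul c x hx =>
    simp only [map_smul, smul_mul_assoc, LinearMap.smul_apply, hx, smul_add, add_mul,
      smul_comm hbar c]

theorem qShuffle_closed_aux (p r : HH) (T S : Submodule C HH)
    (hT : ∀ t ∈ T, t * la ∈ T) (hS : ∀ t ∈ S, t * lb * la ∈ T)
    (hb' : ∀ t ∈ S, hbar • (t * lb) ∈ S) (h0 : qShuffleHH p r ∈ S)
    (h1 : ∀ l : ℕ, qShuffleHH p (r * lb * la ^ (l + 1)) ∈ S)
    (h2 : ∀ l : ℕ, qShuffleHH (p * lb * la ^ (l + 1)) r ∈ S) :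
    ∀ n k l : ℕ, k + l = n →
      qShuffleHH (p * lb * la ^ (k + 1)) (r * lb * la ^ (l + 1)) ∈ T := by
  have hbT : ∀ t ∈ S, hbar • (t * lb * la) ∈ T := fun t ht => T.smul_mem _ (hS t ht)
  intro n
  induction n using Nat.strong_induction_on with
  | _ n ih =>
    intro k l h
    rcases k with _ | k <;> rcases l with _ | l
    · have a1 := hS _ (h2 0)
      have a2 := hS _ (h1 0)
      have a3 := hS _ (hb' _ h0)
      simp only [zero_add, pow_one] at a1 a2 ⊢
      rw [qShuffle_a, qShuffle_b_right, qShuffle_b_left, qShuffle_b_left, qShuffle_b_right,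
        add_mul, add_mul]
      refine T.add_mem (T.add_mem a1 a2) ?_
      simpa only [smul_mul_assoc] using a3
    · have a1 := hT _ (ih l (by omega) 0 l (by omega))
      have a2 := hS _ (h1 (l + 1))
      have a3 := hbT _ (h1 l)
      rw [pow_succ la (l + 1), ← mul_assoc] at a2 ⊢
      simp only [zero_add, pow_one] at a1 ⊢
      rw [qShuffle_a, qShuffle_b_left, qShuffle_b_left, add_mul, add_mul]
      refine T.add_mem (T.add_mem a1 a2) ?_
      simpa only [smul_mul_assoc] using a3
    · have a1 := hT _ (ih k (by omega) k 0 (by omega))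
      have a2 := hS _ (h2 (k + 1))
      have a3 := hbT _ (h2 k)
      rw [pow_succ la (k + 1), ← mul_assoc] at a2 ⊢
      simp only [zero_add, pow_one] at a1 ⊢
      rw [qShuffle_a, qShuffle_b_right, qShuffle_b_right, add_mul, add_mul]
      refine T.add_mem (T.add_mem a2 a1) ?_
      simpa only [smul_mul_assoc] using a3
    · have a1 := hT _ (ih (k + (l + 1)) (by omega) k (l + 1) rfl)
      have a2 := hT _ (ih (k + 1 + l) (by omega) (k + 1) l rfl)
      have a3 := T.smul_mem hbar (hT _ (ih (k + l) (by omega) k l rfl))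
      rw [pow_succ la (l + 1), ← mul_assoc] at a1 ⊢
      rw [pow_succ la (k + 1), ← mul_assoc] at a2 ⊢
      rw [qShuffle_a, add_mul, add_mul]
      refine T.add_mem (T.add_mem a2 a1) ?_
      simpa only [smul_mul_assoc] using a3

theorem qShuffle_closed_word (u v : List Letter) :
    qShuffleHH (toHH (word C u)) (toHH (word C v)) ∈ LinearMap.range toHH.toLinearMap := by
  set S := LinearMap.range toHH.toLinearMap with hSdef
  have hSg : ∀ t ∈ S, ∀ n : ℕ, t * lb * la ^ (n + 1) ∈ S := by
    rintro t ⟨s, rfl⟩ n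
    refine ⟨s * g n.succPNat, ?_⟩
    simp [toHH_g, mul_assoc]
  have hShb : ∀ t ∈ S, hbar • (t * lb) ∈ S := by
    rintro t ⟨s, rfl⟩
    refine ⟨s * hb, ?_⟩
    simp [toHH_hb]
  let T : Submodule C HH :=
    { carrier := {t | ∀ n : ℕ, t * la ^ n ∈ S}
      add_mem' := fun {s t} hs ht n => by
        have := S.add_mem (hs n) (ht n)
        rwa [← add_mul] at this
      zero_mem' := fun n => by simp
      smul_mem' := fun c t ht n => by
        have := S.smul_mem c (ht n)
        rwa [← smul_mul_assoc] at this }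
  have hT : ∀ t ∈ T, t * la ∈ T := fun t ht n => by
    rw [mul_assoc, ← pow_succ']
    exact ht (n + 1)
  have hST : ∀ t ∈ S, t * lb * la ∈ T := fun t ht n => by
    rw [mul_assoc (t * lb), ← pow_succ']
    exact hSg t ht n
  have hTS : ∀ t ∈ T, t ∈ S := fun t ht => by
    have := ht 0
    rwa [pow_zero, mul_one] at this
  have hg : ∀ (u : List Letter) (k : ℕ+), toHH (word C (u ++ [Letter.g k])) =
      toHH (word C u) * lb * la ^ ((k : ℕ) - 1 + 1) := fun u k => by
    rw [word_snoc, map_mul, toHH_ι, letterHH, mul_assoc, Nat.sub_add_cancel k.pos]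
  have hh : ∀ (u : List Letter), toHH (word C (u ++ [Letter.hb])) =
      hbar • (toHH (word C u) * lb) := fun u => by
    rw [word_snoc, map_mul, toHH_ι, letterHH, mul_smul_comm]
  induction u using List.reverseRecOn generalizing v with
  | nil => rw [word_nil, map_one, qShuffle_one_left]; exact ⟨_, rfl⟩
  | append_singleton u p ihu =>
    cases p with
    | hb =>
      rw [hh, map_smul, LinearMap.smul_apply, qShuffle_b_left]
      exact hShb _ (ihu v)
    | g k =>
      rw [hg]
      generalize (k : ℕ) - 1 = m
      induction v using List.reverseRecOn generalizing m with
      | nil =>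
        rw [word_nil, map_one, qShuffle_one_right]
        exact hSg _ ⟨_, rfl⟩ m
      | append_singleton v q ihv =>
        cases q with
        | hb =>
          rw [hh, map_smul, qShuffle_b_right]
          exact hShb _ (ihv m)
        | g l =>
          rw [hg]
          refine hTS _ (qShuffle_closed_aux _ _ T S hT hST hShb (ihu v) ?_ ihv _ m _ rfl)
          intro n
          have := ihu (v ++ [Letter.g n.succPNat])
          rw [hg] at this
          simpa using this

theorem qShuffle_closed (w w' : CA) :
    qShuffleHH (toHH.toLinearMap w) (toHH.toLinearMap w') ∈ LinearMap.range toHH.toLinearMap := by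
  induction w using induction_word with
  | hw u =>
    induction w' using induction_word with
    | hw v => exact qShuffle_closed_word u v
    | h0 => simp
    | hadd x y hx hy => simp only [map_add]; exact Submodule.add_mem _ hx hy
    | hsmul c x hx => simp only [map_smul]; exact Submodule.smul_mem _ c hx
  | h0 => simp
  | hadd x y hx hy => simp only [map_add, LinearMap.add_apply]; exact Submodule.add_mem _ hx hy
  | hsmul c x hx =>
    simp only [map_smul, LinearMap.smul_apply]; exact Submodule.smul_mem _ c hx

/-- The shuffle product `sh_ħ` on `𝒞⟨A⟩`, the restriction of the one on `ℌ`. -/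
def qShuffle : CA →ₗ[C] CA →ₗ[C] CA :=
  pullback toHH.toLinearMap toHH_injective qShuffleHH qShuffle_closed

theorem toHH_qShuffle (w w' : CA) : toHH (qShuffle w w') = qShuffleHH (toHH w) (toHH w') :=
  pullback_spec toHH.toLinearMap toHH_injective qShuffleHH qShuffle_closed w w'

/-- The anti-homomorphism of `𝒞`-algebras `𝒞⟨A⟩ → 𝒞⟨A⟩` with prescribed values on `A`. -/
def antiHom (f : Letter → CA) : CA →ₗ[C] CA :=
  (MulOpposite.opLinearEquiv C).symm.toLinearMap ∘ₗ
    (FreeAlgebra.lift C fun u => MulOpposite.op (f u)).toLinearMap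

theorem antiHom_mul (f : Letter → CA) (w w' : CA) :
    antiHom f (w * w') = antiHom f w' * antiHom f w := by
  simp [antiHom]

theorem antiHom_ι (f : Letter → CA) (u : Letter) : antiHom f (FreeAlgebra.ι C u) = f u := by
  simp [antiHom]

theorem toHH_range : toHH.range =
    Algebra.adjoin C ({hbar • lb} ∪ {x | ∃ k : ℕ+, x = lb * la ^ (k : ℕ)}) := by
  rw [toHH, ← Algebra.adjoin_range_eq_range_freeAlgebra_lift]
  congr 1
  ext x
  constructor
  · rintro ⟨u, rfl⟩
    cases u with
    | hb => exact Or.inl rfl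
    | g k => exact Or.inr ⟨k, rfl⟩
  · rintro (rfl | ⟨k, rfl⟩)
    · exact ⟨Letter.hb, rfl⟩
    · exact ⟨Letter.g k, rfl⟩

/-- `ψ^∗(ħb) = ħb`, `ψ^∗(b a^k) = b (-a)^k`. -/
def psiStarLetter : Letter → CA
  | Letter.hb => hb
  | Letter.g k => (-1 : C) ^ (k : ℕ) • g k

/-- `ψ^sh(ħb) = ħb`, `ψ^sh(b a^k) = b (-a-ħ)^k`, see `toHH_psiShLetter`. -/
def psiShLetter : Letter → CA
  | Letter.hb => hb
  | Letter.g k => (-1 : C) ^ (k : ℕ) • (hbar ^ ((k : ℕ) - 1) • hb +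
      ∑ j ∈ Finset.range k, (((k : ℕ).choose (j + 1) : C) * hbar ^ ((k : ℕ) - (j + 1))) •
        g j.succPNat)

theorem toHH_psiStarLetter (k : ℕ+) :
    toHH (psiStarLetter (Letter.g k)) = lb * (-la) ^ (k : ℕ) := by
  rw [psiStarLetter, map_smul, toHH_g, neg_pow la, Algebra.smul_def]
  simp only [map_pow, map_neg, map_one]
  rw [← mul_assoc, ← mul_assoc, ((Commute.neg_one_left lb).pow_left _).eq]

theorem toHH_psiShLetter (k : ℕ+) :
    toHH (psiShLetter (Letter.g k)) = lb * (-la - algebraMap C HH hbar) ^ (k : ℕ) := by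
  have hc : Commute la (algebraMap C HH hbar) := (Algebra.commutes hbar la).symm
  have h1 : -la - algebraMap C HH hbar = (-1 : C) • (la + algebraMap C HH hbar) := by
    have h3 : ∀ x : HH, (-1 : C) • x = -x := fun x => by
      have := neg_smul (1 : C) x
      rwa [one_smul] at this
    rw [h3]; abel
  have h2 : hbar ^ ((k : ℕ) - 1) * hbar = hbar ^ (k : ℕ) := by
    rw [← pow_succ, Nat.sub_add_cancel k.pos]
  rw [h1, smul_pow, hc.add_pow, psiShLetter, map_smul, mul_smul_comm, map_add, map_smul, toHH_hb,
    smul_smul, h2, map_sum, Finset.sum_range_succ', mul_add, add_comm, Finset.mul_sum]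
  congr 2
  · refine Finset.sum_congr rfl fun j _ => ?_
    rw [map_smul, toHH_g, Algebra.smul_def, Algebra.commutes, map_mul, map_natCast, map_pow,
      Nat.succPNat_coe, Nat.succ_eq_add_one, (Nat.cast_commute _ _).eq]
    simp only [mul_assoc]
  · simp only [pow_zero, one_mul, Nat.sub_zero, Nat.choose_zero_right, Nat.cast_one, mul_one,
      ← map_pow]
    rw [Algebra.smul_def, Algebra.commutes]

/-- The anti-involution `ψ^∗`. -/
def psiStar : CA →ₗ[C] CA := antiHom psiStarLetter

/-- The anti-involution `ψ^sh`. -/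
def psiSh : CA →ₗ[C] CA := antiHom psiShLetter

/-- The linear map `u₁ ⋯ u_r ↦ ∑_{i=0}^r u₁ ⋯ u_i • ψ(u_{i+1} ⋯ u_r)` on `𝒞⟨A⟩`,
for a product `•` and a map `ψ`. -/
def symmetrize (mul : CA →ₗ[C] CA →ₗ[C] CA) (ψ : CA →ₗ[C] CA) : CA →ₗ[C] CA :=
  linExt fun u => ∑ i ∈ Finset.range (u.length + 1),
    mul (word C (u.take i)) (ψ (word C (u.drop i)))

/-- `w_ħ^{𝒮,∗}`. -/
def wSymStar : CA →ₗ[C] CA := symmetrize qHarmonic psiStar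

/-- `w_ħ^{𝒮,sh}`. -/
def wSymSh : CA →ₗ[C] CA := symmetrize qShuffle psiSh

/-- `g_k = g_{k₁} ⋯ g_{k_r}`. -/
def gIndex (k : Index) : CA := (k.map g).prod

/-- `E_{1^m} = 1/(m+1)! ∑_{j=0}^m g₁^{sh j} sh e₁^{sh (m-j)}`. -/
def EOnes (m : ℕ) : CA :=
  (Polynomial.C (1 / ((m + 1).factorial : ℚ)) : C) • ∑ j ∈ Finset.range (m + 1),
    qShuffle ((qShuffle (g 1))^[j] 1) ((qShuffle (e 1))^[m - j] 1)

/-- `EAux s k` is `E` of the index consisting of `s` ones followed by `k`. -/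
def EAux : ℕ → Index → CA
  | s, [] => EOnes s
  | s, a :: k => if a = 1 then EAux (s + 1) k else EOnes s * e a * EAux 0 k

/-- `E_k = E_{1^{s₀}} e_{t₁+2} E_{1^{s₁}} ⋯ e_{t_r+2} E_{1^{s_r}}` for
`k = (1^{s₀}, t₁+2, 1^{s₁}, …, t_r+2, 1^{s_r})`. -/
def EIndex (k : Index) : CA := EAux 0 k

/-! The submodules of `𝒞⟨A⟩`. -/

/-- `𝒞 + ∑_{k ≥ 1} 𝒞⟨A⟩ g_k`. -/
def hatH0 : Submodule C CA := Submodule.span C ({1} ∪ {x | ∃ w k, x = w * g k})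

/-- `(e₁-g₁)^{α₁} g_{β₁+1} ⋯ (e₁-g₁)^{α_r} g_{β_r+1}` for the list of the pairs `(αᵢ, βᵢ)`. -/
def basisMonomial (l : List (ℕ × ℕ)) : CA :=
  (l.map fun p => hb ^ p.1 * g p.2.succPNat).prod

/-- `𝔫₀`: spanned by the `basisMonomial`s with `α_s, β_t ≥ 1` for some `s ≤ t`. -/
def n0 : Submodule C CA :=
  Submodule.span C {x | ∃ l : List (ℕ × ℕ), (∃ s t : Fin l.length, s ≤ t ∧ 1 ≤ (l.get s).1 ∧
    1 ≤ (l.get t).2) ∧ x = basisMonomial l}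

/-- `𝔫 = 𝔫₀ + ħ hatH0`. -/
def nMod : Submodule C CA := n0 ⊔ hatH0.map (LinearMap.lsmul C CA hbar)

/-- `ℌ⁰ = 𝒞 + ∑_{k ≥ 2} 𝒞⟨A⟩ g_k + 𝔫`. -/
def H0 : Submodule C CA := Submodule.span C ({1} ∪ {x | ∃ w k, 2 ≤ k ∧ x = w * g k}) ⊔ nMod

/-! ### The analytic side of the `q`-analogue -/

/-- Complex parameters `q` with `0 < |q| < 1`. -/
abbrev QParam := {q : ℂ // 0 < ‖q‖ ∧ ‖q‖ < 1}

/-- The limit `q → 1 - 0` along real parameters. -/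
def qToOne : Filter QParam := comap (fun q => (q : ℂ)) (map (fun x : ℝ => (x : ℂ)) (𝓝[<] 1))

instance : qToOne.NeBot := by
  rw [qToOne, comap_neBot_iff_frequently]
  refine Eventually.frequently ?_
  rw [eventually_map]
  have h : ∀ᶠ x : ℝ in 𝓝[<] 1, x ∈ Set.Ioo (0 : ℝ) 1 := Ioo_mem_nhdsLT one_pos
  filter_upwards [h] with x hx
  have hn : ‖(x : ℂ)‖ = x := by rw [Complex.norm_real, Real.norm_of_nonneg hx.1.le]
  exact ⟨⟨x, by rw [hn]; exact hx.1, by rw [hn]; exact hx.2⟩, rfl⟩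

/-- The ring homomorphism `𝒞 = ℚ[ħ] → ℂ`, `ħ ↦ 1 - q`. -/
def evalHbar (q : ℂ) : C →+* ℂ := Polynomial.eval₂RingHom (algebraMap ℚ ℂ) (1 - q)

/-- The `q`-integer `[m]`. -/
def qInt (q : ℂ) (m : ℕ) : ℂ := (1 - q ^ m) / (1 - q)

/-- `F_q(m; u)` for `u ∈ A`. -/
def Fq (q : ℂ) (m : ℕ) : Letter → ℂ
  | Letter.hb => 1 - q
  | Letter.g k => q ^ ((k : ℕ) * m) / qInt q m ^ (k : ℕ)

/-- `Z_{q,M}`: the additive map on `𝒞⟨A⟩` on which `ħ` acts as `1 - q`, with value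
`∑_{0 < m₁ < ⋯ < m_r < M} ∏ F_q(mᵢ; uᵢ)` on `u₁ ⋯ u_r`. -/
def truncZq (q : ℂ) (M : ℕ) (w : CA) : ℂ :=
  ((wordBasis C Letter).repr w).sum fun u c => evalHbar q c * nestedSum (Fq q) M u

theorem truncZq_word (q : ℂ) (M : ℕ) (u : List Letter) :
    truncZq q M (word C u) = nestedSum (Fq q) M u := by
  simp [truncZq, ← wordBasis_apply]

/-- `Z_q(w) = lim_{M → ∞} Z_{q,M}(w)`, as a function of `q`, used for `w ∈ hatH0`. -/
def Zq (w : CA) (q : QParam) : ℂ := limUnder atTop fun M => truncZq q M w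

/-- `Z_q^{𝒮,∗}(w) = lim_{M → ∞} Z_{q,M}(w_ħ^{𝒮,∗}(w))`. -/
def ZqSymStar (w : CA) : QParam → ℂ := Zq (wSymStar w)

/-- `Z_q^{𝒮,sh}(w) = lim_{M → ∞} Z_{q,M}(w_ħ^{𝒮,sh}(w))`. -/
def ZqSymSh (w : CA) : QParam → ℂ := Zq (wSymSh w)

/-- `𝒵_q = Z_q(ℌ⁰)`, as a space of functions of `q`. -/
def ZqSpace : Submodule ℚ (QParam → ℂ) := Submodule.span ℚ (Zq '' H0)

/-- `𝒩_q = Z_q(𝔫)`. -/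
def Nq : Submodule ℚ (QParam → ℂ) := Submodule.span ℚ (Zq '' nMod)

/-- `𝒫_q`, the ideal of `𝒵_q` generated by the `Z_q(g_{2k})`, `k ≥ 1`: the span of their multiples
by elements of `𝒵_q`. -/
def Pq : Submodule ℚ (QParam → ℂ) :=
  Submodule.span ℚ {h | ∃ k : ℕ+, ∃ f ∈ ZqSpace, h = Zq (g (2 * k)) * f}

/-- `𝒩_q + 𝒫_q` inside `𝒵_q`. -/
def NPq : Submodule ℚ ZqSpace := (Nq ⊔ Pq).comap ZqSpace.subtype

end

end QSMZV

/-! Everything rests on one statement, `hasLimit_H0`: for `w ∈ ℌ⁰` the function `Z_q(w)` tends to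
`ζ` of the reduction of `w` modulo `ħ`, where `ħ` and `ħb` become `0` and `g_k` becomes `z_k`
(`toH1`).

Analysis. For real `x < 1` one has `x^m / [m] ≤ 1/m`. Hence for a word in the `g_k` whose last index
is at least two the convergent series of the MZV is a majorant, and dominated convergence gives the
limit (`tendsto_Zq_admissible`). In any word ending in some `g_k`, each letter is bounded by `1 - x`
or `1/m`, and the last one also supplies the damping `√x^m`. This damping is shared among all
variables, so the sum is at most a power of `log(1/(1-x))` up to constants
(`nestedSum_Fr_le_growth`). A factor `ħ`, or a letter `ħb` somewhere before a `g_k` with `k ≥ 2`,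
gains a factor `1 - x`, and such terms tend to `0`. These are exactly the elements of `𝔫` and the
words with `ħb` in `ℌ⁰`.

Regularization. Removal of a last `z₁` is a locally nilpotent derivation for both products. It sends
`z₁` to `1`, and its kernel is spanned by the admissible words. Hence `𝔥¹` is a polynomial ring in
`z₁` over this kernel, and `ζ` extends uniquely once it is multiplicative there
(`existsUnique_extension`). For the harmonic product this holds already for truncated sums; for the
shuffle product it follows from power series of multiple polylogarithms. The symmetrized word is
killed by the derivation because its terms cancel in pairs. So its regularization does not involve
`T`, and `ζ^{𝒮,•}(k)` is `ζ` of that word (`IsRegularizable.symMZV_eq`).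

Symmetrization in `𝒞⟨A⟩`. In the harmonic case neither `ħ` nor `ħb` appears, and `w_ħ^{𝒮,∗}(g_k)` is
a copy of the symmetrized word. In the shuffle case the difficulty is to show that `w_ħ^{𝒮,sh}(E_k)`
lies in `ℌ⁰`. With `G(t) = exp_sh(t g₁)` and `φ(x) = (e^x - 1)/x` one finds `∑ E_{1^n} t^n = G(t)
φ(tħb)`, and the sum over all deconcatenations of this series equals `G(t) sh_ħ G(-t)`, with
arbitrary prefixes on both sides (`fullSer_eSer`). Removing the last `a` from such a product, the
terms that could leave `ℌ⁰` cancel by `e^{tħb} e^{-tħb} = 1` (`qSh_mul_gSer`). What remains is a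
constant plus an element of the augmentation ideal of `𝒞⟨A⟩` times `a`, which lies in `ℌ⁰` because
`ħb·a = ħ g₁` and `g_k a = g_{k+1}`. The prefixes have the required shape because `e_k` and
`ψ^sh(e_k)` both end in `a` for `k ≥ 2`.

Quotients. Elements of `𝔫` reduce to `0`, and `ζ(2k)` is a rational multiple of `ζ(2)^k` by Euler.
Hence `𝒩_q + 𝒫_q` is mapped into `ζ(2)𝒵`. -/

namespace QSMZV

noncomputable section

/-! ### Nested sums -/

section NestedSum

variable {X : Type} {K : Type} [CommRing K]

-- Replaces the index type `Fin (u ++ [a]).length` by `Fin (u.length + 1)`, from which the last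
-- variable can be split off.
open Classical in
theorem nestedSum_eq (F : ℕ → X → K) (M : ℕ) (u : List X) (n : ℕ) (h : n = u.length) :
    nestedSum F M u =
      ∑ m ∈ (Fintype.piFinset fun _ : Fin n => Finset.Ioo 0 M).filter StrictMono,
        ∏ i, F (m i) (u.get (i.cast h)) := by
  subst h; rfl

@[simp] theorem nestedSum_nil (F : ℕ → X → K) (M : ℕ) : nestedSum F M [] = 1 := by
  classical
  rw [nestedSum_eq F M [] 0 rfl]
  have : ((Fintype.piFinset fun _ : Fin 0 => Finset.Ioo 0 M).filter StrictMono) = {Fin.elim0} := by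
    ext m
    simp only [Finset.mem_filter, Fintype.mem_piFinset, IsEmpty.forall_iff, true_and,
      Finset.mem_singleton]
    exact ⟨fun _ => Subsingleton.elim _ _, fun _ => Subsingleton.strictMono _⟩
  rw [this, Finset.sum_singleton, Finset.univ_eq_empty, Finset.prod_empty]

/-- Fix the largest variable `m`: the remaining ones form a nested sum truncated at `m`. Later
arguments mostly reach nested sums through this recursion. -/
theorem nestedSum_snoc (F : ℕ → X → K) (M : ℕ) (u : List X) (a : X) :
    nestedSum F M (u ++ [a]) = ∑ m ∈ Finset.Ioo 0 M, nestedSum F m u * F m a := by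
  classical
  rw [nestedSum_eq F M (u ++ [a]) (u.length + 1) (by simp)]
  simp only [nestedSum_eq F _ u u.length rfl, Finset.sum_mul]
  rw [Finset.sum_sigma']
  refine Finset.sum_bij' (fun m _ => ⟨m (Fin.last _), fun i => m i.castSucc⟩)
    (fun p _ => Fin.snoc p.2 p.1) ?_ ?_ ?_ ?_ ?_
  · intro m hm
    simp only [Finset.mem_filter, Fintype.mem_piFinset, Finset.mem_Ioo] at hm
    simp only [Finset.mem_sigma, Finset.mem_filter, Fintype.mem_piFinset, Finset.mem_Ioo]
    exact ⟨hm.1 _, fun i => ⟨(hm.1 _).1, hm.2 i.castSucc_lt_last⟩,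
      fun i j hij => hm.2 (Fin.castSucc_lt_castSucc_iff.mpr hij)⟩
  · rintro ⟨n, p⟩ hp
    simp only [Finset.mem_sigma, Finset.mem_filter, Fintype.mem_piFinset, Finset.mem_Ioo] at hp
    simp only [Finset.mem_filter, Fintype.mem_piFinset, Finset.mem_Ioo]
    refine ⟨fun i => ?_, fun i j hij => ?_⟩
    · refine Fin.lastCases ?_ (fun i => ?_) i
      · simpa using hp.1
      · simpa using ⟨(hp.2.1 i).1, (hp.2.1 i).2.trans hp.1.2⟩
    · induction j using Fin.lastCases with
      | last =>
        induction i using Fin.lastCases with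
        | last => exact absurd hij (lt_irrefl _)
        | cast i => simpa using (hp.2.1 i).2
      | cast j =>
        induction i using Fin.lastCases with
        | last => exact absurd (hij.trans j.castSucc_lt_last) (lt_irrefl _)
        | cast i => simpa using hp.2.2 (Fin.castSucc_lt_castSucc_iff.mp hij)
  · intro m _
    ext i
    induction i using Fin.lastCases <;> simp
  · rintro ⟨n, p⟩ _
    simp
  · intro m _
    rw [Fin.prod_univ_castSucc]
    congr 1
    · refine Finset.prod_congr rfl fun i _ => ?_
      congr 1
      simp [List.getElem_append_left]
    · congr 1
      simp

theorem nestedSum_succ_snoc (F : ℕ → X → K) (M : ℕ) (hM : 0 < M) (u : List X) (a : X) :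
    nestedSum F (M + 1) (u ++ [a]) =
      nestedSum F M (u ++ [a]) + nestedSum F M u * F M a := by
  rw [nestedSum_snoc, nestedSum_snoc]
  have : Finset.Ioo 0 (M + 1) = insert M (Finset.Ioo 0 M) := by
    ext; simp only [Finset.mem_Ioo, Finset.mem_insert]; omega
  rw [this, Finset.sum_insert (by simp), add_comm]

theorem nestedSum_snoc_of_le_one (F : ℕ → X → K) {M : ℕ} (hM : M ≤ 1) (u : List X) (a : X) :
    nestedSum F M (u ++ [a]) = 0 := by
  rw [nestedSum_snoc]
  refine Finset.sum_eq_zero fun m hm => ?_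
  rw [Finset.mem_Ioo] at hm
  omega

/-- The dummy term at `m = 0` turns truncated sums into partial sums of a series over `ℕ`. -/
theorem nestedSum_snoc_eq_range (F : ℕ → X → K) (M : ℕ) (u : List X) (a : X) :
    nestedSum F M (u ++ [a]) =
      ∑ m ∈ Finset.range M, if m = 0 then 0 else nestedSum F m u * F m a := by
  rw [nestedSum_snoc]
  have h : ∀ m ∈ Finset.Ioo 0 M, nestedSum F m u * F m a =
      if m = 0 then 0 else nestedSum F m u * F m a := fun m hm => by
    rw [if_neg (Finset.mem_Ioo.mp hm).1.ne']
  rw [Finset.sum_congr rfl h]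
  refine Finset.sum_subset (fun m hm => by simp at hm ⊢; omega) fun m hm hm' => ?_
  simp only [Finset.mem_range, Finset.mem_Ioo, not_and, not_lt] at hm hm'
  rw [if_pos]
  by_contra h0
  exact absurd (hm' (Nat.pos_of_ne_zero h0)) (not_le.mpr hm)

theorem nestedSum_map {L : Type} [CommRing L] (φ : K →+* L) (F : ℕ → X → K) (M : ℕ) (u : List X) :
    φ (nestedSum F M u) = nestedSum (fun m a => φ (F m a)) M u := by
  simp [nestedSum, map_sum, map_prod]

theorem nestedSum_congr {F F' : ℕ → X → K} (M : ℕ) (u : List X)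
    (h : ∀ m, 0 < m → ∀ a ∈ u, F m a = F' m a) : nestedSum F M u = nestedSum F' M u := by
  classical
  refine Finset.sum_congr rfl fun m hm => Finset.prod_congr rfl fun i _ => ?_
  simp only [Finset.mem_filter, Fintype.mem_piFinset, Finset.mem_Ioo] at hm
  exact h _ (hm.1 i).1 _ (List.get_mem _ _)

theorem nestedSum_map_list {Y : Type} (f : Y → X) (F : ℕ → X → K) (M : ℕ) (u : List Y) :
    nestedSum F M (u.map f) = nestedSum (fun m a => F m (f a)) M u := by
  rw [nestedSum_eq F M _ u.length (by simp), nestedSum_eq _ M u u.length rfl]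
  refine Finset.sum_congr rfl fun m _ => Finset.prod_congr rfl fun i _ => ?_
  congr 1
  simp

end NestedSum

/-! ### Positivity, monotonicity and bounds for real nested sums -/

section NestedSumReal

variable {X : Type}

theorem nestedSum_nonneg {F : ℕ → X → ℝ} {u : List X} (h : ∀ m, 0 < m → ∀ a ∈ u, 0 ≤ F m a)
    (M : ℕ) : 0 ≤ nestedSum F M u := by
  classical
  refine Finset.sum_nonneg fun m hm => Finset.prod_nonneg fun i _ => ?_
  simp only [Finset.mem_filter, Fintype.mem_piFinset, Finset.mem_Ioo] at hm
  exact h _ (hm.1 i).1 _ (List.get_mem _ _)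

theorem nestedSum_mono {F F' : ℕ → X → ℝ} {u : List X} (h : ∀ m, 0 < m → ∀ a ∈ u, 0 ≤ F m a)
    (h' : ∀ m, 0 < m → ∀ a ∈ u, F m a ≤ F' m a) (M : ℕ) :
    nestedSum F M u ≤ nestedSum F' M u := by
  classical
  refine Finset.sum_le_sum fun m hm => Finset.prod_le_prod ?_ ?_
  all_goals
    intro i _
    simp only [Finset.mem_filter, Fintype.mem_piFinset, Finset.mem_Ioo] at hm
  · exact h _ (hm.1 i).1 _ (List.get_mem _ _)
  · exact h' _ (hm.1 i).1 _ (List.get_mem _ _)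

theorem nestedSum_monotone {F : ℕ → X → ℝ} {u : List X} (h : ∀ m, 0 < m → ∀ a ∈ u, 0 ≤ F m a) :
    Monotone fun M => nestedSum F M u := by
  classical
  intro M N hMN
  refine Finset.sum_le_sum_of_subset_of_nonneg ?_ ?_
  · intro m hm
    simp only [Finset.mem_filter, Fintype.mem_piFinset, Finset.mem_Ioo] at hm ⊢
    exact ⟨fun i => ⟨(hm.1 i).1, (hm.1 i).2.trans_le hMN⟩, hm.2⟩
  · intro m hm _
    simp only [Finset.mem_filter, Fintype.mem_piFinset, Finset.mem_Ioo] at hm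
    exact Finset.prod_nonneg fun i _ => h _ (hm.1 i).1 _ (List.get_mem _ _)

/-- Bound of a nested sum by a product of independent sums. -/
theorem nestedSum_le_prod {F : ℕ → X → ℝ} {u : List X} (w : Fin u.length → ℕ → ℝ)
    (hw : ∀ i m, 0 ≤ w i m) (M : ℕ)
    (h : ∀ m : Fin u.length → ℕ, (∀ i, 0 < m i) → StrictMono m →
      ∏ i, F (m i) (u.get i) ≤ ∏ i, w i (m i)) :
    nestedSum F M u ≤ ∏ i, ∑ m ∈ Finset.Ioo 0 M, w i m := by
  classical
  rw [Finset.prod_univ_sum]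
  refine (Finset.sum_le_sum fun m hm => ?_).trans
    (Finset.sum_le_sum_of_subset_of_nonneg (Finset.filter_subset _ _) fun m _ _ =>
      Finset.prod_nonneg fun i _ => hw _ _)
  simp only [Finset.mem_filter, Fintype.mem_piFinset, Finset.mem_Ioo] at hm
  exact h m (fun i => (hm.1 i).1) hm.2

end NestedSumReal

/-! ### Quasi-shuffle products -/

section QuasiShuffle

variable {R : Type} [CommRing R] {X : Type}

/-- To prove a linear condition, it suffices to treat `1` and words with a last letter. -/
theorem word_cases {p : FreeAlgebra R X → Prop} (w : FreeAlgebra R X) (h1 : p 1)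
    (hw : ∀ u a, p (word R u * FreeAlgebra.ι R a)) (h0 : p 0)
    (hadd : ∀ x y, p x → p y → p (x + y)) (hsmul : ∀ (c : R) x, p x → p (c • x)) : p w := by
  refine induction_word w (fun u => ?_) h0 hadd hsmul
  rcases List.eq_nil_or_concat' u with rfl | ⟨u, a, rfl⟩
  · exact h1
  · rw [word_snoc]; exact hw u a

theorem linExt_one {N : Type} [AddCommGroup N] [Module R N] (f : List X → N) :
    linExt (R := R) f 1 = f [] := by
  rw [← word_nil, linExt_word]

theorem linExt_word_mul_ι {N : Type} [AddCommGroup N] [Module R N] (f : List X → N)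
    (u : List X) (a : X) : linExt (R := R) f (word R u * FreeAlgebra.ι R a) = f (u ++ [a]) := by
  rw [← word_snoc, linExt_word]

/-- Two linear maps which agree on words are equal. -/
theorem linearMap_ext_word {N : Type} [AddCommGroup N] [Module R N]
    {f f' : FreeAlgebra R X →ₗ[R] N} (h : ∀ u, f (word R u) = f' (word R u)) : f = f' :=
  (wordBasis R X).ext fun u => by rw [wordBasis_apply, h]

theorem quasiShuffle_comm {circ : X → X → FreeAlgebra R X} (hc : ∀ a b, circ a b = circ b a)
    (w w' : FreeAlgebra R X) : quasiShuffle circ w w' = quasiShuffle circ w' w := by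
  have key : ∀ u v : List X, quasiShuffle circ (word R u) (word R v) =
      quasiShuffle circ (word R v) (word R u) := by
    intro u
    induction u using List.reverseRecOn with
    | nil => intro v; rw [word_nil, quasiShuffle_one_left, quasiShuffle_one_right]
    | append_singleton u a ihu =>
      intro v
      induction v using List.reverseRecOn with
      | nil => rw [word_nil, quasiShuffle_one_left, quasiShuffle_one_right]
      | append_singleton v b ihv =>
        have h1 := ihu (v ++ [b])
        rw [word_snoc] at h1 ihv
        rw [word_snoc, word_snoc, quasiShuffle_snoc, quasiShuffle_snoc, h1, ihv, ihu v, hc a b]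
        abel
  have := linearMap_ext_word (f := quasiShuffle circ) (f' := (quasiShuffle circ).flip)
    fun u => linearMap_ext_word fun v => key u v
  exact congrArg (fun B => B w w') this

/-- The form of `circ` covers the harmonic product (`c = 1`, `d` addition) and the shuffle product
(`c = 0`). Both sides expand by the recursion on last letters, with induction on the total length.
-/
theorem quasiShuffle_assoc {circ : X → X → FreeAlgebra R X} {c : R} {d : X → X → X}
    (hcirc : ∀ a b, circ a b = c • FreeAlgebra.ι R (d a b))
    (hd : ∀ a b e, d (d a b) e = d a (d b e)) (w w' w'' : FreeAlgebra R X) :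
    quasiShuffle circ (quasiShuffle circ w w') w'' =
      quasiShuffle circ w (quasiShuffle circ w' w'') := by
  have key : ∀ (n : ℕ) (u v t : List X), u.length + v.length + t.length = n →
      quasiShuffle circ (quasiShuffle circ (word R u) (word R v)) (word R t) =
        quasiShuffle circ (word R u) (quasiShuffle circ (word R v) (word R t)) := by
    intro n
    induction n using Nat.strong_induction_on with
    | _ n ih =>
      intro u v t hn
      rcases List.eq_nil_or_concat' u with rfl | ⟨u, a, rfl⟩
      · rw [word_nil, quasiShuffle_one_left, quasiShuffle_one_left]
      rcases List.eq_nil_or_concat' v with rfl | ⟨v, b, rfl⟩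
      · rw [word_nil, quasiShuffle_one_left, quasiShuffle_one_right]
      rcases List.eq_nil_or_concat' t with rfl | ⟨t, e, rfl⟩
      · rw [word_nil, quasiShuffle_one_right, quasiShuffle_one_right]
      simp only [List.length_append, List.length_singleton] at hn
      -- The seven ways to remove the last letter from a nonempty subset of the three words.
      have h1 := ih (u.length + (v.length + 1) + (t.length + 1)) (by omega) u (v ++ [b]) (t ++ [e])
        (by simp)
      have h2 := ih (u.length + 1 + v.length + (t.length + 1)) (by omega) (u ++ [a]) v (t ++ [e])
        (by simp)
      have h3 := ih (u.length + 1 + (v.length + 1) + t.length) (by omega) (u ++ [a]) (v ++ [b]) t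
        (by simp)
      have h4 := ih (u.length + v.length + (t.length + 1)) (by omega) u v (t ++ [e]) (by simp)
      have h5 := ih (u.length + (v.length + 1) + t.length) (by omega) u (v ++ [b]) t (by simp)
      have h6 := ih (u.length + 1 + v.length + t.length) (by omega) (u ++ [a]) v t (by simp)
      have h7 := ih (u.length + v.length + t.length) (by omega) u v t rfl
      simp only [word_snoc] at h1 h2 h3 h4 h5 h6 ⊢
      have e1 : quasiShuffle circ (word R u * FreeAlgebra.ι R a) (word R v * FreeAlgebra.ι R b) =
          quasiShuffle circ (word R u) (word R v * FreeAlgebra.ι R b) * FreeAlgebra.ι R a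
          + quasiShuffle circ (word R u * FreeAlgebra.ι R a) (word R v) * FreeAlgebra.ι R b
          + c • (quasiShuffle circ (word R u) (word R v) * FreeAlgebra.ι R (d a b)) := by
        rw [quasiShuffle_snoc, hcirc, mul_smul_comm]
      have e2 : quasiShuffle circ (word R v * FreeAlgebra.ι R b) (word R t * FreeAlgebra.ι R e) =
          quasiShuffle circ (word R v) (word R t * FreeAlgebra.ι R e) * FreeAlgebra.ι R b
          + quasiShuffle circ (word R v * FreeAlgebra.ι R b) (word R t) * FreeAlgebra.ι R e
          + c • (quasiShuffle circ (word R v) (word R t) * FreeAlgebra.ι R (d b e)) := by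
        rw [quasiShuffle_snoc, hcirc, mul_smul_comm]
      rw [e1, e2]
      simp only [map_add, map_smul, LinearMap.add_apply, LinearMap.smul_apply, quasiShuffle_snoc,
        hcirc, hd, h1, h2, ← h3, h4, h5, h6, h7, add_mul, smul_mul_assoc, mul_smul_comm]
      module
  induction w using induction_word with
  | hw u =>
    induction w' using induction_word with
    | hw v =>
      induction w'' using induction_word with
      | hw t => exact key _ u v t rfl
      | h0 => simp
      | hadd x y hx hy => simp only [map_add, hx, hy]
      | hsmul c x hx => simp only [map_smul, hx]
    | h0 => simp
    | hadd x y hx hy => simp only [map_add, LinearMap.add_apply, hx, hy]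
    | hsmul c x hx => simp only [map_smul, LinearMap.smul_apply, hx]
  | h0 => simp
  | hadd x y hx hy => simp only [map_add, LinearMap.add_apply, hx, hy]
  | hsmul c x hx => simp only [map_smul, LinearMap.smul_apply, hx]

/-- Removal of the last letter of the words which end in `z`; the other words are sent to `0`. -/
def dropLetter [DecidableEq X] (R : Type) [CommRing R] (z : X) :
    FreeAlgebra R X →ₗ[R] FreeAlgebra R X :=
  linExt fun u => if u.getLast? = some z then word R u.dropLast else 0

/-! ### Removal of a fixed last letter as a locally nilpotent derivation -/

section DropLetter

variable [DecidableEq X] (z : X)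

@[simp] theorem dropLetter_one : dropLetter R z 1 = 0 := by
  rw [dropLetter, linExt_one]; simp

theorem dropLetter_mul_ι (w : FreeAlgebra R X) (a : X) :
    dropLetter R z (w * FreeAlgebra.ι R a) = if a = z then w else 0 := by
  induction w using induction_word with
  | hw u => rw [dropLetter, linExt_word_mul_ι]; simp
  | h0 => simp
  | hadd x y hx hy => rw [add_mul, map_add, hx, hy]; split_ifs <;> simp
  | hsmul c x hx => rw [smul_mul_assoc, map_smul, hx]; split_ifs <;> simp

/-- Removal of a last letter which never occurs in `circ` is a derivation. -/
theorem dropLetter_quasiShuffle {circ : X → X → FreeAlgebra R X} {c : R} {d : X → X → X}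
    (hcirc : ∀ a b, circ a b = c • FreeAlgebra.ι R (d a b)) (hd : c = 0 ∨ ∀ a b, d a b ≠ z)
    (w w' : FreeAlgebra R X) : dropLetter R z (quasiShuffle circ w w') =
      quasiShuffle circ (dropLetter R z w) w' + quasiShuffle circ w (dropLetter R z w') := by
  have hcd : ∀ (x : FreeAlgebra R X) a b, dropLetter R z (x * circ a b) = 0 := fun x a b => by
    rw [hcirc, mul_smul_comm, map_smul, dropLetter_mul_ι]
    rcases hd with rfl | hd
    · simp
    · rw [if_neg (hd a b), smul_zero]
  induction w using word_cases with
  | h1 => rw [quasiShuffle_one_left, quasiShuffle_one_left, dropLetter_one]; simp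
  | hw u a =>
    induction w' using word_cases with
    | h1 => rw [quasiShuffle_one_right, quasiShuffle_one_right, dropLetter_one]; simp
    | hw v b =>
      rw [quasiShuffle_snoc, map_add, map_add, hcd]
      simp only [dropLetter_mul_ι]
      split_ifs <;> simp [add_comm]
    | h0 => simp
    | hadd x y hx hy => simp only [map_add, hx, hy]; abel
    | hsmul c x hx => simp only [map_smul, hx, smul_add]
  | h0 => simp
  | hadd x y hx hy => simp only [map_add, LinearMap.add_apply, hx, hy]; abel
  | hsmul c x hx => simp only [map_smul, LinearMap.smul_apply, hx, smul_add]

theorem dropLetter_iterate_word (u : List X) : (dropLetter R z)^[u.length + 1] (word R u) = 0 := by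
  induction u using List.reverseRecOn with
  | nil => simp
  | append_singleton u a ih =>
    rw [List.length_append, List.length_singleton, Function.iterate_succ_apply, word_snoc,
      dropLetter_mul_ι]
    split_ifs
    · exact ih
    · exact iterate_map_zero _ _

theorem exists_dropLetter_iterate_eq_zero (w : FreeAlgebra R X) :
    ∃ n, (dropLetter R z)^[n] w = 0 := by
  induction w using induction_word with
  | hw u => exact ⟨_, dropLetter_iterate_word z u⟩
  | h0 => exact ⟨0, rfl⟩
  | hadd x y hx hy =>
    obtain ⟨n, hn⟩ := hx
    obtain ⟨m, hm⟩ := hy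
    refine ⟨n + m, ?_⟩
    rw [iterate_map_add, Function.iterate_add_apply _ n m y, hm, add_comm n m,
      Function.iterate_add_apply _ m n x, hn, iterate_map_zero, iterate_map_zero, add_zero]
  | hsmul c x hx =>
    obtain ⟨n, hn⟩ := hx
    exact ⟨n, by rw [← Module.End.pow_apply, map_smul, Module.End.pow_apply, hn, smul_zero]⟩

end DropLetter

end QuasiShuffle

/-! ### Extension of homomorphisms along locally nilpotent derivations -/

section Derivation

open Polynomial

variable {A : Type} [CommRing A] [Algebra ℚ A] (D : Derivation ℚ A A)

/-- The subalgebra of constants of a derivation. -/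
def constants : Subalgebra ℚ A where
  carrier := {a | D a = 0}
  mul_mem' := fun {a b} ha hb => by
    rw [Set.mem_ofPred_eq] at *
    rw [D.leibniz, ha, hb, smul_zero, smul_zero, add_zero]
  add_mem' := fun {a b} ha hb => by
    rw [Set.mem_ofPred_eq] at *
    rw [map_add, ha, hb, add_zero]
  algebraMap_mem' := fun r => D.map_algebraMap r

variable {D} {y : A} (hy : D y = 1)
include hy

/-- The chain rule: the coefficients are constants of `D` and `D y = 1`, so `D` acts as `d/dX`. -/
theorem derivation_aeval (p : (constants D)[X]) :
    D (aeval y p) = aeval y (derivative p) := by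
  induction p using Polynomial.induction_on' with
  | add p q hp hq => simp only [map_add, hp, hq]
  | monomial n k =>
    have hk : D (k : A) = 0 := k.2
    rw [derivative_monomial, aeval_monomial, aeval_monomial, Derivation.leibniz,
      Derivation.leibniz_pow, hy]
    have : (algebraMap (constants D) A) k = (k : A) := rfl
    rw [this, hk, map_mul, map_natCast, this]
    simp only [smul_eq_mul, nsmul_eq_mul]
    ring

/-- If `p(y) = 0`, then applying `D` gives `p'(y) = 0`, so `p' = 0` by induction on the degree. In
characteristic zero `p` is then constant, hence zero. -/
theorem aeval_injective : Function.Injective (aeval (R := constants D) y) := by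
  have : IsAddTorsionFree (constants D) := IsAddTorsionFree.of_module_rat _
  rw [injective_iff_map_eq_zero]
  intro p
  induction h : p.natDegree using Nat.strong_induction_on generalizing p with
  | _ n ih =>
    intro hp
    have h0 : p.natDegree = 0 := by
      by_contra hne
      have hd : aeval y (derivative p) = 0 := by
        rw [← derivation_aeval hy, hp, map_zero]
      exact hne (derivative_eq_zero.mp
        (ih _ (h ▸ natDegree_derivative_lt hne) _ rfl hd))
    rw [eq_C_of_natDegree_eq_zero h0] at hp ⊢
    rw [aeval_C] at hp
    have : p.coeff 0 = 0 := Subtype.ext hp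
    rw [this, C_0]

/-- Induction on the order of nilpotency: if `D a = P'(y)` with `P` an antiderivative, which exists
over `ℚ`, then `a - P(y)` is a constant of `D`. -/
theorem aeval_surjective (hD : ∀ a, ∃ n, D^[n] a = 0) :
    Function.Surjective (aeval (R := constants D) y) := by
  have anti : ∀ p : (constants D)[X], ∃ P, derivative P = p := by
    intro p
    induction p using Polynomial.induction_on' with
    | add p q hp hq =>
      obtain ⟨P, rfl⟩ := hp
      obtain ⟨Q, rfl⟩ := hq
      exact ⟨P + Q, derivative_add⟩
    | monomial n k =>
      refine ⟨monomial (n + 1) ((n + 1 : ℚ)⁻¹ • k), ?_⟩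
      rw [derivative_monomial, Nat.add_sub_cancel]
      congr 1
      have h : ((n + 1 : ℕ) : constants D) = algebraMap ℚ _ ((n + 1 : ℕ) : ℚ) :=
        (map_natCast _ _).symm
      rw [h, ← Algebra.commutes, ← Algebra.smul_def, smul_smul]
      have : ((n + 1 : ℕ) : ℚ) * (n + 1 : ℚ)⁻¹ = 1 := by
        push_cast; exact mul_inv_cancel₀ (by positivity)
      rw [this, one_smul]
  have key : ∀ (n : ℕ) (a : A), D^[n] a = 0 → ∃ p, aeval (R := constants D) y p = a := by
    intro n
    induction n with
    | zero => exact fun a ha => ⟨0, by rw [map_zero]; exact ha.symm⟩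
    | succ n ih =>
      intro a ha
      obtain ⟨p, hp⟩ := ih (D a) ha
      obtain ⟨P, rfl⟩ := anti p
      have hk : D (a - aeval y P) = 0 := by rw [map_sub, derivation_aeval hy, hp, sub_self]
      refine ⟨P + Polynomial.C ⟨_, hk⟩, ?_⟩
      rw [map_add, aeval_C]
      exact add_sub_cancel _ _
  intro a
  obtain ⟨n, hn⟩ := hD a
  exact key n a hn

/-- If `D` is a locally nilpotent derivation of `A` with `D y = 1`, then a homomorphism on the
constants extends uniquely to a homomorphism to a polynomial ring which sends `y` to `X`. -/
theorem existsUnique_extension {B : Type} [CommRing B] [Algebra ℚ B]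
    (hD : ∀ a, ∃ n, D^[n] a = 0) (Z : A →ₗ[ℚ] B) (hZ1 : Z 1 = 1)
    (hZ : ∀ a b, D a = 0 → D b = 0 → Z (a * b) = Z a * Z b) :
    ∃! Φ : A →ₗ[ℚ] B[X], Φ 1 = 1 ∧ (∀ a b, Φ (a * b) = Φ a * Φ b) ∧ Φ y = X ∧
      ∀ a, D a = 0 → Φ a = Polynomial.C (Z a) := by
  let ζ : constants D →ₐ[ℚ] B := AlgHom.ofLinearMap (Z ∘ₗ (constants D).val.toLinearMap) hZ1
    fun a b => hZ a b a.2 b.2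
  let e : (constants D)[X] ≃ₐ[constants D] A :=
    AlgEquiv.ofBijective (aeval y) ⟨aeval_injective hy, aeval_surjective hy hD⟩
  -- Identify `A` with polynomials in `y` over the constants and apply `Z` to the coefficients.
  let Φ : A →ₐ[ℚ] B[X] := (mapAlgHom ζ).comp (e.symm.restrictScalars ℚ).toAlgHom
  have hΦ : ∀ p, Φ (aeval y p) = mapAlgHom ζ p := fun p =>
    congrArg (mapAlgHom ζ) (e.symm_apply_apply p)
  refine ⟨Φ.toLinearMap, ⟨map_one Φ, map_mul Φ, ?_, fun a ha => ?_⟩, ?_⟩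
  · have := hΦ X
    rw [aeval_X] at this
    exact this.trans (by simp)
  · have := hΦ (Polynomial.C ⟨a, ha⟩)
    rw [aeval_C] at this
    exact this.trans (by simp [ζ]; rfl)
  · rintro Ψ ⟨h1, h2, h3, h4⟩
    have hpow : ∀ n, Ψ (y ^ n) = X ^ n := by
      intro n
      induction n with
      | zero => rw [pow_zero, pow_zero, h1]
      | succ n ih => rw [pow_succ, h2, ih, h3, pow_succ]
    refine LinearMap.ext fun a => ?_
    obtain ⟨p, rfl⟩ := aeval_surjective hy hD a
    induction p using Polynomial.induction_on' with
    | add p q hp hq => simp only [map_add, hp, hq]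
    | monomial n k =>
      have hk : (algebraMap (constants D) A) k = (k : A) := rfl
      rw [aeval_monomial, h2, hpow, hk, h4 _ k.2]
      have := hΦ (monomial n k)
      rw [aeval_monomial, hk] at this
      rw [AlgHom.toLinearMap_apply, this]
      simp [ζ, C_mul_X_pow_eq_monomial]
      rfl

end Derivation

/-- The version of `existsUnique_extension` for a vector space with a commutative product. -/
theorem existsUnique_extension_of_mul {V B : Type} [AddCommGroup V] [Module ℚ V] [CommRing B]
    [Algebra ℚ B] (mul : V →ₗ[ℚ] V →ₗ[ℚ] V) (one y : V)
    (hcomm : ∀ v w, mul v w = mul w v) (hassoc : ∀ u v w, mul (mul u v) w = mul u (mul v w))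
    (hone : ∀ v, mul one v = v) (D : V →ₗ[ℚ] V)
    (hder : ∀ v w, D (mul v w) = mul (D v) w + mul v (D w)) (hy : D y = one)
    (hD : ∀ v, ∃ n, D^[n] v = 0) (Z : V →ₗ[ℚ] B) (hZ1 : Z one = 1)
    (hZ : ∀ v w, D v = 0 → D w = 0 → Z (mul v w) = Z v * Z w) :
    ∃! Φ : V →ₗ[ℚ] Polynomial B, Φ one = 1 ∧ (∀ v w, Φ (mul v w) = Φ v * Φ w) ∧
      Φ y = Polynomial.X ∧ ∀ v, D v = 0 → Φ v = Polynomial.C (Z v) := by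
  -- `V` is only a vector space here because `𝔥¹` already carries concatenation as its ring
  -- structure; the given product is installed locally.
  let _ : CommRing V :=
    { ‹AddCommGroup V› with
      mul := fun v w => mul v w
      one := one
      mul_assoc := hassoc
      mul_comm := hcomm
      one_mul := hone
      mul_one := fun v => (hcomm v one).trans (hone v)
      left_distrib := fun u v w => map_add (mul u) v w
      right_distrib := fun u v w => by
        change mul (u + v) w = mul u w + mul v w
        rw [map_add, LinearMap.add_apply]
      zero_mul := fun v => by
        change mul 0 v = 0
        rw [map_zero, LinearMap.zero_apply]
      mul_zero := fun v => map_zero (mul v) }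
  let _ : Algebra ℚ V := Algebra.ofModule
    (fun r v w => by
      change mul (r • v) w = r • mul v w
      rw [map_smul, LinearMap.smul_apply])
    (fun r v w => map_smul (mul v) r w)
  exact existsUnique_extension (D := Derivation.mk' D fun v w => by
    refine (hder v w).trans ?_
    rw [add_comm]
    exact congrArg _ (hcomm _ _)) hy hD Z hZ1 hZ

/-! ### Convergence of multiple zeta values -/

section Convergence

theorem admissible_nil : Admissible [] := by simp [Admissible]

theorem admissible_snoc {k : Index} {a : ℕ+} : Admissible (k ++ [a]) ↔ a ≠ 1 := by
  simp only [Admissible, List.getLast?_append, List.getLast?_singleton, Option.some_or,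
    Option.mem_def, Option.some.injEq, forall_eq']
  rw [← PNat.coe_le_coe, ne_eq, ← PNat.coe_inj, PNat.one_coe]
  have := a.pos
  change 2 ≤ (a : ℕ) ↔ _
  omega

/-- Write `1/m_last` as a product of `n + 1` equal powers and use `m_i ≤ m_last` in each. This
shares the decay of the last variable equally among all of them. -/
theorem prod_le_of_le_last {n : ℕ} (m : Fin (n + 1) → ℕ) (hm : ∀ i, 0 < m i)
    (hmono : StrictMono m) :
    1 / (m (Fin.last n) : ℝ) ≤ ∏ i, (m i : ℝ) ^ (-(1 / ((n : ℝ) + 1))) := by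
  have hpos : ∀ i, (0 : ℝ) < m i := fun i => Nat.cast_pos.mpr (hm i)
  calc 1 / (m (Fin.last n) : ℝ)
      = ∏ _i : Fin (n + 1), (m (Fin.last n) : ℝ) ^ (-(1 / ((n : ℝ) + 1))) := by
        rw [Finset.prod_const, Finset.card_univ, Fintype.card_fin, ← Real.rpow_natCast,
          ← Real.rpow_mul (hpos _).le, one_div, ← Real.rpow_neg_one]
        congr 1
        push_cast
        field_simp
    _ ≤ _ := by
        refine Finset.prod_le_prod (fun i _ => (Real.rpow_pos_of_pos (hpos _) _).le) fun i _ => ?_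
        refine Real.rpow_le_rpow_of_nonpos (hpos i) ?_ ?_
        · exact_mod_cast hmono.monotone (Fin.le_last i)
        · rw [neg_nonpos]; positivity

/-- The last exponent is at least two, so a spare factor `1/m_last` is available. Shared among the
`r + 1` variables it raises every exponent to `1 + 1/(r+1)`, and the sums then converge
independently. -/
theorem truncMZV_bounded {k : Index} (hk : Admissible k) : ∃ B, ∀ M, truncMZV M k ≤ B := by
  rcases List.eq_nil_or_concat' k with rfl | ⟨k, a, rfl⟩
  · exact ⟨1, fun M => by rw [truncMZV, nestedSum_nil]⟩
  rw [admissible_snoc] at hk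
  set r : ℕ := k.length with hr
  have hlen : r + 1 = (k ++ [a]).length := by simp [hr]
  have hs : Summable fun m : ℕ => (m : ℝ) ^ (-(1 + 1 / ((r : ℝ) + 1))) := by
    rw [Real.summable_nat_rpow, neg_lt_neg_iff, lt_add_iff_pos_right]
    positivity
  refine ⟨∏ _i : Fin (k ++ [a]).length, ∑' m : ℕ, (m : ℝ) ^ (-(1 + 1 / ((r : ℝ) + 1))),
    fun M => ?_⟩
  refine (nestedSum_le_prod (fun _ m => (m : ℝ) ^ (-(1 + 1 / ((r : ℝ) + 1))))
    (fun _ m => Real.rpow_nonneg (Nat.cast_nonneg m) _) M ?_).trans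
    (Finset.prod_le_prod (fun _ _ => Finset.sum_nonneg fun m _ =>
      Real.rpow_nonneg (Nat.cast_nonneg m) _) fun _ _ => hs.sum_le_tsum _ fun m _ =>
      Real.rpow_nonneg (Nat.cast_nonneg m) _)
  intro m hm hmono
  have hpos : ∀ i, (0 : ℝ) < m i := fun i => Nat.cast_pos.mpr (hm i)
  have h1 : ∀ i, (1 : ℝ) ≤ m i := fun i => Nat.one_le_cast.mpr (hm i)
  let j : Fin (k ++ [a]).length := (Fin.last r).cast hlen
  have hj : (k ++ [a]).get j = a := by simp [j, hr]
  have hlast := prod_le_of_le_last (fun i => m (i.cast hlen)) (fun i => hm _)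
    (fun i i' h => hmono h)
  have hprod : ∏ i, (m i : ℝ) ^ (-(1 / ((r : ℝ) + 1))) =
      ∏ i : Fin (r + 1), (m (i.cast hlen) : ℝ) ^ (-(1 / ((r : ℝ) + 1))) :=
    (Fintype.prod_equiv (finCongr hlen) _ _ fun i => rfl).symm
  calc ∏ i, 1 / (m i : ℝ) ^ (((k ++ [a]).get i : ℕ+) : ℕ)
      ≤ ∏ i, (1 / (m i : ℝ)) * (if i = j then 1 / (m i : ℝ) else 1) := by
        refine Finset.prod_le_prod (fun i _ => by positivity) fun i _ => ?_
        split_ifs with h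
        · rw [h, hj, one_div_mul_one_div, ← sq]
          refine one_div_le_one_div_of_le (by have := hpos j; positivity) ?_
          refine pow_le_pow_right₀ (h1 j) ?_
          have := a.pos
          have : (a : ℕ) ≠ 1 := fun h => hk (PNat.eq h)
          omega
        · rw [mul_one]
          refine one_div_le_one_div_of_le (hpos i) ?_
          exact le_self_pow₀ (h1 i) (PNat.ne_zero _)
    _ = (∏ i, 1 / (m i : ℝ)) * (1 / (m j : ℝ)) := by
        rw [Finset.prod_mul_distrib, Finset.prod_ite_eq' Finset.univ j, if_pos (Finset.mem_univ _)]
    _ ≤ (∏ i, 1 / (m i : ℝ)) * ∏ i, (m i : ℝ) ^ (-(1 / ((r : ℝ) + 1))) := by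
        refine mul_le_mul_of_nonneg_left ?_ (Finset.prod_nonneg fun i _ => by positivity)
        rw [hprod]
        exact hlast
    _ = ∏ i, (m i : ℝ) ^ (-(1 + 1 / ((r : ℝ) + 1))) := by
        rw [← Finset.prod_mul_distrib]
        refine Finset.prod_congr rfl fun i _ => ?_
        rw [neg_add, Real.rpow_add (hpos i), Real.rpow_neg_one, one_div]

theorem truncMZV_monotone (k : Index) : Monotone fun M => truncMZV M k :=
  nestedSum_monotone fun m _ a _ => by positivity

theorem tendsto_truncMZV {k : Index} (hk : Admissible k) :
    Tendsto (fun M => truncMZV M k) atTop (𝓝 (mzv k)) := by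
  obtain ⟨B, hB⟩ := truncMZV_bounded hk
  exact tendsto_nhds_limUnder ⟨_, tendsto_atTop_ciSup (truncMZV_monotone k)
    ⟨B, by rintro _ ⟨M, rfl⟩; exact hB M⟩⟩

end Convergence

/-! ### The linear extension of `ζ` -/

open Classical in
/-- The projection of `𝔥¹` onto the span of the admissible words. -/
def admPart : H1 →ₗ[ℚ] H1 := linExt fun k => if Admissible k then word ℚ k else 0

open Classical in
/-- The linear map `z_k ↦ ζ(k)` for `k` admissible, and `z_k ↦ 0` otherwise. -/
def zetaEl : H1 →ₗ[ℚ] MZVAlg := linExt fun k => if h : Admissible k then mzvEl k h else 0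

/-- The linear map `z_k ↦ ζ_M(k)`. -/
def truncLin (M : ℕ) : H1 →ₗ[ℚ] ℝ := linExt fun k => truncMZV M k

/-- The derivation of `𝔥¹` which removes a last letter `z₁`. -/
abbrev dropOne : H1 →ₗ[ℚ] H1 := dropLetter ℚ (1 : ℕ+)

theorem admPart_word {k : Index} (hk : Admissible k) : admPart (word ℚ k) = word ℚ k := by
  rw [admPart, linExt_word, if_pos hk]

theorem admPart_word_not {k : Index} (hk : ¬ Admissible k) : admPart (word ℚ k) = 0 := by
  rw [admPart, linExt_word, if_neg hk]

theorem zetaEl_word {k : Index} (hk : Admissible k) : zetaEl (word ℚ k) = mzvEl k hk := by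
  rw [zetaEl, linExt_word, dif_pos hk]

theorem zetaEl_one : zetaEl 1 = 1 := by
  rw [← word_nil, zetaEl_word admissible_nil]
  refine Subtype.ext (tendsto_nhds_unique (tendsto_truncMZV admissible_nil) ?_)
  simp [truncMZV]

/-- A word is inadmissible exactly when it ends in `z₁`. Consequently the kernel of `dropOne`
consists of combinations of admissible words. -/
theorem admPart_add (w : H1) : admPart w + dropOne w * FreeAlgebra.ι ℚ 1 = w := by
  induction w using word_cases with
  | h1 => rw [← word_nil, admPart_word admissible_nil, word_nil, dropLetter_one]; simp
  | hw u a =>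
    rw [dropLetter_mul_ι, ← word_snoc]
    split_ifs with h
    · subst h
      rw [admPart_word_not (by simp [admissible_snoc]), zero_add, word_snoc]
    · rw [admPart_word (admissible_snoc.mpr h), zero_mul, add_zero]
  | h0 => simp
  | hadd x y hx hy =>
    conv_rhs => rw [← hx, ← hy]
    simp only [map_add, add_mul]; abel
  | hsmul c x hx =>
    conv_rhs => rw [← hx]
    simp only [map_smul, smul_add, smul_mul_assoc]

theorem admPart_eq_self {w : H1} (hw : dropOne w = 0) : admPart w = w := by
  have := admPart_add w
  rwa [hw, zero_mul, add_zero] at this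

theorem dropOne_word {k : Index} (hk : Admissible k) : dropOne (word ℚ k) = 0 := by
  rcases List.eq_nil_or_concat' k with rfl | ⟨k, a, rfl⟩
  · exact dropLetter_one 1
  · rw [word_snoc, dropLetter_mul_ι, if_neg (admissible_snoc.mp hk)]

/-- Stated through `admPart` so that it can be proved by linearity over all words; restricted to the
kernel of `dropOne` it becomes `tendsto_truncLin`. -/
theorem tendsto_truncLin_admPart (w : H1) :
    Tendsto (fun M => truncLin M (admPart w)) atTop (𝓝 (zetaEl (admPart w) : ℝ)) := by
  induction w using induction_word with
  | hw u =>
    by_cases hu : Admissible u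
    · simp only [admPart_word hu, truncLin, linExt_word, zetaEl_word hu]
      exact tendsto_truncMZV hu
    · simp [admPart_word_not hu]
  | h0 => simp
  | hadd x y hx hy =>
    simp only [map_add]
    exact hx.add hy
  | hsmul c x hx =>
    simp only [map_smul]
    exact hx.const_smul c

theorem tendsto_truncLin {w : H1} (hw : dropOne w = 0) :
    Tendsto (fun M => truncLin M w) atTop (𝓝 (zetaEl w : ℝ)) := by
  have := tendsto_truncLin_admPart w
  rwa [admPart_eq_self hw] at this

/-! ### The harmonic product -/

theorem harmonic_comm (w w' : H1) : harmonic w w' = harmonic w' w :=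
  quasiShuffle_comm (fun a b => by rw [add_comm]) w w'

theorem harmonic_assoc (w w' w'' : H1) :
    harmonic (harmonic w w') w'' = harmonic w (harmonic w' w'') :=
  quasiShuffle_assoc (c := 1) (d := fun a b => a + b) (fun _ _ => (one_smul _ _).symm) add_assoc
    w w' w''

theorem harmonic_one (w : H1) : harmonic 1 w = w := quasiShuffle_one_left _ w

/-- A merged letter `z_{a+b}` is never `z₁`, so the contraction terms of the product are killed. -/
theorem dropOne_harmonic (w w' : H1) :
    dropOne (harmonic w w') = harmonic (dropOne w) w' + harmonic w (dropOne w') :=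
  dropLetter_quasiShuffle 1 (c := 1) (d := fun a b => a + b) (fun _ _ => (one_smul _ _).symm)
    (Or.inr fun a b h => by
      have := congrArg PNat.val h
      have ha := a.pos
      have hb := b.pos
      simp at this
      omega) w w'

theorem truncLin_one (M : ℕ) : truncLin M 1 = 1 := by
  rw [truncLin, linExt_one, truncMZV, nestedSum_nil]

theorem truncLin_zero_mul_ι (w : H1) (a : ℕ+) : truncLin 0 (w * FreeAlgebra.ι ℚ a) = 0 := by
  induction w using induction_word with
  | hw u => rw [truncLin, linExt_word_mul_ι, truncMZV, nestedSum_snoc_of_le_one _ zero_le_one]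
  | h0 => simp
  | hadd x y hx hy => rw [add_mul, map_add, hx, hy, add_zero]
  | hsmul c x hx => rw [smul_mul_assoc, map_smul, hx, smul_zero]

theorem truncLin_succ_mul_ι (M : ℕ) (w : H1) (a : ℕ+) :
    truncLin (M + 1) (w * FreeAlgebra.ι ℚ a) =
      truncLin M (w * FreeAlgebra.ι ℚ a) +
        truncLin M w * (if M = 0 then 0 else 1 / (M : ℝ) ^ (a : ℕ)) := by
  induction w using induction_word with
  | hw u =>
    simp only [truncLin, linExt_word_mul_ι, linExt_word, truncMZV]
    split_ifs with h
    · subst h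
      rw [nestedSum_snoc_of_le_one _ le_rfl, nestedSum_snoc_of_le_one _ zero_le_one]; simp
    · rw [nestedSum_succ_snoc _ _ (Nat.pos_of_ne_zero h)]
  | h0 => simp
  | hadd x y hx hy => simp only [add_mul, map_add, hx, hy]; abel
  | hsmul c x hx => simp only [smul_mul_assoc, map_smul, hx, smul_add]

/-- Induction on `M`: each of the two values grows by an increment carrying `1/M^a` or `1/M^b`. The
product of the increments has the factor `1/M^{a+b}`, which is the contraction term. -/
theorem truncLin_harmonic (M : ℕ) (w w' : H1) :
    truncLin M (harmonic w w') = truncLin M w * truncLin M w' := by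
  induction M generalizing w w' with
  | zero =>
    induction w using word_cases with
    | h1 => rw [harmonic_one, truncLin_one, one_mul]
    | hw u a =>
      induction w' using word_cases with
      | h1 => rw [harmonic_comm, harmonic_one, truncLin_one, mul_one]
      | hw v b =>
        rw [harmonic, quasiShuffle_snoc]
        simp only [map_add, truncLin_zero_mul_ι]; simp
      | h0 => simp
      | hadd x y hx hy => simp only [map_add, hx, hy, mul_add]
      | hsmul c x hx => simp only [map_smul, hx, mul_smul_comm]
    | h0 => simp
    | hadd x y hx hy => simp only [map_add, LinearMap.add_apply, hx, hy, add_mul]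
    | hsmul c x hx => simp only [map_smul, LinearMap.smul_apply, hx, smul_mul_assoc]
  | succ M ih =>
    induction w using word_cases with
    | h1 => rw [harmonic_one, truncLin_one, one_mul]
    | hw u a =>
      induction w' using word_cases with
      | h1 => rw [harmonic_comm, harmonic_one, truncLin_one, mul_one]
      | hw v b =>
        have h0 := ih (word ℚ u * FreeAlgebra.ι ℚ a) (word ℚ v * FreeAlgebra.ι ℚ b)
        have h1 := ih (word ℚ u) (word ℚ v * FreeAlgebra.ι ℚ b)
        have h2 := ih (word ℚ u * FreeAlgebra.ι ℚ a) (word ℚ v)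
        have h3 := ih (word ℚ u) (word ℚ v)
        rw [harmonic, quasiShuffle_snoc] at h0 ⊢
        rw [← harmonic] at h0 ⊢
        simp only [map_add, truncLin_succ_mul_ι, h1, h2, h3] at h0 ⊢
        have hp : (if M = 0 then (0 : ℝ) else 1 / (M : ℝ) ^ ((a + b : ℕ+) : ℕ)) =
            (if M = 0 then 0 else 1 / (M : ℝ) ^ (a : ℕ)) *
              (if M = 0 then 0 else 1 / (M : ℝ) ^ (b : ℕ)) := by
          split_ifs
          · simp
          · rw [PNat.add_coe, pow_add, one_div_mul_one_div]
        rw [hp]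
        linear_combination h0
      | h0 => simp
      | hadd x y hx hy => simp only [map_add, hx, hy, mul_add]
      | hsmul c x hx => simp only [map_smul, hx, mul_smul_comm]
    | h0 => simp
    | hadd x y hx hy => simp only [map_add, LinearMap.add_apply, hx, hy, add_mul]
    | hsmul c x hx => simp only [map_smul, LinearMap.smul_apply, hx, smul_mul_assoc]

theorem zetaEl_harmonic (w w' : H1) (hw : dropOne w = 0) (hw' : dropOne w' = 0) :
    zetaEl (harmonic w w') = zetaEl w * zetaEl w' := by
  have h : dropOne (harmonic w w') = 0 := by rw [dropOne_harmonic, hw, hw']; simp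
  refine Subtype.ext (tendsto_nhds_unique (tendsto_truncLin h) ?_)
  simp only [truncLin_harmonic]
  exact (tendsto_truncLin hw).mul (tendsto_truncLin hw')

/-! ### The shuffle product -/

instance : DecidableEq XY := Classical.decEq XY

theorem shuffleH_comm (w w' : H) : shuffleH w w' = shuffleH w' w :=
  quasiShuffle_comm (fun _ _ => rfl) w w'

theorem shuffleH_assoc (w w' w'' : H) :
    shuffleH (shuffleH w w') w'' = shuffleH w (shuffleH w' w'') :=
  quasiShuffle_assoc (c := 0) (d := fun a _ => a) (fun _ _ => (zero_smul _ _).symm)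
    (fun _ _ _ => rfl) w w' w''

theorem shuffle_comm (w w' : H1) : shuffle w w' = shuffle w' w :=
  toH_injective (by rw [toH_shuffle, toH_shuffle, shuffleH_comm])

theorem shuffle_assoc (w w' w'' : H1) :
    shuffle (shuffle w w') w'' = shuffle w (shuffle w' w'') :=
  toH_injective (by simp only [toH_shuffle, shuffleH_assoc])

theorem shuffle_one (w : H1) : shuffle 1 w = w :=
  toH_injective (by rw [toH_shuffle, map_one, shuffleH, quasiShuffle_one_left])

/-- `z_a = y x^{a-1}` ends in `y` exactly when `a = 1`. This transfers the derivation property from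
`𝔥` to `𝔥¹`. -/
theorem toH_dropOne (w : H1) : toH (dropOne w) = dropLetter ℚ XY.y (toH w) := by
  induction w using word_cases with
  | h1 => simp
  | hw u a =>
    rw [dropLetter_mul_ι, map_mul, toH_ι]
    obtain ⟨n, hn⟩ : ∃ n, (a : ℕ) - 1 = n := ⟨_, rfl⟩
    have := a.pos
    cases n with
    | zero =>
      have ha : a = 1 := PNat.eq (by rw [PNat.one_coe]; omega)
      rw [if_pos ha, hn, pow_zero, mul_one, dropLetter_mul_ι, if_pos rfl]
    | succ n =>
      have ha : a ≠ 1 := by rintro rfl; simp at hn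
      rw [if_neg ha, hn, pow_succ, ← mul_assoc, ← mul_assoc, dropLetter_mul_ι, if_neg (by simp),
        map_zero]
  | h0 => simp
  | hadd x y hx hy => simp only [map_add, hx, hy]
  | hsmul c x hx => simp only [map_smul, hx]

theorem dropOne_shuffle (w w' : H1) :
    dropOne (shuffle w w') = shuffle (dropOne w) w' + shuffle w (dropOne w') :=
  toH_injective (by
    rw [map_add, toH_shuffle, toH_shuffle, toH_dropOne, toH_dropOne, toH_dropOne, toH_shuffle]
    exact dropLetter_quasiShuffle XY.y (c := 0) (d := fun a _ => a)
      (fun _ _ => (zero_smul _ _).symm) (Or.inl rfl) _ _)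

open PowerSeries in
/-- The operator `∑ c_n t^n ↦ ∑_{n ≥ 1} (c_n / n) t^n`. -/
def integrate : ℝ⟦X⟧ →ₗ[ℚ] ℝ⟦X⟧ where
  toFun f := mk fun n => coeff n f / n
  map_add' f g := by ext n; simp [add_div]
  map_smul' c f := by ext n; simp [mul_div_assoc, Rat.smul_def]

/-! ### Power series of multiple polylogarithms and the shuffle product formula -/

section Polylog

open PowerSeries

theorem coeff_integrate (f : ℝ⟦X⟧) (n : ℕ) : coeff n (integrate f) = coeff n f / n :=
  PowerSeries.coeff_mk n fun n => coeff n f / n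

/-- Integration by parts for `dt/t`; on coefficients it is `1/(ij) = (1/i + 1/j)/(i+j)`. The
constant terms must vanish because `integrate` divides by `0` there, with value `0`. -/
theorem integrate_mul_integrate (f g : ℝ⟦X⟧) (hf : coeff 0 f = 0) (hg : coeff 0 g = 0) :
    integrate f * integrate g = integrate (f * integrate g) + integrate (integrate f * g) := by
  ext n
  rw [map_add, coeff_integrate, coeff_integrate, coeff_mul, coeff_mul, coeff_mul,
    ← add_div, ← Finset.sum_add_distrib, Finset.sum_div]
  refine Finset.sum_congr rfl fun p hp => ?_
  rw [Finset.HasAntidiagonal.mem_antidiagonal] at hp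
  subst hp
  rw [coeff_integrate, coeff_integrate]
  rcases Nat.eq_zero_or_pos p.1 with h1 | h1
  · rw [h1, hf]; simp
  rcases Nat.eq_zero_or_pos p.2 with h2 | h2
  · rw [h2, hg]; simp
  have h1' : (p.1 : ℝ) ≠ 0 := by positivity
  have h2' : (p.2 : ℝ) ≠ 0 := by positivity
  have h3' : (p.1 : ℝ) + p.2 ≠ 0 := by positivity
  push_cast
  field_simp

/-- The power series `t / (1 - t)`. -/
def geomTail : ℝ⟦X⟧ := mk fun n => if n = 0 then 0 else 1

theorem coeff_mul_geomTail (f : ℝ⟦X⟧) (n : ℕ) :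
    coeff n (f * geomTail) = ∑ j ∈ Finset.range n, coeff j f := by
  rw [coeff_mul, Finset.Nat.sum_antidiagonal_eq_sum_range_succ_mk, Finset.sum_range_succ]
  simp only [geomTail, coeff_mk, Nat.sub_self, if_true, mul_zero, add_zero]
  refine Finset.sum_congr rfl fun j hj => ?_
  rw [Finset.mem_range] at hj
  rw [if_neg (by omega), mul_one]

/-- The differential form attached to a letter. -/
def letterForm : XY → ℝ⟦X⟧
  | XY.x => 1
  | XY.y => geomTail

/-- The power series of the multiple polylogarithm of a word, read from right to left. -/
def polylogRev : List XY → ℝ⟦X⟧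
  | [] => 1
  | l :: u => integrate (polylogRev u * letterForm l)

/-- The power series of multiple polylogarithms. -/
def polylog : H →ₗ[ℚ] ℝ⟦X⟧ := linExt fun u => polylogRev u.reverse

theorem polylog_one : polylog 1 = 1 := by
  rw [polylog, linExt_one]; rfl

theorem polylog_mul_ι (w : H) (l : XY) :
    polylog (w * FreeAlgebra.ι ℚ l) = integrate (polylog w * letterForm l) := by
  induction w using induction_word with
  | hw u => rw [polylog, linExt_word_mul_ι, linExt_word]; simp [polylogRev]
  | h0 => simp
  | hadd x y hx hy => simp only [add_mul, map_add, hx, hy]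
  | hsmul c x hx => simp only [smul_mul_assoc, map_smul, hx]

/-- A word beginning with `x` would start with the divergent integral of `dt/t` at `0`; the
hypothesis on the head excludes this. -/
theorem coeff_zero_polylog_mul {u : List XY} {l : XY} (h : (u ++ [l]).head? ≠ some XY.x) :
    coeff 0 (polylog (word ℚ u) * letterForm l) = 0 := by
  rcases List.eq_nil_or_concat' u with rfl | ⟨u, a, rfl⟩
  · cases l
    · simp at h
    · simp [letterForm, geomTail]
  · rw [coeff_mul, word_snoc, polylog_mul_ι]
    simp [coeff_integrate]

theorem head?_of_append {u : List XY} {l : XY} (h : (u ++ [l]).head? ≠ some XY.x) :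
    u.head? ≠ some XY.x := by
  cases u <;> simp_all

/-- The shuffle formula for iterated integrals: integration by parts reproduces the recursion on
last letters. -/
theorem polylog_shuffleH_word (u v : List XY) (hu : u.head? ≠ some XY.x)
    (hv : v.head? ≠ some XY.x) :
    polylog (shuffleH (word ℚ u) (word ℚ v)) = polylog (word ℚ u) * polylog (word ℚ v) := by
  induction u using List.reverseRecOn generalizing v with
  | nil => rw [word_nil, shuffleH, quasiShuffle_one_left, polylog_one, one_mul]
  | append_singleton u a ihu =>
    induction v using List.reverseRecOn with
    | nil => rw [word_nil, shuffleH, quasiShuffle_one_right, polylog_one, mul_one]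
    | append_singleton v b ihv =>
      have h1 := ihu (v ++ [b]) (head?_of_append hu) hv
      have h2 := ihv (head?_of_append hv)
      have h3 := integrate_mul_integrate _ _ (coeff_zero_polylog_mul hu)
        (coeff_zero_polylog_mul hv)
      rw [word_snoc] at h1 h2
      rw [word_snoc, word_snoc, shuffleH_snoc, map_add, polylog_mul_ι, polylog_mul_ι, h1, h2,
        polylog_mul_ι, polylog_mul_ι, h3]
      congr 2 <;> ring

theorem toH_word (k : Index) : toH (word ℚ k) =
    word ℚ (k.flatMap fun a : ℕ+ => XY.y :: List.replicate ((a : ℕ) - 1) XY.x) := by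
  induction k with
  | nil => simp
  | cons a k ih =>
    rw [word_cons, map_mul, ih, toH_ι, List.flatMap_cons, word_append, word_cons]
    simp [word]

theorem polylog_shuffle_word (k l : Index) :
    polylog (toH (shuffle (word ℚ k) (word ℚ l))) =
      polylog (toH (word ℚ k)) * polylog (toH (word ℚ l)) := by
  have h : ∀ k : Index, (k.flatMap fun a : ℕ+ =>
      XY.y :: List.replicate ((a : ℕ) - 1) XY.x).head? ≠ some XY.x := by
    intro k; cases k <;> simp
  rw [toH_shuffle, toH_word, toH_word, polylog_shuffleH_word _ _ (h k) (h l)]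

/-- The letter `y` multiplies by `t/(1-t)`, which takes partial sums. It and each of the `a - 1`
letters `x` contribute one division by `n`. -/
theorem coeff_polylog_toH_mul_ι (w : H1) (a : ℕ+) (n : ℕ) :
    coeff n (polylog (toH (w * FreeAlgebra.ι ℚ a))) =
      (∑ j ∈ Finset.range n, coeff j (polylog (toH w))) / (n : ℝ) ^ (a : ℕ) := by
  have key : ∀ m : ℕ, coeff n (polylog (toH w * FreeAlgebra.ι ℚ XY.y * FreeAlgebra.ι ℚ XY.x ^ m)) =
      (∑ j ∈ Finset.range n, coeff j (polylog (toH w))) / (n : ℝ) ^ (m + 1) := by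
    intro m
    induction m with
    | zero =>
      rw [pow_zero, mul_one, polylog_mul_ι, coeff_integrate, letterForm, coeff_mul_geomTail,
        zero_add, pow_one]
    | succ m ih =>
      rw [pow_succ, ← mul_assoc, polylog_mul_ι, coeff_integrate, letterForm, mul_one, ih, div_div,
        ← pow_succ]
  rw [map_mul, toH_ι, ← mul_assoc, key, Nat.sub_add_cancel a.pos]

/-- The coefficient at `t^j` is the part of the nested sum with largest variable `j`. For the empty
word the constant term `1` is counted only when `n > 0`. -/
theorem sum_coeff_polylog_word (k : Index) (n : ℕ) (hn : 0 < n) :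
    ∑ j ∈ Finset.range n, coeff j (polylog (toH (word ℚ k))) = truncMZV n k := by
  induction k using List.reverseRecOn generalizing n with
  | nil =>
    rw [word_nil, map_one, polylog_one, truncMZV, nestedSum_nil,
      Finset.sum_eq_single_of_mem 0 (Finset.mem_range.mpr hn)]
    · simp
    · intro j _ hj
      simp [coeff_one, hj]
  | append_singleton k a ih =>
    rw [truncMZV, nestedSum_snoc_eq_range]
    refine Finset.sum_congr rfl fun j _ => ?_
    rw [word_snoc, coeff_polylog_toH_mul_ι]
    split_ifs with h
    · subst h; simp
    · rw [ih j (Nat.pos_of_ne_zero h), truncMZV, div_eq_mul_one_div]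

theorem sum_coeff_polylog (w : H1) (n : ℕ) (hn : 0 < n) :
    ∑ j ∈ Finset.range n, coeff j (polylog (toH w)) = truncLin n w := by
  induction w using induction_word with
  | hw u => rw [truncLin, linExt_word, sum_coeff_polylog_word u n hn]
  | h0 => simp
  | hadd x y hx hy => simp only [map_add, Finset.sum_add_distrib, hx, hy]
  | hsmul c x hx =>
    rw [map_smul, map_smul, map_smul, ← hx, Finset.smul_sum]
    rfl

theorem coeff_polylog_word_nonneg (k : Index) (n : ℕ) :
    0 ≤ coeff n (polylog (toH (word ℚ k))) := by
  rcases List.eq_nil_or_concat' k with rfl | ⟨k, a, rfl⟩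
  · rw [word_nil, map_one, polylog_one, coeff_one]
    split_ifs <;> norm_num
  · rw [word_snoc, coeff_polylog_toH_mul_ι]
    refine div_nonneg ?_ (by positivity)
    rcases Nat.eq_zero_or_pos n with rfl | hn
    · simp
    · rw [sum_coeff_polylog_word k n hn]
      exact nestedSum_nonneg (fun m _ a _ => by positivity) n

theorem hasSum_coeff_polylog {k : Index} (hk : Admissible k) :
    HasSum (fun n => coeff n (polylog (toH (word ℚ k)))) (mzv k) := by
  rw [hasSum_iff_tendsto_nat_of_nonneg (coeff_polylog_word_nonneg k)]
  refine (tendsto_truncMZV hk).congr' ?_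
  filter_upwards [eventually_gt_atTop 0] with n hn
  exact (sum_coeff_polylog_word k n hn).symm

/-- Evaluate the power series identity at `t = 1`: the coefficient series are nonnegative and
summable, so their Cauchy product has sum `ζ(k) ζ(l)`. -/
theorem zetaEl_shuffle_word {k l : Index} (hk : Admissible k) (hl : Admissible l) :
    zetaEl (shuffle (word ℚ k) (word ℚ l)) = zetaEl (word ℚ k) * zetaEl (word ℚ l) := by
  have hd : dropOne (shuffle (word ℚ k) (word ℚ l)) = 0 := by
    rw [dropOne_shuffle, dropOne_word hk, dropOne_word hl]; simp
  have h1 := hasSum_coeff_polylog hk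
  have h2 := hasSum_coeff_polylog hl
  have hs : HasSum (fun n => coeff n (polylog (toH (shuffle (word ℚ k) (word ℚ l)))))
      (mzv k * mzv l) := by
    rw [polylog_shuffle_word]
    simp only [coeff_mul]
    rw [← h1.tsum_eq, ← h2.tsum_eq,
      tsum_mul_tsum_eq_tsum_sum_antidiagonal_of_summable_norm h1.summable.norm h2.summable.norm]
    exact (summable_norm_sum_mul_antidiagonal_of_summable_norm h1.summable.norm
      h2.summable.norm).of_norm.hasSum
  rw [zetaEl_word hk, zetaEl_word hl]
  refine Subtype.ext (tendsto_nhds_unique (tendsto_truncLin hd) ?_)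
  refine hs.tendsto_sum_nat.congr' ?_
  filter_upwards [eventually_gt_atTop 0] with n hn
  exact sum_coeff_polylog _ n hn

end Polylog

theorem zetaEl_shuffle (w w' : H1) (hw : dropOne w = 0) (hw' : dropOne w' = 0) :
    zetaEl (shuffle w w') = zetaEl w * zetaEl w' := by
  rw [← admPart_eq_self hw, ← admPart_eq_self hw']
  clear hw hw'
  induction w using induction_word with
  | hw u =>
    by_cases hu : Admissible u
    · induction w' using induction_word with
      | hw v =>
        by_cases hv : Admissible v
        · rw [admPart_word hu, admPart_word hv, zetaEl_shuffle_word hu hv]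
        · simp [admPart_word_not hv]
      | h0 => simp
      | hadd x y hx hy => simp only [map_add, hx, hy, mul_add]
      | hsmul c x hx => simp only [map_smul, hx, mul_smul_comm]
    · simp [admPart_word_not hu]
  | h0 => simp
  | hadd x y hx hy => simp only [map_add, LinearMap.add_apply, hx, hy, add_mul]
  | hsmul c x hx => simp only [map_smul, LinearMap.smul_apply, hx, smul_mul_assoc]

/-! ### The algebra of multiple zeta values and the regularizations -/

theorem coe_zetaEl_mem_span (w : H1) :
    (zetaEl w : ℝ) ∈ Submodule.span ℚ {x | ∃ k, Admissible k ∧ x = mzv k} := by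
  induction w using induction_word with
  | hw u =>
    by_cases hu : Admissible u
    · rw [zetaEl_word hu]
      exact Submodule.subset_span ⟨u, hu, rfl⟩
    · rw [zetaEl, linExt_word, dif_neg hu]
      exact Submodule.zero_mem _
  | h0 => simp
  | hadd x y hx hy => rw [map_add]; exact Submodule.add_mem _ hx hy
  | hsmul c x hx => rw [map_smul]; exact Submodule.smul_mem _ c hx

/-- The span is closed under multiplication because harmonic products of elements of the kernel of
`dropOne` stay in that kernel. -/
theorem toSubmodule_MZVAlg : Subalgebra.toSubmodule MZVAlg =
    Submodule.span ℚ {x | ∃ k, Admissible k ∧ x = mzv k} := by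
  rw [MZVAlg, Algebra.adjoin_eq_span]
  refine le_antisymm (Submodule.span_le.mpr ?_) (Submodule.span_mono Submonoid.subset_closure)
  have h : ∀ x ∈ Submonoid.closure {x | ∃ k, Admissible k ∧ x = mzv k},
      ∃ w : H1, dropOne w = 0 ∧ x = zetaEl w := by
    intro x hx
    induction hx using Submonoid.closure_induction with
    | mem x hx =>
      obtain ⟨k, hk, rfl⟩ := hx
      exact ⟨word ℚ k, dropOne_word hk, by rw [zetaEl_word hk]; rfl⟩
    | one => exact ⟨1, dropLetter_one 1, by rw [zetaEl_one]; rfl⟩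
    | mul x y _ _ hx hy =>
      obtain ⟨w, hw, rfl⟩ := hx
      obtain ⟨w', hw', rfl⟩ := hy
      exact ⟨harmonic w w', by rw [dropOne_harmonic, hw, hw']; simp,
        by rw [zetaEl_harmonic _ _ hw hw']; rfl⟩
  intro x hx
  obtain ⟨w, -, rfl⟩ := h x hx
  exact coe_zetaEl_mem_span w

/-- The properties of the products on `𝔥¹` on which regularization is based. -/
structure IsRegularizable (mul : H1 →ₗ[ℚ] H1 →ₗ[ℚ] H1) : Prop where
  comm : ∀ w w', mul w w' = mul w' w
  assoc : ∀ w w' w'', mul (mul w w') w'' = mul w (mul w' w'')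
  one_mul : ∀ w, mul 1 w = w
  dropOne_mul : ∀ w w', dropOne (mul w w') = mul (dropOne w) w' + mul w (dropOne w')
  zetaEl_mul : ∀ w w', dropOne w = 0 → dropOne w' = 0 → zetaEl (mul w w') = zetaEl w * zetaEl w'

theorem isRegularizable_harmonic : IsRegularizable harmonic :=
  ⟨harmonic_comm, harmonic_assoc, harmonic_one, dropOne_harmonic, zetaEl_harmonic⟩

theorem isRegularizable_shuffle : IsRegularizable shuffle :=
  ⟨shuffle_comm, shuffle_assoc, shuffle_one, dropOne_shuffle, zetaEl_shuffle⟩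

theorem IsRegularization.map_of_dropOne {mul : H1 →ₗ[ℚ] H1 →ₗ[ℚ] H1}
    {Φ : H1 →ₗ[ℚ] Polynomial MZVAlg} (hΦ : IsRegularization mul Φ) {w : H1}
    (hw : dropOne w = 0) : Φ w = Polynomial.C (zetaEl w) := by
  rw [← admPart_eq_self hw]
  clear hw
  induction w using induction_word with
  | hw u =>
    by_cases hu : Admissible u
    · rw [admPart_word hu, hΦ.map_admissible u hu, zetaEl_word hu]
    · simp [admPart_word_not hu]
  | h0 => simp
  | hadd x y hx hy => simp only [map_add, hx, hy]
  | hsmul c x hx =>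
    rw [map_smul, map_smul, map_smul, hx, Polynomial.smul_C]

/-- The extension theorem for the derivation `dropOne` with `y = z₁`; on its kernel the prescribed
values on admissible words amount to `zetaEl`. -/
theorem IsRegularizable.existsUnique {mul : H1 →ₗ[ℚ] H1 →ₗ[ℚ] H1} (h : IsRegularizable mul) :
    ∃! Φ, IsRegularization mul Φ := by
  have hy : dropOne (FreeAlgebra.ι ℚ (1 : ℕ+)) = 1 := by
    have := dropLetter_mul_ι (R := ℚ) (1 : ℕ+) 1 1
    rwa [_root_.one_mul, if_pos rfl] at this
  obtain ⟨Φ, ⟨h1, h2, h3, h4⟩, huniq⟩ := existsUnique_extension_of_mul mul 1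
    (FreeAlgebra.ι ℚ 1) h.comm h.assoc h.one_mul dropOne h.dropOne_mul hy
    (exists_dropLetter_iterate_eq_zero 1) zetaEl zetaEl_one h.zetaEl_mul
  refine ⟨Φ, ⟨h1, h2, h3, fun k hk => by rw [h4 _ (dropOne_word hk), zetaEl_word hk]⟩, ?_⟩
  intro Ψ hΨ
  exact huniq Ψ ⟨hΨ.map_one, hΨ.map_mul, hΨ.map_y, fun w hw => hΨ.map_of_dropOne hw⟩

theorem IsRegularizable.isRegularization_regMap {mul : H1 →ₗ[ℚ] H1 →ₗ[ℚ] H1}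
    (h : IsRegularizable mul) : IsRegularization mul (regMap mul) :=
  Classical.epsilon_spec h.existsUnique.exists

/-! ### Symmetric multiple zeta values -/

/-- The element `∑_{i=0}^r (-1)^{k_{i+1}+⋯+k_r} z_{k₁} ⋯ z_{k_i} • z_{k_r} ⋯ z_{k_{i+1}}`. -/
def symWord (mul : H1 →ₗ[ℚ] H1 →ₗ[ℚ] H1) (k : Index) : H1 :=
  ∑ i ∈ Finset.range (k.length + 1),
    (-1 : ℚ) ^ weight (k.drop i) • mul (word ℚ (k.take i)) (word ℚ (k.drop i).reverse)

/-- If `k_{i+1} = 1`, removing it from the left factor of term `i + 1` and from the right factor of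
term `i` leaves the same product. The signs differ by `(-1)^{k_{i+1}} = -1`. -/
theorem IsRegularizable.dropOne_symWord {mul : H1 →ₗ[ℚ] H1 →ₗ[ℚ] H1} (h : IsRegularizable mul)
    (k : Index) : dropOne (symWord mul k) = 0 := by
  simp only [symWord, map_sum, map_smul, h.dropOne_mul, smul_add, Finset.sum_add_distrib]
  -- Shifts the sum over left factors by one to align the cancelling terms; the two boundary terms
  -- contain the empty word and vanish.
  rw [Finset.sum_range_succ', Finset.sum_range_succ]
  simp only [List.take_zero, word_nil, dropLetter_one, map_zero, LinearMap.zero_apply, smul_zero,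
    add_zero, List.drop_length, List.reverse_nil]
  rw [← Finset.sum_add_distrib]
  refine Finset.sum_eq_zero fun i hi => ?_
  rw [Finset.mem_range] at hi
  rw [List.drop_eq_getElem_cons hi, List.take_succ_eq_append_getElem hi, List.reverse_cons,
    word_snoc, word_snoc, dropLetter_mul_ι, dropLetter_mul_ι]
  split_ifs with h1
  · simp [weight, h1, pow_add]
  · simp

/-- The symmetrized word is killed by `dropOne`, so its regularization is a constant polynomial and
setting `T = 0` changes nothing. -/
theorem IsRegularizable.symMZV_eq {mul : H1 →ₗ[ℚ] H1 →ₗ[ℚ] H1} (h : IsRegularizable mul)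
    (k : Index) : symMZV mul k = zetaEl (symWord mul k) := by
  have hΦ := h.isRegularization_regMap
  have h1 := hΦ.map_of_dropOne (h.dropOne_symWord k)
  have h2 := congrArg (Polynomial.eval 0) h1
  rw [Polynomial.eval_C] at h2
  rw [← h2, symWord, map_sum, Polynomial.eval_finsetSum, symMZV]
  refine Finset.sum_congr rfl fun i _ => ?_
  rw [map_smul, hΦ.map_mul, Polynomial.eval_smul, Polynomial.eval_mul, regMZV, regMZV, mul_assoc]
  rcases Nat.even_or_odd (weight (k.drop i)) with hp | hp <;> simp [hp.neg_one_pow]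

/-! ### Reduction modulo `ħ` -/

section SemiExt

variable {X : Type} {N : Type} [AddCommGroup N] [Module ℚ N]

/-- The additive map on `𝒞⟨X⟩` with prescribed values on words, on which `ħ` acts by `0`. -/
def semiExt (f : List X → N) : FreeAlgebra C X →+ N where
  toFun w := ((wordBasis C X).repr w).sum fun u c => c.coeff 0 • f u
  map_zero' := by simp
  map_add' x y := by
    rw [map_add, Finsupp.sum_add_index']
    · simp
    · intro u c d; rw [Polynomial.coeff_add, add_smul]

theorem semiExt_word (f : List X → N) (u : List X) : semiExt f (word C u) = f u := by
  change ((wordBasis C X).repr (word C u)).sum (fun u c => c.coeff 0 • f u) = _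
  simp [← wordBasis_apply]

theorem semiExt_smul (f : List X → N) (c : C) (w : FreeAlgebra C X) :
    semiExt f (c • w) = c.coeff 0 • semiExt f w := by
  change ((wordBasis C X).repr (c • w)).sum (fun u c => c.coeff 0 • f u) =
    c.coeff 0 • ((wordBasis C X).repr w).sum (fun u c => c.coeff 0 • f u)
  rw [map_smul, Finsupp.sum_smul_index' (by simp), Finsupp.smul_sum]
  simp [Polynomial.mul_coeff_zero, mul_smul]

theorem semiExt_hbar_smul (f : List X → N) (w : FreeAlgebra C X) :
    semiExt f (hbar • w) = 0 := by
  rw [semiExt_smul, hbar, Polynomial.coeff_X_zero, zero_smul]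

end SemiExt

/-- The value of a letter modulo `ħ`. -/
def letterH1 : Letter → H1
  | Letter.hb => 0
  | Letter.g k => FreeAlgebra.ι ℚ k

/-- The reduction `𝒞⟨A⟩ → 𝔥¹`, `ħ ↦ 0`, `ħb ↦ 0`, `g_k ↦ z_k`. -/
def toH1 : CA →+ H1 := semiExt fun u => (u.map letterH1).prod

theorem toH1_word (u : List Letter) : toH1 (word C u) = (u.map letterH1).prod := semiExt_word _ _

theorem toH1_smul (c : C) (w : CA) : toH1 (c • w) = c.coeff 0 • toH1 w := semiExt_smul _ _ _

theorem toH1_hbar_smul (w : CA) : toH1 (hbar • w) = 0 := semiExt_hbar_smul _ _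

theorem toH1_one : toH1 1 = 1 := by rw [← word_nil, toH1_word]; rfl

theorem toH1_mul (w w' : CA) : toH1 (w * w') = toH1 w * toH1 w' := by
  induction w using induction_word with
  | hw u =>
    induction w' using induction_word with
    | hw v => rw [← word_append, toH1_word, toH1_word, toH1_word, List.map_append, List.prod_append]
    | h0 => simp
    | hadd x y hx hy => simp only [mul_add, map_add, hx, hy]
    | hsmul c x hx => rw [mul_smul_comm, toH1_smul, toH1_smul, hx, mul_smul_comm]
  | h0 => simp
  | hadd x y hx hy => simp only [add_mul, map_add, hx, hy]
  | hsmul c x hx => rw [smul_mul_assoc, toH1_smul, toH1_smul, hx, smul_mul_assoc]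

theorem toH1_ι (u : Letter) : toH1 (FreeAlgebra.ι C u) = letterH1 u := by
  have := toH1_word [u]
  simpa [word] using this

theorem toH1_hb : toH1 hb = 0 := toH1_ι _

theorem toH1_g (k : ℕ+) : toH1 (g k) = FreeAlgebra.ι ℚ k := toH1_ι _

theorem toH1_e (k : ℕ+) : toH1 (e k) = FreeAlgebra.ι ℚ k := by
  rw [e]
  split_ifs with h
  · rw [map_add, toH1_hb, toH1_g, zero_add, h]
  · rw [map_add, toH1_hbar_smul, toH1_g, add_zero]

theorem toH1_word_map_g (k : Index) : toH1 (word C (k.map Letter.g)) = word ℚ k := by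
  rw [toH1_word, List.map_map]
  rfl

/-! The reduction of the shuffle product. -/

/-- The reductions, with `ba ↦ y` and remaining `a ↦ x`, of a word `w` and of `w a`;
words are read from right to left. -/
def reduceRev : List AB → H × H
  | [] => (1, FreeAlgebra.ι ℚ XY.x)
  | AB.a :: u => ((reduceRev u).2, (reduceRev u).2 * FreeAlgebra.ι ℚ XY.x)
  | AB.b :: u => (0, (reduceRev u).1 * FreeAlgebra.ι ℚ XY.y)

/-- The reduction `ħ ↦ 0`, `ba ↦ y`, `a ↦ x` of `w`. -/
def reduce : HH →+ H := semiExt fun u => (reduceRev u.reverse).1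

/-- The reduction of `w a`. -/
def reduceA : HH →+ H := semiExt fun u => (reduceRev u.reverse).2

theorem reduce_smul (c : C) (w : HH) : reduce (c • w) = c.coeff 0 • reduce w := semiExt_smul _ _ _

theorem reduceA_smul (c : C) (w : HH) : reduceA (c • w) = c.coeff 0 • reduceA w :=
  semiExt_smul _ _ _

theorem reduceA_hbar_smul (w : HH) : reduceA (hbar • w) = 0 := semiExt_hbar_smul _ _

theorem reduce_one : reduce 1 = 1 := by rw [← word_nil, reduce, semiExt_word]; rfl

theorem reduceA_one : reduceA 1 = FreeAlgebra.ι ℚ XY.x := by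
  rw [← word_nil, reduceA, semiExt_word]; rfl

theorem reduce_mul_la (w : HH) : reduce (w * la) = reduceA w := by
  induction w using induction_word with
  | hw u => rw [la, ← word_snoc, reduce, reduceA, semiExt_word, semiExt_word]; simp [reduceRev]
  | h0 => simp
  | hadd x y hx hy => simp only [add_mul, map_add, hx, hy]
  | hsmul c x hx => rw [smul_mul_assoc, reduce_smul, reduceA_smul, hx]

theorem reduceA_mul_la (w : HH) : reduceA (w * la) = reduceA w * FreeAlgebra.ι ℚ XY.x := by
  induction w using induction_word with
  | hw u => rw [la, ← word_snoc, reduceA, semiExt_word, semiExt_word]; simp [reduceRev]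
  | h0 => simp
  | hadd x y hx hy => simp only [add_mul, map_add, hx, hy]
  | hsmul c x hx => rw [smul_mul_assoc, reduceA_smul, reduceA_smul, hx, smul_mul_assoc]

theorem reduce_mul_lb (w : HH) : reduce (w * lb) = 0 := by
  induction w using induction_word with
  | hw u => rw [lb, ← word_snoc, reduce, semiExt_word]; simp [reduceRev]
  | h0 => simp
  | hadd x y hx hy => simp only [add_mul, map_add, hx, hy, add_zero]
  | hsmul c x hx => rw [smul_mul_assoc, reduce_smul, hx, smul_zero]

theorem reduceA_mul_lb (w : HH) : reduceA (w * lb) = reduce w * FreeAlgebra.ι ℚ XY.y := by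
  induction w using induction_word with
  | hw u =>
    rw [lb, ← word_snoc, reduce, reduceA, semiExt_word, semiExt_word]; simp [reduceRev]
  | h0 => simp
  | hadd x y hx hy => simp only [add_mul, map_add, hx, hy]
  | hsmul c x hx => rw [smul_mul_assoc, reduce_smul, reduceA_smul, hx, smul_mul_assoc]

/-- A word ending in `b` reduces to `0`, and so does its product. For two words ending in `a`, the
term with `ħ` disappears and the remaining recursion becomes that of the shuffle product on `𝔥`. -/
theorem reduce_qShuffleHH_word (u v : List AB) :
    reduce (qShuffleHH (word C u) (word C v)) = shuffleH (reduce (word C u)) (reduce (word C v)) := by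
  have key : ∀ (n : ℕ) (u v : List AB), u.length + v.length = n →
      reduce (qShuffleHH (word C u) (word C v)) =
        shuffleH (reduce (word C u)) (reduce (word C v)) := by
    intro n
    induction n using Nat.strong_induction_on with
    | _ n ih =>
      have hs : ∀ (u : List AB), word C (u ++ [AB.a]) = word C u * la := fun u => word_snoc u _
      have hs' : ∀ (u : List AB), word C (u ++ [AB.b]) = word C u * lb := fun u => word_snoc u _
      intro u v hn
      rcases List.eq_nil_or_concat' u with rfl | ⟨u, p, rfl⟩
      · rw [word_nil, qShuffle_one_left, reduce_one, shuffleH, quasiShuffle_one_left]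
      rcases List.eq_nil_or_concat' v with rfl | ⟨v, q, rfl⟩
      · rw [word_nil, qShuffle_one_right, reduce_one, shuffleH, quasiShuffle_one_right]
      simp only [List.length_append, List.length_singleton] at hn
      cases p with
      | b => rw [hs', qShuffle_b_left, reduce_mul_lb, reduce_mul_lb]; simp
      | a =>
        cases q with
        | b => rw [hs', qShuffle_b_right, reduce_mul_lb, reduce_mul_lb]; simp
        | a =>
          -- `l` is the last letter of the reduction of `v a`: it is `y` if `v` ends in `b`, and `x`
          -- if `v` ends in `a` or is empty.
          have key1 : ∃ P l, reduceA (word C v) = P * FreeAlgebra.ι ℚ l ∧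
              reduceA (qShuffleHH (word C u * la) (word C v)) =
                shuffleH (reduceA (word C u)) P * FreeAlgebra.ι ℚ l := by
            rcases List.eq_nil_or_concat' v with rfl | ⟨v, q, rfl⟩
            · refine ⟨1, XY.x, ?_, ?_⟩
              · rw [word_nil, reduceA_one, one_mul]
              · rw [word_nil, qShuffle_one_right, reduceA_mul_la, shuffleH, quasiShuffle_one_right]
            simp only [List.length_append, List.length_singleton] at hn
            cases q with
            | b =>
              refine ⟨reduce (word C v), XY.y, by rw [hs', reduceA_mul_lb], ?_⟩
              have h := ih (u.length + 1 + v.length) (by omega) (u ++ [AB.a]) v (by simp)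
              rw [hs, reduce_mul_la] at h
              rw [hs', qShuffle_b_right, reduceA_mul_lb, h]
            | a =>
              refine ⟨reduceA (word C v), XY.x, by rw [hs, reduceA_mul_la], ?_⟩
              have h := ih (u.length + 1 + (v.length + 1)) (by omega) (u ++ [AB.a]) (v ++ [AB.a])
                (by simp)
              rw [hs, hs, reduce_mul_la, reduce_mul_la, qShuffle_a, reduce_mul_la] at h
              rw [hs, qShuffle_a, reduceA_mul_la, h]
          have key2 : ∃ P l, reduceA (word C u) = P * FreeAlgebra.ι ℚ l ∧
              reduceA (qShuffleHH (word C u) (word C v * la)) =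
                shuffleH P (reduceA (word C v)) * FreeAlgebra.ι ℚ l := by
            rcases List.eq_nil_or_concat' u with rfl | ⟨u, q, rfl⟩
            · refine ⟨1, XY.x, ?_, ?_⟩
              · rw [word_nil, reduceA_one, one_mul]
              · rw [word_nil, qShuffle_one_left, reduceA_mul_la, shuffleH, quasiShuffle_one_left]
            simp only [List.length_append, List.length_singleton] at hn
            cases q with
            | b =>
              refine ⟨reduce (word C u), XY.y, by rw [hs', reduceA_mul_lb], ?_⟩
              have h := ih (u.length + (v.length + 1)) (by omega) u (v ++ [AB.a]) (by simp)
              rw [hs, reduce_mul_la] at h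
              rw [hs', qShuffle_b_left, reduceA_mul_lb, h]
            | a =>
              refine ⟨reduceA (word C u), XY.x, by rw [hs, reduceA_mul_la], ?_⟩
              have h := ih (u.length + 1 + (v.length + 1)) (by omega) (u ++ [AB.a]) (v ++ [AB.a])
                (by simp)
              rw [hs, hs, reduce_mul_la, reduce_mul_la, qShuffle_a, reduce_mul_la] at h
              rw [hs, qShuffle_a, reduceA_mul_la, h]
          obtain ⟨P, l, hP, h1⟩ := key1
          obtain ⟨Q, l', hQ, h2⟩ := key2
          rw [hs, hs, qShuffle_a, reduce_mul_la, reduce_mul_la, reduce_mul_la, map_add, map_add,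
            reduceA_hbar_smul, add_zero, h1, h2, hP, hQ, shuffleH_snoc, add_comm]
  exact key _ u v rfl

theorem reduce_qShuffleHH (w w' : HH) :
    reduce (qShuffleHH w w') = shuffleH (reduce w) (reduce w') := by
  induction w using induction_word with
  | hw u =>
    induction w' using induction_word with
    | hw v => exact reduce_qShuffleHH_word u v
    | h0 => simp
    | hadd x y hx hy => simp only [map_add, hx, hy]
    | hsmul c x hx => rw [map_smul, reduce_smul, reduce_smul, hx, map_smul]
  | h0 => simp
  | hadd x y hx hy => simp only [map_add, LinearMap.add_apply, hx, hy]
  | hsmul c x hx =>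
    rw [map_smul, LinearMap.smul_apply, reduce_smul, reduce_smul, hx, map_smul,
      LinearMap.smul_apply]

/-- In `g_k = ba · a^{k-1}` the block `ba` becomes `y`, while `ħb` is killed by `ħ`. -/
theorem reduce_toHH (w : CA) : reduce (toHH w) = toH (toH1 w) := by
  induction w using induction_word with
  | hw u =>
    induction u using List.reverseRecOn with
    | nil => rw [word_nil, map_one toHH, toH1_one, map_one toH, reduce_one]
    | append_singleton u p ih =>
      rw [word_snoc, map_mul toHH, toHH_ι, toH1_mul, toH1_ι, map_mul toH, ← ih]
      cases p with
      | hb =>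
        rw [letterHH, letterH1, mul_smul_comm, reduce_smul, reduce_mul_lb]; simp
      | g k =>
        rw [letterHH, letterH1, toH_ι]
        have key : ∀ n : ℕ, reduceA (toHH (word C u) * (lb * la ^ n)) =
            reduce (toHH (word C u)) * (FreeAlgebra.ι ℚ XY.y * FreeAlgebra.ι ℚ XY.x ^ n) := by
          intro n
          induction n with
          | zero => rw [pow_zero, pow_zero, mul_one, mul_one, reduceA_mul_lb]
          | succ n ih' =>
            rw [pow_succ, pow_succ, ← mul_assoc lb, ← mul_assoc, reduceA_mul_la, ih', mul_assoc,
              mul_assoc]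
        rw [← key, ← reduce_mul_la, mul_assoc, mul_assoc, ← pow_succ, Nat.sub_add_cancel k.pos]
  | h0 => simp
  | hadd x y hx hy => simp only [map_add, hx, hy]
  | hsmul c x hx => rw [map_smul, reduce_smul, toH1_smul, hx, map_smul]

theorem toH1_qShuffle (w w' : CA) : toH1 (qShuffle w w') = shuffle (toH1 w) (toH1 w') :=
  toH_injective (by
    rw [← reduce_toHH, toHH_qShuffle, reduce_qShuffleHH, reduce_toHH, reduce_toHH, toH_shuffle])

/-! The symmetrization modulo `ħ`. -/

theorem antiHom_word_cons (f : Letter → CA) (a : Letter) (u : List Letter) :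
    antiHom f (word C (a :: u)) = antiHom f (word C u) * f a := by
  rw [word_cons, antiHom_mul, antiHom_ι]

theorem antiHom_one (f : Letter → CA) : antiHom f 1 = 1 := by simp [antiHom]

theorem weight_cons (a : ℕ+) (k : Index) : weight (a :: k) = a + weight k := by simp [weight]

theorem toH1_psiShLetter (k : ℕ+) : toH1 (psiShLetter (Letter.g k)) =
    (-1 : ℚ) ^ (k : ℕ) • FreeAlgebra.ι ℚ k := by
  have h1 : ((-1 : C) ^ (k : ℕ)).coeff 0 = (-1 : ℚ) ^ (k : ℕ) := by
    rw [Polynomial.coeff_zero_eq_eval_zero]; simp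
  rw [psiShLetter, toH1_smul, map_add, map_sum, toH1_smul, toH1_hb, smul_zero, zero_add, h1]
  congr 1
  obtain ⟨n, hn⟩ : ∃ n, (k : ℕ) = n + 1 := ⟨(k : ℕ) - 1, (Nat.sub_add_cancel k.pos).symm⟩
  -- Only the top term of the binomial expansion is free of `ħ`.
  rw [Finset.sum_eq_single_of_mem n (by rw [hn]; simp)]
  · have hk : n.succPNat = k := PNat.eq (by rw [hn]; rfl)
    rw [toH1_smul, toH1_g, hk, hn]
    simp
  · intro j hj hjn
    rw [Finset.mem_range] at hj
    have : hbar ^ ((k : ℕ) - (j + 1)) = hbar * hbar ^ ((k : ℕ) - (j + 1) - 1) := by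
      rw [← pow_succ']; congr 1; omega
    rw [this, mul_left_comm, mul_smul, toH1_hbar_smul]

theorem toH1_psiSh_word (k : Index) : toH1 (psiSh (word C (k.map Letter.g))) =
    (-1 : ℚ) ^ weight k • word ℚ k.reverse := by
  induction k with
  | nil => rw [List.map_nil, word_nil, psiSh, antiHom_one, toH1_one]; simp [weight]
  | cons a k ih =>
    rw [List.map_cons, psiSh, antiHom_word_cons, toH1_mul, ← psiSh, ih, toH1_psiShLetter,
      List.reverse_cons, word_snoc, weight_cons, smul_mul_smul_comm, pow_add, mul_comm]

theorem toH1_word_of_hb_mem {u : List Letter} (hu : Letter.hb ∈ u) : toH1 (word C u) = 0 := by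
  rw [toH1_word]
  exact List.prod_eq_zero (List.mem_map.mpr ⟨_, hu, rfl⟩)

theorem toH1_psiSh_word_of_hb_mem {u : List Letter} (hu : Letter.hb ∈ u) :
    toH1 (psiSh (word C u)) = 0 := by
  induction u with
  | nil => simp at hu
  | cons a u ih =>
    rw [psiSh, antiHom_word_cons, toH1_mul, ← psiSh]
    rcases List.mem_cons.mp hu with rfl | h
    · rw [psiShLetter, toH1_hb, mul_zero]
    · rw [ih h, zero_mul]

theorem exists_map_g {u : List Letter} (hu : Letter.hb ∉ u) : ∃ k : Index, u = k.map Letter.g := by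
  induction u with
  | nil => exact ⟨[], rfl⟩
  | cons a u ih =>
    rw [List.mem_cons, not_or] at hu
    obtain ⟨k, rfl⟩ := ih hu.2
    cases a with
    | hb => exact absurd rfl hu.1
    | g n => exact ⟨n :: k, rfl⟩

/-- The linear map `z_k ↦ symWord mul k`. -/
def symLin (mul : H1 →ₗ[ℚ] H1 →ₗ[ℚ] H1) : H1 →ₗ[ℚ] H1 := linExt (symWord mul)

/-- Wherever a word containing `ħb` is cut, one of the two factors contains `ħb` and reduces to `0`.
-/
theorem toH1_wSymSh (w : CA) : toH1 (wSymSh w) = symLin shuffle (toH1 w) := by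
  induction w using induction_word with
  | hw u =>
    rw [wSymSh, symmetrize, linExt_word, map_sum]
    simp only [toH1_qShuffle]
    by_cases hu : Letter.hb ∈ u
    · rw [toH1_word_of_hb_mem hu, map_zero]
      refine Finset.sum_eq_zero fun i _ => ?_
      rw [← List.take_append_drop i u, List.mem_append] at hu
      rcases hu with h | h
      · rw [toH1_word_of_hb_mem h]; simp
      · rw [toH1_psiSh_word_of_hb_mem h]; simp
    · obtain ⟨k, rfl⟩ := exists_map_g hu
      rw [toH1_word_map_g, symLin, linExt_word, symWord, List.length_map]
      refine Finset.sum_congr rfl fun i _ => ?_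
      rw [← List.map_take, ← List.map_drop, toH1_word_map_g, toH1_psiSh_word, map_smul]
  | h0 => simp
  | hadd x y hx hy => simp only [map_add, hx, hy]
  | hsmul c x hx => rw [map_smul, toH1_smul, toH1_smul, hx, map_smul]

/-! The reduction of `E_k`. -/

/-- There are `n + 1` places at which to insert `y` into `y^n`. -/
theorem shuffle_ι_one_pow (n : ℕ) : shuffle (FreeAlgebra.ι ℚ 1) (FreeAlgebra.ι ℚ 1 ^ n) =
    (n + 1 : ℚ) • FreeAlgebra.ι ℚ (1 : ℕ+) ^ (n + 1) := by
  refine toH_injective ?_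
  have h : toH (FreeAlgebra.ι ℚ 1) = FreeAlgebra.ι ℚ XY.y := by simp [toH_ι]
  rw [toH_shuffle, map_smul, map_pow toH, map_pow toH, h]
  induction n with
  | zero => rw [pow_zero, shuffleH, quasiShuffle_one_right]; simp
  | succ n ih =>
    have := shuffleH_snoc 1 (FreeAlgebra.ι ℚ XY.y ^ n) XY.y XY.y
    rw [one_mul, ← pow_succ, ih, shuffleH, quasiShuffle_one_left] at this
    rw [shuffleH, this, smul_mul_assoc, ← pow_succ]
    push_cast
    module

theorem iterate_shuffle_add (w : H1) (m n : ℕ) :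
    shuffle ((shuffle w)^[m] 1) ((shuffle w)^[n] 1) = (shuffle w)^[m + n] 1 := by
  induction m with
  | zero => rw [Function.iterate_zero, id, shuffle_one, zero_add]
  | succ m ih =>
    rw [Function.iterate_succ_apply', shuffle_assoc, ih, ← Function.iterate_succ_apply' (shuffle w)]
    congr 2; omega

theorem iterate_shuffle_ι_one (n : ℕ) :
    (shuffle (FreeAlgebra.ι ℚ 1))^[n] 1 = (n.factorial : ℚ) • FreeAlgebra.ι ℚ (1 : ℕ+) ^ n := by
  induction n with
  | zero => simp
  | succ n ih =>
    rw [Function.iterate_succ_apply', ih, map_smul, shuffle_ι_one_pow, smul_smul,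
      Nat.factorial_succ]
    push_cast
    rw [mul_comm]

theorem toH1_iterate_qShuffle (w : CA) (n : ℕ) :
    toH1 ((qShuffle w)^[n] 1) = (shuffle (toH1 w))^[n] 1 := by
  induction n with
  | zero => exact toH1_one
  | succ n ih => rw [Function.iterate_succ_apply', Function.iterate_succ_apply', toH1_qShuffle, ih]

/-- Modulo `ħ` both `e₁` and `g₁` become `z₁`, so all `m + 1` summands equal `m! z₁^m`, and the
factor `1/(m+1)!` cancels exactly. -/
theorem toH1_EOnes (m : ℕ) : toH1 (EOnes m) = FreeAlgebra.ι ℚ (1 : ℕ+) ^ m := by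
  rw [EOnes, toH1_smul, Polynomial.coeff_C_zero, map_sum]
  have : ∀ j ∈ Finset.range (m + 1),
      toH1 (qShuffle ((qShuffle (g 1))^[j] 1) ((qShuffle (e 1))^[m - j] 1)) =
        (m.factorial : ℚ) • FreeAlgebra.ι ℚ (1 : ℕ+) ^ m := fun j hj => by
    rw [Finset.mem_range] at hj
    rw [toH1_qShuffle, toH1_iterate_qShuffle, toH1_iterate_qShuffle, toH1_g, toH1_e,
      iterate_shuffle_add, ← iterate_shuffle_ι_one]
    congr 2; omega
  rw [Finset.sum_congr rfl this, Finset.sum_const, Finset.card_range, ← Nat.cast_smul_eq_nsmul ℚ,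
    smul_smul, smul_smul, Nat.factorial_succ]
  have h1 : ((m + 1 : ℕ) : ℚ) ≠ 0 := by positivity
  have h2 : (m.factorial : ℚ) ≠ 0 := by positivity
  have h3 : 1 / (((m + 1) * m.factorial : ℕ) : ℚ) * (((m + 1 : ℕ) : ℚ) * m.factorial) = 1 := by
    rw [Nat.cast_mul, one_div_mul_cancel (mul_ne_zero h1 h2)]
  rw [mul_assoc, h3, one_smul]

theorem toH1_EAux (s : ℕ) (k : Index) :
    toH1 (EAux s k) = FreeAlgebra.ι ℚ (1 : ℕ+) ^ s * word ℚ k := by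
  induction k generalizing s with
  | nil => rw [EAux, toH1_EOnes, word_nil, mul_one]
  | cons a k ih =>
    rw [EAux]
    split_ifs with h
    · rw [ih, h, word_cons, pow_succ, mul_assoc]
    · rw [toH1_mul, toH1_mul, toH1_EOnes, toH1_e, ih, word_cons, pow_zero, one_mul, mul_assoc]

theorem toH1_EIndex (k : Index) : toH1 (EIndex k) = word ℚ k := by
  rw [EIndex, toH1_EAux, pow_zero, one_mul]

theorem toH1_wSymSh_EIndex (k : Index) : toH1 (wSymSh (EIndex k)) = symWord shuffle k := by
  rw [toH1_wSymSh, toH1_EIndex, symLin, linExt_word]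

/-! The harmonic symmetrization. -/

/-- The inclusion `𝔥¹ → 𝒞⟨A⟩`, `z_k ↦ g_k`. -/
def ofH1 : H1 →ₗ[ℚ] CA := linExt fun k => word C (k.map Letter.g)

theorem rat_smul_eq (c : ℚ) (x : CA) : c • x = (Polynomial.C c : C) • x := by
  rw [← Polynomial.algebraMap_eq, algebraMap_smul]

theorem ofH1_word (k : Index) : ofH1 (word ℚ k) = word C (k.map Letter.g) := linExt_word _ _

theorem ofH1_mul_ι (w : H1) (a : ℕ+) : ofH1 (w * FreeAlgebra.ι ℚ a) = ofH1 w * g a := by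
  induction w using induction_word with
  | hw u => rw [← word_snoc, ofH1_word, ofH1_word, List.map_append, word_append]; simp [word, g]
  | h0 => simp
  | hadd x y hx hy => simp only [add_mul, map_add, hx, hy]
  | hsmul c x hx => simp only [smul_mul_assoc, map_smul, hx]

theorem toH1_ofH1 (w : H1) : toH1 (ofH1 w) = w := by
  induction w using induction_word with
  | hw u => rw [ofH1_word, toH1_word_map_g]
  | h0 => simp
  | hadd x y hx hy => simp only [map_add, hx, hy]
  | hsmul c x hx =>
    rw [map_smul, rat_smul_eq, toH1_smul, Polynomial.coeff_C_zero, hx]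

/-- Since `g_k ∘_ħ g_l = g_{k+l}` involves no `ħ`, the two products satisfy the same recursion on
these words. -/
theorem ofH1_harmonic_word (k l : Index) :
    ofH1 (harmonic (word ℚ k) (word ℚ l)) = qHarmonic (ofH1 (word ℚ k)) (ofH1 (word ℚ l)) := by
  induction k using List.reverseRecOn generalizing l with
  | nil =>
    rw [word_nil, harmonic_one, ← word_nil, ofH1_word, ofH1_word [], List.map_nil, word_nil,
      qHarmonic, quasiShuffle_one_left]
  | append_singleton k a ihk =>
    induction l using List.reverseRecOn with
    | nil =>
      rw [word_nil, harmonic_comm, harmonic_one, ← word_nil, ofH1_word, ofH1_word [], List.map_nil,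
        word_nil, qHarmonic, quasiShuffle_one_right]
    | append_singleton l b ihl =>
      have h1 := ihk (l ++ [b])
      have h2 := ihk l
      rw [word_snoc, ofH1_mul_ι] at h1 ihl
      rw [word_snoc, word_snoc, ofH1_mul_ι, ofH1_mul_ι]
      rw [harmonic, quasiShuffle_snoc, ← harmonic, map_add, map_add, ofH1_mul_ι, ofH1_mul_ι,
        ofH1_mul_ι, h1, h2, ihl]
      rw [qHarmonic, g, g, quasiShuffle_snoc]
      rfl

theorem psiStar_word (k : Index) : psiStar (word C (k.map Letter.g)) =
    (-1 : ℚ) ^ weight k • word C (k.reverse.map Letter.g) := by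
  induction k with
  | nil => rw [List.map_nil, word_nil, psiStar, antiHom_one]; simp [weight]
  | cons a k ih =>
    have h : ∀ x : CA, (-1 : C) ^ (a : ℕ) • x = (-1 : ℚ) ^ (a : ℕ) • x := fun x => by
      rw [rat_smul_eq]; simp
    rw [List.map_cons, psiStar, antiHom_word_cons, ← psiStar, ih, psiStarLetter, h,
      List.reverse_cons, List.map_append, List.map_singleton, word_snoc, weight_cons,
      smul_mul_smul_comm, pow_add, mul_comm]
    rfl

theorem gIndex_eq (k : Index) : gIndex k = word C (k.map Letter.g) := by
  rw [gIndex, word, List.map_map]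
  rfl

/-- An exact identity, not merely one modulo `ħ`: neither `ħ` nor `ħb` arises from a word in the
`g_k`. -/
theorem wSymStar_gIndex (k : Index) : wSymStar (gIndex k) = ofH1 (symWord harmonic k) := by
  rw [gIndex_eq, wSymStar, symmetrize, linExt_word, symWord, map_sum, List.length_map]
  refine Finset.sum_congr rfl fun i _ => ?_
  rw [← List.map_take, ← List.map_drop, psiStar_word, map_smul ofH1, ofH1_harmonic_word, ofH1_word,
    ofH1_word, rat_smul_eq, map_smul, ← rat_smul_eq]

theorem ofH1_mem_H0 {w : H1} (hw : dropOne w = 0) : ofH1 w ∈ H0 := by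
  rw [← admPart_eq_self hw]
  clear hw
  induction w using induction_word with
  | hw u =>
    by_cases hu : Admissible u
    · rw [admPart_word hu, ofH1_word]
      refine Submodule.mem_sup_left (Submodule.subset_span ?_)
      rcases List.eq_nil_or_concat' u with rfl | ⟨u, a, rfl⟩
      · exact Or.inl rfl
      · refine Or.inr ⟨word C (u.map Letter.g), a, hu a (by simp), ?_⟩
        rw [List.map_append, word_append]
        simp [word, g]
    · rw [admPart_word_not hu, map_zero]
      exact Submodule.zero_mem _
  | h0 => simp
  | hadd x y hx hy => rw [map_add, map_add]; exact Submodule.add_mem _ hx hy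
  | hsmul c x hx =>
    rw [map_smul, map_smul, rat_smul_eq]
    exact Submodule.smul_mem _ _ hx

theorem wSymStar_gIndex_mem_H0 (k : Index) : wSymStar (gIndex k) ∈ H0 := by
  rw [wSymStar_gIndex]
  exact ofH1_mem_H0 (isRegularizable_harmonic.dropOne_symWord k)

/-! ### Associativity and commutativity of `sh_ħ` -/

theorem word_snoc_a (u : List AB) : word C (u ++ [AB.a]) = word C u * la := word_snoc u _

theorem word_snoc_b (u : List AB) : word C (u ++ [AB.b]) = word C u * lb := word_snoc u _

theorem qShuffleHH_comm (w w' : HH) : qShuffleHH w w' = qShuffleHH w' w := by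
  have key : ∀ u v : List AB, qShuffleHH (word C u) (word C v) =
      qShuffleHH (word C v) (word C u) := by
    intro u
    induction u using List.reverseRecOn with
    | nil => intro v; rw [word_nil, qShuffle_one_left, qShuffle_one_right]
    | append_singleton u p ihu =>
      intro v
      induction v using List.reverseRecOn with
      | nil => rw [word_nil, qShuffle_one_left, qShuffle_one_right]
      | append_singleton v q ihv =>
        have h1 := ihu (v ++ [q])
        have h2 := ihu v
        cases p with
        | b => rw [word_snoc_b, qShuffle_b_left, qShuffle_b_right, h1]
        | a =>
          cases q with
          | b => rw [word_snoc_b, qShuffle_b_left, qShuffle_b_right, ihv]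
          | a =>
            rw [word_snoc_a] at h1 ihv
            rw [word_snoc_a, word_snoc_a, qShuffle_a, qShuffle_a, h1, ihv, h2,
              add_comm (qShuffleHH (word C v) (word C u * la))]
  have := linearMap_ext_word (f := qShuffleHH) (f' := qShuffleHH.flip)
    fun u => linearMap_ext_word fun v => key u v
  exact congrArg (fun B => B w w') this

/-- A final `b` can be pulled out of any of the three factors. Only the case of three final letters
`a` needs the full expansion. -/
theorem qShuffleHH_assoc (w w' w'' : HH) :
    qShuffleHH (qShuffleHH w w') w'' = qShuffleHH w (qShuffleHH w' w'') := by
  have key : ∀ (n : ℕ) (u v t : List AB), u.length + v.length + t.length = n →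
      qShuffleHH (qShuffleHH (word C u) (word C v)) (word C t) =
        qShuffleHH (word C u) (qShuffleHH (word C v) (word C t)) := by
    intro n
    induction n using Nat.strong_induction_on with
    | _ n ih =>
      intro u v t hn
      rcases List.eq_nil_or_concat' u with rfl | ⟨u, p, rfl⟩
      · rw [word_nil, qShuffle_one_left, qShuffle_one_left]
      rcases List.eq_nil_or_concat' v with rfl | ⟨v, q, rfl⟩
      · rw [word_nil, qShuffle_one_left, qShuffle_one_right]
      rcases List.eq_nil_or_concat' t with rfl | ⟨t, e, rfl⟩
      · rw [word_nil, qShuffle_one_right, qShuffle_one_right]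
      simp only [List.length_append, List.length_singleton] at hn
      have h1 := ih (u.length + (v.length + 1) + (t.length + 1)) (by omega) u (v ++ [q]) (t ++ [e])
        (by simp)
      have h2 := ih (u.length + 1 + v.length + (t.length + 1)) (by omega) (u ++ [p]) v (t ++ [e])
        (by simp)
      have h3 := ih (u.length + 1 + (v.length + 1) + t.length) (by omega) (u ++ [p]) (v ++ [q]) t
        (by simp)
      have h4 := ih (u.length + v.length + (t.length + 1)) (by omega) u v (t ++ [e]) (by simp)
      have h5 := ih (u.length + (v.length + 1) + t.length) (by omega) u (v ++ [q]) t (by simp)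
      have h6 := ih (u.length + 1 + v.length + t.length) (by omega) (u ++ [p]) v t (by simp)
      have h7 := ih (u.length + v.length + t.length) (by omega) u v t rfl
      cases p with
      | b => rw [word_snoc_b, qShuffle_b_left, qShuffle_b_left, qShuffle_b_left, h1]
      | a =>
        cases q with
        | b =>
          rw [word_snoc_b, qShuffle_b_right, qShuffle_b_left, qShuffle_b_left, qShuffle_b_right, h2]
        | a =>
          cases e with
          | b => rw [word_snoc_b, qShuffle_b_right, qShuffle_b_right, qShuffle_b_right, h3]
          | a =>
            rw [word_snoc_a] at h1 h2 h3 h4 h5 h6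
            rw [word_snoc_a] at h1 h2 h3
            rw [word_snoc_a, word_snoc_a, word_snoc_a]
            have e1 := qShuffle_a (word C u) (word C v)
            have e2 := qShuffle_a (word C v) (word C t)
            rw [e1, e2]
            simp only [map_add, map_smul, LinearMap.add_apply, LinearMap.smul_apply, qShuffle_a,
              h1, h2, ← h3, h4, h5, h6, h7, add_mul, smul_mul_assoc]
            module
  induction w using induction_word with
  | hw u =>
    induction w' using induction_word with
    | hw v =>
      induction w'' using induction_word with
      | hw t => exact key _ u v t rfl
      | h0 => simp
      | hadd x y hx hy => simp only [map_add, hx, hy]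
      | hsmul c x hx => simp only [map_smul, hx]
    | h0 => simp
    | hadd x y hx hy => simp only [map_add, LinearMap.add_apply, hx, hy]
    | hsmul c x hx => simp only [map_smul, LinearMap.smul_apply, hx]
  | h0 => simp
  | hadd x y hx hy => simp only [map_add, LinearMap.add_apply, hx, hy]
  | hsmul c x hx => simp only [map_smul, LinearMap.smul_apply, hx]

theorem qShuffle_comm (w w' : CA) : qShuffle w w' = qShuffle w' w :=
  toHH_injective (by rw [toHH_qShuffle, toHH_qShuffle, qShuffleHH_comm])

theorem qShuffle_assoc (w w' w'' : CA) :
    qShuffle (qShuffle w w') w'' = qShuffle w (qShuffle w' w'') :=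
  toHH_injective (by simp only [toHH_qShuffle, qShuffleHH_assoc])

theorem one_qShuffle (w : CA) : qShuffle 1 w = w :=
  toHH_injective (by rw [toHH_qShuffle, map_one, qShuffle_one_left])

theorem qShuffle_mul_hb_left (w w' : CA) : qShuffle (w * hb) w' = qShuffle w w' * hb :=
  toHH_injective (by
    rw [toHH_qShuffle, map_mul toHH, map_mul toHH, toHH_qShuffle, toHH_hb, mul_smul_comm, map_smul,
      LinearMap.smul_apply, qShuffle_b_left, mul_smul_comm])

theorem qShuffle_mul_hb_right (w w' : CA) : qShuffle w (w' * hb) = qShuffle w w' * hb := by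
  rw [qShuffle_comm, qShuffle_mul_hb_left, qShuffle_comm]

theorem qShuffle_mul_hb_pow (w w' : CA) (n : ℕ) :
    qShuffle w (w' * hb ^ n) = qShuffle w w' * hb ^ n := by
  induction n with
  | zero => simp
  | succ n ih => rw [pow_succ, ← mul_assoc, qShuffle_mul_hb_right, ih, mul_assoc]

/-- Apply the rule for a common last `a` to `b·a` and `wb·a`, then pull out the letters `b`; the
last summand comes from the term with `ħ`. -/
theorem qShuffle_g_one_mul_g_one (w : CA) : qShuffle (g 1) (w * g 1) =
    qShuffle (g 1) w * g 1 + w * g 1 * g 1 + w * hb * g 1 :=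
  toHH_injective (by
    have h := qShuffle_a lb (toHH w * lb)
    have h1 := qShuffle_b_left 1 (toHH w * lb * la)
    have h2 := qShuffle_b_left 1 (toHH w * lb)
    rw [qShuffle_one_left, one_mul] at h1 h2
    simp only [map_add, map_mul, toHH_qShuffle, toHH_g, toHH_hb, PNat.one_coe, pow_one]
    rw [← mul_assoc, h, h1, h2, qShuffle_b_right]
    simp only [add_mul, mul_assoc, mul_smul_comm, smul_mul_assoc])

/-! ### The powers of `g₁` and the elements `E_{1^m}` -/

/-- `g₁^{sh n} / n!`. -/
def gDiv (n : ℕ) : CA := (1 / (n.factorial : ℚ)) • (qShuffle (g 1))^[n] 1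

theorem gDiv_zero : gDiv 0 = 1 := by simp [gDiv]

theorem iterate_eq_gDiv (n : ℕ) : (qShuffle (g 1))^[n] 1 = (n.factorial : ℚ) • gDiv n := by
  have : (n.factorial : ℚ) ≠ 0 := by positivity
  rw [gDiv, smul_smul, mul_one_div_cancel this, one_smul]

theorem qShuffle_g_one_gDiv (n : ℕ) : qShuffle (g 1) (gDiv n) = (n + 1 : ℚ) • gDiv (n + 1) := by
  have h := iterate_eq_gDiv (n + 1)
  rw [Function.iterate_succ_apply', iterate_eq_gDiv, LinearMap.map_smul_of_tower,
    Nat.factorial_succ] at h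
  have h1 : (n.factorial : ℚ) ≠ 0 := by positivity
  have h2 := congrArg (fun x => (1 / (n.factorial : ℚ)) • x) h
  simp only [smul_smul] at h2
  rw [one_div_mul_cancel h1, one_smul] at h2
  rw [h2]
  congr 1
  push_cast
  field_simp

/-- The coefficients of `G = 1 + G φ(tħb) g₁ t`, where `G = ∑ g₁^{sh n} t^n / n!` and `φ(x) = (e^x -
1)/x`. This expresses shuffle powers of `g₁` by concatenation. The induction takes one more shuffle
product with `g₁`. -/
theorem gDiv_succ (n : ℕ) : gDiv (n + 1) = ∑ j ∈ Finset.range (n + 1),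
    (1 / ((n - j + 1).factorial : ℚ)) • (gDiv j * hb ^ (n - j) * g 1) := by
  induction n with
  | zero =>
    have h := qShuffle_g_one_gDiv 0
    rw [gDiv_zero, qShuffle_comm, one_qShuffle] at h
    simp only [Nat.cast_zero, zero_add, one_smul] at h
    simp [gDiv_zero, ← h]
  | succ n ih =>
    have hn : ((n : ℚ) + 2) ≠ 0 := by positivity
    have h := qShuffle_g_one_gDiv (n + 1)
    have h' : ((n : ℚ) + 2) • gDiv (n + 1 + 1) = ((n : ℚ) + 2) •
        ∑ j ∈ Finset.range (n + 1 + 1),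
          (1 / ((n + 1 - j + 1).factorial : ℚ)) • (gDiv j * hb ^ (n + 1 - j) * g 1) := by
      have e0 : ((n + 1 : ℕ) : ℚ) + 1 = n + 2 := by push_cast; ring
      rw [e0] at h
      rw [← h]
      have e1 : qShuffle (g 1) (gDiv (n + 1)) =
          (∑ j ∈ Finset.range (n + 1), ((j + 1 : ℚ) / ((n - j + 1).factorial : ℚ)) •
            (gDiv (j + 1) * hb ^ (n - j) * g 1)) + gDiv (n + 1) * g 1 +
          ∑ j ∈ Finset.range (n + 1), (1 / ((n - j + 1).factorial : ℚ)) •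
            (gDiv j * hb ^ (n - j + 1) * g 1) := by
        conv_rhs => enter [1, 2]; rw [ih, Finset.sum_mul]
        rw [ih, map_sum, ← Finset.sum_add_distrib, ← Finset.sum_add_distrib]
        refine Finset.sum_congr rfl fun j _ => ?_
        rw [LinearMap.map_smul_of_tower, qShuffle_g_one_mul_g_one, qShuffle_mul_hb_pow,
          qShuffle_g_one_gDiv,
          smul_add, smul_add, smul_mul_assoc, smul_mul_assoc, smul_smul, smul_mul_assoc, pow_succ,
          mul_assoc (gDiv j) _ hb, one_div_mul_eq_div]
      have e2 : ∑ j ∈ Finset.range (n + 1 + 1), ((j : ℚ) / ((n + 1 - j + 1).factorial : ℚ)) •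
            (gDiv j * hb ^ (n + 1 - j) * g 1) =
          ∑ j ∈ Finset.range (n + 1), ((j + 1 : ℚ) / ((n - j + 1).factorial : ℚ)) •
            (gDiv (j + 1) * hb ^ (n - j) * g 1) := by
        rw [Finset.sum_range_succ']
        simp
      have e3 : ∑ j ∈ Finset.range (n + 1 + 1), (1 / ((n + 1 - j).factorial : ℚ)) •
            (gDiv j * hb ^ (n + 1 - j) * g 1) = gDiv (n + 1) * g 1 +
          ∑ j ∈ Finset.range (n + 1), (1 / ((n - j + 1).factorial : ℚ)) •
            (gDiv j * hb ^ (n - j + 1) * g 1) := by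
        rw [Finset.sum_range_succ, add_comm]
        congr 1
        · simp
        · refine Finset.sum_congr rfl fun j hj => ?_
          rw [Finset.mem_range] at hj
          rw [show n + 1 - j = n - j + 1 by omega]
      rw [e1, ← e2, add_assoc, ← e3, ← Finset.sum_add_distrib, Finset.smul_sum]
      refine Finset.sum_congr rfl fun j hj => ?_
      rw [Finset.mem_range] at hj
      rw [← add_smul, smul_smul]
      congr 1
      -- With `m = n + 1 - j` the coefficient identity is `j/(m+1)! + 1/m! = (n+2)/(m+1)!`.
      obtain ⟨m, hm⟩ : ∃ m, n + 1 = j + m := ⟨n + 1 - j, by omega⟩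
      have hm' : (n : ℚ) + 1 = j + m := by exact_mod_cast hm
      rw [hm, Nat.add_sub_cancel_left, Nat.factorial_succ]
      have : (m.factorial : ℚ) ≠ 0 := by positivity
      have : (m : ℚ) + 1 ≠ 0 := by positivity
      push_cast
      field_simp
      linear_combination -hm'
    have h3 := congrArg (fun x => ((n : ℚ) + 2)⁻¹ • x) h'
    simpa only [smul_smul, inv_mul_cancel₀ hn, one_smul] using h3

theorem qShuffle_e_one (w : CA) : qShuffle (e 1) w = qShuffle (g 1) w + w * hb := by
  rw [e, if_pos rfl, map_add, LinearMap.add_apply, add_comm]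
  have := qShuffle_mul_hb_left 1 w
  rw [one_mul, one_qShuffle] at this
  rw [this]

/-- In the commutative algebra with product `sh_ħ`, with `e₁ = g₁ + ħb`, this is the quotient `((g₁
+ ħb)^{m+1} - g₁^{m+1}) / ħb`, since `ħb sh w = w·ħb`. The induction multiplies the sum by `e₁` and
adds the new power of `g₁`. -/
theorem sum_iterate_qShuffle (m : ℕ) :
    ∑ j ∈ Finset.range (m + 1), qShuffle ((qShuffle (g 1))^[j] 1) ((qShuffle (e 1))^[m - j] 1) =
      ∑ j ∈ Finset.range (m + 1), ((m + 1).choose j : ℚ) •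
        ((qShuffle (g 1))^[j] 1 * hb ^ (m - j)) := by
  induction m with
  | zero => simp [one_qShuffle]
  | succ m ih =>
    have h1 : ∑ j ∈ Finset.range (m + 1 + 1),
        qShuffle ((qShuffle (g 1))^[j] 1) ((qShuffle (e 1))^[m + 1 - j] 1) =
        qShuffle (e 1) (∑ j ∈ Finset.range (m + 1),
          qShuffle ((qShuffle (g 1))^[j] 1) ((qShuffle (e 1))^[m - j] 1)) +
        (qShuffle (g 1))^[m + 1] 1 := by
      rw [Finset.sum_range_succ, map_sum]
      congr 1
      · refine Finset.sum_congr rfl fun j hj => ?_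
        rw [Finset.mem_range] at hj
        rw [show m + 1 - j = m - j + 1 by omega, Function.iterate_succ_apply', ← qShuffle_assoc,
          ← qShuffle_assoc, qShuffle_comm (e 1)]
      · rw [Nat.sub_self, Function.iterate_zero, id, qShuffle_comm, one_qShuffle]
    rw [h1, ih, qShuffle_e_one, map_sum, Finset.sum_mul]
    have h2 : ∀ j, qShuffle (g 1) (((m + 1).choose j : ℚ) •
        ((qShuffle (g 1))^[j] 1 * hb ^ (m - j))) =
          ((m + 1).choose j : ℚ) • ((qShuffle (g 1))^[j + 1] 1 * hb ^ (m - j)) := fun j => by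
      rw [LinearMap.map_smul_of_tower, qShuffle_mul_hb_pow, Function.iterate_succ_apply']
    have h3 : ∑ j ∈ Finset.range (m + 1),
        ((m + 1).choose j : ℚ) • ((qShuffle (g 1))^[j] 1 * hb ^ (m - j)) * hb =
        ∑ j ∈ Finset.range (m + 1),
          ((m + 1).choose j : ℚ) • ((qShuffle (g 1))^[j] 1 * hb ^ (m + 1 - j)) := by
      refine Finset.sum_congr rfl fun j hj => ?_
      rw [Finset.mem_range] at hj
      rw [smul_mul_assoc, mul_assoc, ← pow_succ, show m - j + 1 = m + 1 - j by omega]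
    simp only [h2]
    rw [h3, Finset.sum_range_succ' (fun j => ((m + 1 + 1).choose j : ℚ) • _)]
    have h4 : ∑ j ∈ Finset.range (m + 1),
          ((m + 1).choose j : ℚ) • ((qShuffle (g 1))^[j] 1 * hb ^ (m + 1 - j)) +
          (qShuffle (g 1))^[m + 1] 1 =
        ∑ j ∈ Finset.range (m + 1), ((m + 1).choose (j + 1) : ℚ) •
          ((qShuffle (g 1))^[j + 1] 1 * hb ^ (m - j)) + hb ^ (m + 1) := by
      have h5 := Finset.sum_range_succ (fun j => ((m + 1).choose j : ℚ) •
        ((qShuffle (g 1))^[j] 1 * hb ^ (m + 1 - j))) (m + 1)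
      rw [Finset.sum_range_succ'] at h5
      simp only [Nat.choose_self, Nat.cast_one, one_smul, Nat.sub_self, pow_zero, mul_one,
        Nat.choose_zero_right, Function.iterate_zero, id, one_mul, Nat.sub_zero,
        Nat.add_sub_add_right] at h5
      exact h5.symm
    rw [add_assoc, h4, ← add_assoc, ← Finset.sum_add_distrib]
    congr 1
    · refine Finset.sum_congr rfl fun j _ => ?_
      rw [← add_smul, Nat.choose_succ_succ (m + 1) j, Nat.add_sub_add_right]
      push_cast
      rfl
    · simp

/-- The coefficients of `∑ E_{1^m} t^m = G(t) φ(tħb)`, from which `G = 1 + (∑ E_{1^m} t^m) g₁ t`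
follows by `gDiv_succ`. -/
theorem EOnes_eq (m : ℕ) : EOnes m = ∑ j ∈ Finset.range (m + 1),
    (1 / ((m - j + 1).factorial : ℚ)) • (gDiv j * hb ^ (m - j)) := by
  rw [EOnes, sum_iterate_qShuffle, ← rat_smul_eq, Finset.smul_sum]
  refine Finset.sum_congr rfl fun j hj => ?_
  rw [Finset.mem_range] at hj
  rw [iterate_eq_gDiv, smul_mul_assoc, smul_smul, smul_smul]
  congr 1
  rw [Nat.cast_choose ℚ (by omega : j ≤ m + 1), show m + 1 - j = m - j + 1 by omega]
  have h1 : (j.factorial : ℚ) ≠ 0 := by positivity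
  have h2 : ((m + 1).factorial : ℚ) ≠ 0 := by positivity
  field_simp

/-! ### Generating series -/

section Convolution

open PowerSeries Finset

theorem sum_antidiagonal_assoc {L : Type} [AddCommMonoid L] (f : ℕ → ℕ → ℕ → L) (n : ℕ) :
    ∑ p ∈ antidiagonal n, ∑ q ∈ antidiagonal p.1, f q.1 q.2 p.2 =
      ∑ p ∈ antidiagonal n, ∑ q ∈ antidiagonal p.2, f p.1 q.1 q.2 := by
  rw [Finset.sum_sigma', Finset.sum_sigma']
  refine Finset.sum_nbij' (fun x => ⟨(x.2.1, x.2.2 + x.1.2), (x.2.2, x.1.2)⟩)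
    (fun x => ⟨(x.1.1 + x.2.1, x.2.2), (x.1.1, x.2.1)⟩) ?_ ?_ ?_ ?_ ?_
  · rintro ⟨⟨a, b⟩, ⟨c, d⟩⟩ h
    simp only [Finset.mem_sigma, HasAntidiagonal.mem_antidiagonal] at h ⊢
    exact ⟨by omega, by trivial⟩
  · rintro ⟨⟨a, b⟩, ⟨c, d⟩⟩ h
    simp only [Finset.mem_sigma, HasAntidiagonal.mem_antidiagonal] at h ⊢
    exact ⟨by omega, by trivial⟩
  · rintro ⟨⟨a, b⟩, ⟨c, d⟩⟩ h
    simp only [Finset.mem_sigma, HasAntidiagonal.mem_antidiagonal] at h ⊢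
    rw [h.2]
  · rintro ⟨⟨a, b⟩, ⟨c, d⟩⟩ h
    simp only [Finset.mem_sigma, HasAntidiagonal.mem_antidiagonal] at h ⊢
    rw [h.2]
  · rintro ⟨⟨a, b⟩, ⟨c, d⟩⟩ _
    rfl

theorem sum_antidiagonal_right_comm {L : Type} [AddCommMonoid L] (f : ℕ → ℕ → ℕ → L) (n : ℕ) :
    ∑ p ∈ antidiagonal n, ∑ q ∈ antidiagonal p.1, f q.1 q.2 p.2 =
      ∑ p ∈ antidiagonal n, ∑ q ∈ antidiagonal p.1, f q.1 p.2 q.2 := by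
  rw [sum_antidiagonal_assoc, sum_antidiagonal_assoc (fun i j k => f i k j)]
  refine Finset.sum_congr rfl fun p _ => ?_
  exact Finset.Nat.sum_antidiagonal_swap (f := fun q => f p.1 q.1 q.2) |>.symm

variable {M N L : Type} [Ring M] [Ring N] [Ring L] [Algebra C M] [Algebra C N] [Algebra C L]

/-- The extension of a bilinear map to power series with a formal parameter. -/
def convol (B : M →ₗ[C] N →ₗ[C] L) : M⟦X⟧ →ₗ[C] N⟦X⟧ →ₗ[C] L⟦X⟧ :=
  LinearMap.mk₂ C (fun f h => PowerSeries.mk fun n =>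
      ∑ p ∈ antidiagonal n, B (coeff p.1 f) (coeff p.2 h))
    (fun f f' h => by ext n; simp [Finset.sum_add_distrib])
    (fun c f h => by ext n; simp [Finset.smul_sum])
    (fun f h h' => by ext n; simp [Finset.sum_add_distrib])
    (fun c f h => by ext n; simp [Finset.smul_sum])

theorem coeff_convol (B : M →ₗ[C] N →ₗ[C] L) (f : M⟦X⟧) (h : N⟦X⟧) (n : ℕ) :
    coeff n (convol B f h) = ∑ p ∈ antidiagonal n, B (coeff p.1 f) (coeff p.2 h) := by
  simp [convol]

theorem coeff_convol_C_right (B : M →ₗ[C] N →ₗ[C] L) (f : M⟦X⟧) (y : N) (n : ℕ) :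
    coeff n (convol B f (PowerSeries.C y)) = B (coeff n f) y := by
  rw [coeff_convol, Finset.Nat.sum_antidiagonal_eq_sum_range_succ_mk, Finset.sum_range_succ]
  simp only [Nat.sub_self, coeff_zero_C, add_eq_right]
  refine Finset.sum_eq_zero fun j hj => ?_
  rw [Finset.mem_range] at hj
  rw [coeff_C, if_neg (by omega), map_zero]

/-- `convol` and right multiplication of the first argument by a series. -/
theorem convol_mul_left (B : M →ₗ[C] N →ₗ[C] L) (f z : M⟦X⟧) (h : N⟦X⟧) (z' : L⟦X⟧)
    (hz : ∀ k x y, B (x * coeff k z) y = B x y * coeff k z') :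
    convol B (f * z) h = convol B f h * z' := by
  ext n
  simp only [coeff_convol, coeff_mul, map_sum, LinearMap.sum_apply, Finset.sum_mul, hz]
  exact sum_antidiagonal_right_comm
    (fun i j k => B (coeff i f) (coeff k h) * coeff j z') n

theorem convol_mul_right (B : M →ₗ[C] N →ₗ[C] L) (f : M⟦X⟧) (h z : N⟦X⟧) (z' : L⟦X⟧)
    (hz : ∀ k x y, B x (y * coeff k z) = B x y * coeff k z') :
    convol B f (h * z) = convol B f h * z' := by
  ext n
  simp only [coeff_convol, coeff_mul, map_sum, Finset.sum_mul, hz]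
  exact (sum_antidiagonal_assoc
    (fun i j k => B (coeff i f) (coeff j h) * coeff k z') n).symm

theorem convol_mul_X_right (B : M →ₗ[C] N →ₗ[C] L) (f : M⟦X⟧) (h : N⟦X⟧) :
    convol B f (h * X) = convol B f h * X :=
  convol_mul_right B f h X X fun k x y => by
    rw [coeff_X, coeff_X]; split_ifs <;> simp

theorem convol_mul_X_left (B : M →ₗ[C] N →ₗ[C] L) (f : M⟦X⟧) (h : N⟦X⟧) :
    convol B (f * X) h = convol B f h * X :=
  convol_mul_left B f X h X fun k x y => by
    rw [coeff_X, coeff_X]; split_ifs <;> simp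

end Convolution

/-! ### The exponential series and the substitution of `ħb` -/

section Series

open PowerSeries

variable {S : Type} [Ring S] [Algebra ℚ S]

/-- The substitution `u(x) ↦ u(t h)`, with `t` the formal parameter. -/
def sigma (h : S) : ℚ⟦X⟧ →+* S⟦X⟧ where
  toFun u := PowerSeries.mk fun n => coeff n u • h ^ n
  map_one' := by
    ext n
    rw [coeff_mk, coeff_one, coeff_one]
    split_ifs with hn <;> simp [hn]
  map_mul' u v := by
    ext n
    rw [coeff_mk, coeff_mul, coeff_mul, Finset.sum_smul]
    refine Finset.sum_congr rfl fun p hp => ?_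
    rw [Finset.HasAntidiagonal.mem_antidiagonal] at hp
    rw [coeff_mk, coeff_mk, smul_mul_smul_comm, ← pow_add, hp]
  map_zero' := by ext n; simp
  map_add' u v := by ext n; simp [add_smul]

theorem coeff_sigma (h : S) (u : ℚ⟦X⟧) (n : ℕ) : coeff n (sigma h u) = coeff n u • h ^ n :=
  coeff_mk n fun n => coeff n u • h ^ n

theorem sigma_X (h : S) : sigma h X = X * PowerSeries.C h := by
  ext n
  rw [coeff_sigma, coeff_X, coeff_mul_C, coeff_X]
  split_ifs with hn <;> simp [hn]

/-- The series `(e^x - 1) / x`. -/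
def phi : ℚ⟦X⟧ := PowerSeries.mk fun n => 1 / ((n + 1).factorial : ℚ)

/-- The series `e^x`. -/
abbrev expS : ℚ⟦X⟧ := PowerSeries.exp ℚ

theorem X_mul_phi : X * phi = expS - 1 := by
  ext n
  cases n with
  | zero => simp
  | succ n => rw [coeff_succ_X_mul, phi, coeff_mk, map_sub, coeff_exp, coeff_one]; simp

/-- The substitution `x ↦ -x`. -/
abbrev neg : ℚ⟦X⟧ →+* ℚ⟦X⟧ := rescale (-1)

theorem expS_mul_neg : expS * neg expS = 1 := exp_mul_exp_neg_eq_one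

theorem X_mul_neg_phi : X * neg phi = 1 - neg expS := by
  have := congrArg neg X_mul_phi
  rw [map_mul, map_sub, map_one, neg, rescale_neg_one_X] at this
  linear_combination -this

theorem expS_mul_neg_phi : expS * neg phi = phi := by
  refine X_mul_cancel ?_
  linear_combination expS * X_mul_neg_phi - X_mul_phi - expS_mul_neg

/-- A solution of `G = 1 + G Y` is a solution of `G = 1 + Y G`. -/
theorem eq_one_add_mul_comm {S : Type} [Ring S] {G Y : S⟦X⟧} (h : G = 1 + G * (Y * X)) :
    G = 1 + Y * X * G := by
  -- Iterating `Z = Z Y X` makes `Z` divisible by every power of `X`. It is applied to the defect of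
  -- the desired equation, which satisfies the same relation.
  have key : ∀ Z : S⟦X⟧, Z = Z * (Y * X) → Z = 0 := by
    intro Z hZ
    have : ∀ n, coeff n Z = 0 := by
      intro n
      induction n using Nat.strong_induction_on with
      | _ n ih =>
        rw [hZ, ← mul_assoc]
        cases n with
        | zero => exact coeff_zero_mul_X _
        | succ n =>
          rw [coeff_succ_mul_X, coeff_mul]
          refine Finset.sum_eq_zero fun p hp => ?_
          rw [Finset.HasAntidiagonal.mem_antidiagonal] at hp
          rw [ih p.1 (by omega), zero_mul]
    ext n
    rw [this n, map_zero]
  have := key (G - Y * X * G - 1) ?_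
  · rw [sub_sub, sub_eq_zero] at this
    rw [← sub_eq_iff_eq_add'] at h
    rw [add_comm]
    exact this
  · have h' : G * (Y * X) = G - 1 := by rw [eq_sub_iff_add_eq, add_comm]; exact h.symm
    calc G - Y * X * G - 1 = G - 1 - Y * X * (G - 1) - Y * X := by noncomm_ring
      _ = G * (Y * X) - Y * X * (G * (Y * X)) - Y * X := by rw [h']
      _ = _ := by noncomm_ring

end Series

/-! ### Generating series in `ℌ` -/

section SeriesHH

open PowerSeries

theorem toHH_rat_smul (c : ℚ) (w : CA) : toHH (c • w) = c • toHH w :=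
  LinearMap.map_smul_of_tower toHH.toLinearMap c w

theorem HH_mul_neg (x y : HH) : x * -y = -(x * y) := mul_neg x y

theorem serHH_mul_neg (x y : HH⟦X⟧) : x * -y = -(x * y) := mul_neg x y

theorem serHH_neg_mul (x y : HH⟦X⟧) : -x * y = -(x * y) := neg_mul x y

theorem serHH_sub_mul (x y z : HH⟦X⟧) : (x - y) * z = x * z - y * z := sub_mul x y z

theorem neg_one_smul_HH (x : HH) : (-1 : ℚ) • x = -x := neg_one_smul ℚ x

/-- The substitution `u ↦ u(t ħb)` with values in `ℌ⟦t⟧`. -/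
abbrev sigH : ℚ⟦X⟧ →+* HH⟦X⟧ := sigma (toHH hb)

/-- The coefficientwise extension of `sh_ħ` to `ℌ⟦t⟧`. -/
abbrev qSh : HH⟦X⟧ →ₗ[C] HH⟦X⟧ →ₗ[C] HH⟦X⟧ := convol qShuffleHH

theorem qShuffleHH_mul_hb_pow_left (x y : HH) (n : ℕ) :
    qShuffleHH (x * toHH hb ^ n) y = qShuffleHH x y * toHH hb ^ n := by
  induction n with
  | zero => simp
  | succ n ih =>
    rw [pow_succ, ← mul_assoc, ← mul_assoc, ← ih, toHH_hb, mul_smul_comm, map_smul,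
      LinearMap.smul_apply, qShuffle_b_left, mul_smul_comm]

theorem qShuffleHH_mul_hb_pow_right (x y : HH) (n : ℕ) :
    qShuffleHH x (y * toHH hb ^ n) = qShuffleHH x y * toHH hb ^ n := by
  rw [qShuffleHH_comm, qShuffleHH_mul_hb_pow_left, qShuffleHH_comm]

/-- Final letters `b` can be pulled out of either factor of `sh_ħ`, hence so can any series in `ħb`.
-/
theorem qSh_mul_sigH_left (f h : HH⟦X⟧) (u : ℚ⟦X⟧) :
    qSh (f * sigH u) h = qSh f h * sigH u :=
  convol_mul_left _ _ _ _ _ fun k x y => by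
    rw [coeff_sigma, mul_smul_comm, LinearMap.map_smul_of_tower, LinearMap.smul_apply,
      qShuffleHH_mul_hb_pow_left, mul_smul_comm]

theorem qSh_mul_sigH_right (f h : HH⟦X⟧) (u : ℚ⟦X⟧) :
    qSh f (h * sigH u) = qSh f h * sigH u :=
  convol_mul_right _ _ _ _ _ fun k x y => by
    rw [coeff_sigma, mul_smul_comm, LinearMap.map_smul_of_tower, qShuffleHH_mul_hb_pow_right,
      mul_smul_comm]

theorem qSh_mul_lb_left (f h : HH⟦X⟧) :
    qSh (f * PowerSeries.C lb) h = qSh f h * PowerSeries.C lb :=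
  convol_mul_left _ _ _ _ _ fun k x y => by
    rw [coeff_C]; split_ifs
    · exact qShuffle_b_left x y
    · simp

theorem qSh_mul_lb_right (f h : HH⟦X⟧) :
    qSh f (h * PowerSeries.C lb) = qSh f h * PowerSeries.C lb :=
  convol_mul_right _ _ _ _ _ fun k x y => by
    rw [coeff_C]; split_ifs
    · exact qShuffle_b_right x y
    · simp

theorem qSh_mul_la (f h : HH⟦X⟧) : qSh (f * PowerSeries.C la) (h * PowerSeries.C la) =
    (qSh (f * PowerSeries.C la) h + qSh f (h * PowerSeries.C la) + hbar • qSh f h) *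
      PowerSeries.C la := by
  ext n
  simp only [map_add, coeff_mul_C, coeff_convol, coeff_smul, qShuffle_a, Finset.smul_sum,
    ← Finset.sum_add_distrib, Finset.sum_mul]

theorem qSh_one_left (f : HH⟦X⟧) : qSh 1 f = f := by
  ext n
  rw [coeff_convol, Finset.Nat.sum_antidiagonal_eq_sum_range_succ_mk, Finset.sum_range_succ']
  simp [coeff_one, qShuffle_one_left]

theorem qSh_one_right (f : HH⟦X⟧) : qSh f 1 = f := by
  ext n
  have := coeff_convol_C_right qShuffleHH f 1 n
  rw [map_one, qShuffle_one_right] at this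
  exact this

theorem sigH_mul_lb (u : ℚ⟦X⟧) :
    sigH u * PowerSeries.C lb = PowerSeries.C lb * sigH u := by
  ext n
  have h : Commute (toHH hb) lb := by
    rw [toHH_hb]; exact (Commute.refl lb).smul_left hbar
  rw [coeff_mul_C, coeff_C_mul, coeff_sigma, smul_mul_assoc, mul_smul_comm, (h.pow_left n).eq]

/-- The series `(e^{tħb} - 1) / ħ`. -/
def Phi : HH⟦X⟧ := PowerSeries.C lb * sigH phi * X

/-- The series `(e^{-tħb} - 1) / ħ`. -/
def PhiNeg : HH⟦X⟧ := -(PowerSeries.C lb * sigH (neg phi) * X)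

theorem hbar_smul_lb_mul (u : ℚ⟦X⟧) :
    hbar • (PowerSeries.C lb * sigH u * X) = sigH (X * u) := by
  have h : hbar • (PowerSeries.C lb : HH⟦X⟧) = PowerSeries.C (toHH hb) := by
    ext n
    rw [coeff_smul, coeff_C, coeff_C, toHH_hb]
    split_ifs <;> simp
  rw [← smul_mul_assoc, ← smul_mul_assoc, h, map_mul, sigma_X, X_mul, mul_assoc,
    ← X_mul (φ := sigH u), ← mul_assoc]

theorem hbar_smul_Phi : hbar • Phi = sigH expS - 1 := by
  rw [Phi, hbar_smul_lb_mul, X_mul_phi, map_sub, map_one]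

theorem hbar_smul_PhiNeg : hbar • PhiNeg = sigH (neg expS) - 1 := by
  rw [PhiNeg, smul_neg, hbar_smul_lb_mul, X_mul_neg_phi, map_sub, map_one, neg_sub]

/-- This is `e^{tħb} e^{-tħb} = 1` divided by `ħ`; to avoid the division, `e^{tħb} PhiNeg = -Phi` is
used. -/
theorem Phi_add_PhiNeg : Phi + PhiNeg + hbar • (Phi * PhiNeg) = 0 := by
  have h : sigH expS * PhiNeg = -Phi := by
    rw [PhiNeg, Phi, serHH_mul_neg, ← mul_assoc, ← mul_assoc, sigH_mul_lb,
      mul_assoc (PowerSeries.C lb),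
      ← map_mul, expS_mul_neg_phi]
  rw [← smul_mul_assoc, hbar_smul_Phi, serHH_sub_mul, one_mul, h]
  abel

theorem qSh_mul_Phi_left (f h : HH⟦X⟧) : qSh (f * Phi) h = qSh f h * Phi := by
  rw [Phi, ← mul_assoc, ← mul_assoc, convol_mul_X_left, qSh_mul_sigH_left, qSh_mul_lb_left,
    mul_assoc, mul_assoc, mul_assoc]

theorem qSh_mul_PhiNeg_right (f h : HH⟦X⟧) : qSh f (h * PhiNeg) = qSh f h * PhiNeg := by
  rw [PhiNeg, serHH_mul_neg, map_neg, ← mul_assoc, ← mul_assoc, convol_mul_X_right,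
    qSh_mul_sigH_right, qSh_mul_lb_right, serHH_mul_neg, mul_assoc, mul_assoc, mul_assoc]

/-- The series `exp_{sh}(s t g₁)`. -/
def gSer (s : ℚ) : HH⟦X⟧ := PowerSeries.mk fun n => s ^ n • toHH (gDiv n)

theorem coeff_gSer (s : ℚ) (n : ℕ) : coeff n (gSer s) = s ^ n • toHH (gDiv n) := coeff_mk _ _

theorem gSer_eq (s : ℚ) : gSer s =
    1 + gSer s * (sigH (rescale s phi) * PowerSeries.C (s • toHH (g 1)) * X) := by
  ext n
  cases n with
  | zero => rw [← mul_assoc]; simp [gSer, gDiv_zero]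
  | succ n =>
    rw [← mul_assoc, ← mul_assoc, map_add, coeff_succ_mul_X, coeff_mul_C, coeff_mul, coeff_gSer,
      gDiv_succ, map_sum, Finset.smul_sum, coeff_one, if_neg (Nat.succ_ne_zero n), zero_add,
      Finset.sum_mul, Finset.Nat.sum_antidiagonal_eq_sum_range_succ_mk]
    refine Finset.sum_congr rfl fun j hj => ?_
    rw [Finset.mem_range] at hj
    rw [coeff_gSer, coeff_sigma, coeff_rescale, phi, coeff_mk, toHH_rat_smul, map_mul, map_mul,
      map_pow, smul_mul_smul_comm, smul_mul_smul_comm, smul_smul]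
    congr 1
    have : s ^ (n + 1) = s ^ j * s ^ (n - j) * s := by
      rw [← pow_add, ← pow_succ]; congr 1; omega
    rw [this]
    ring

/-- Since `g₁ = ba`, the recursion for `exp_sh(t g₁)` exhibits a last letter `a`, to which the rule
`qSh_mul_la` applies. -/
theorem gSer_one_eq : gSer 1 = 1 + gSer 1 * Phi * PowerSeries.C la := by
  conv_lhs => rw [gSer_eq]
  rw [one_smul, rescale_one, RingHom.id_apply, toHH_g, PNat.one_coe, pow_one, map_mul, Phi,
    ← sigH_mul_lb]
  congr 1
  simp only [mul_assoc]
  rw [X_mul]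

theorem gSer_neg_one_eq : gSer (-1) = 1 + gSer (-1) * PhiNeg * PowerSeries.C la := by
  conv_lhs => rw [gSer_eq]
  rw [neg_one_smul_HH, toHH_g, PNat.one_coe, pow_one, map_neg, map_mul, PhiNeg, ← sigH_mul_lb]
  congr 1
  simp only [mul_assoc, serHH_mul_neg, serHH_neg_mul]
  rw [X_mul]

theorem qSh_add_mul_la (c c' : C) (f h : HH⟦X⟧) :
    qSh (c • 1 + f * PowerSeries.C la) (c' • 1 + h * PowerSeries.C la) =
      (c * c') • 1 + (qSh (c • 1 + f * PowerSeries.C la) h +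
        qSh f (c' • 1 + h * PowerSeries.C la) + hbar • qSh f h) * PowerSeries.C la := by
  simp only [map_add, map_smul, LinearMap.add_apply, LinearMap.smul_apply, qSh_one_left,
    qSh_one_right, qSh_mul_la, add_mul, smul_mul_assoc]
  module

/-- The product of `P exp(t g₁)` and `Q exp(-t g₁)`. -/
theorem qSh_mul_gSer {c c' : C} {P P' Q Q' : HH⟦X⟧} (hP : P = c • 1 + P' * PowerSeries.C la)
    (hQ : Q = c' • 1 + Q' * PowerSeries.C la) :
    qSh (P * gSer 1) (Q * gSer (-1)) = (c * c') • 1 +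
      (qSh P' (Q * gSer (-1)) * sigH (neg expS) + qSh (P * gSer 1) Q' * sigH expS +
        hbar • qSh P' Q') * PowerSeries.C la := by
  set F := P * gSer 1 with hF
  set F' := Q * gSer (-1) with hF'
  -- Both factors become a constant plus a multiple of `a`, so that the rule for a common last `a`
  -- determines the product.
  have h1 : F = c • 1 + (P' + F * Phi) * PowerSeries.C la := by
    conv_lhs => rw [hF, gSer_one_eq]
    rw [mul_add, mul_one, add_mul, ← add_assoc, ← hP, hF]
    simp only [mul_assoc]
  have h2 : F' = c' • 1 + (Q' + F' * PhiNeg) * PowerSeries.C la := by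
    conv_lhs => rw [hF', gSer_neg_one_eq]
    rw [mul_add, mul_one, add_mul, ← add_assoc, ← hQ, hF']
    simp only [mul_assoc]
  have h3 := qSh_add_mul_la c c' (P' + F * Phi) (Q' + F' * PhiNeg)
  rw [← h1, ← h2] at h3
  rw [h3]
  congr 2
  simp only [map_add, LinearMap.add_apply, qSh_mul_Phi_left, qSh_mul_PhiNeg_right]
  have e1 : sigH expS = 1 + hbar • Phi := by rw [hbar_smul_Phi]; abel
  have e2 : sigH (neg expS) = 1 + hbar • PhiNeg := by rw [hbar_smul_PhiNeg]; abel
  -- The terms containing the product of `F` and `F'` carry the factor `Phi + PhiNeg + ħ Phi PhiNeg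
  -- = 0`.
  have e3 := congrArg (fun z => qSh F F' * z) Phi_add_PhiNeg
  simp only [mul_add, mul_smul_comm, mul_zero] at e3
  rw [e1, e2]
  simp only [mul_add, mul_one, mul_smul_comm, smul_add, mul_assoc]
  linear_combination (norm := module) e3

end SeriesHH

/-! ### Sums over deconcatenations -/

/-- The map `(P, u₁ ⋯ u_r, R) ↦ ∑ᵢ (P u₁ ⋯ u_i) sh_ħ (R ψ(u_{i+1} ⋯ u_r))`. -/
def fullSum (P : HH) : CA →ₗ[C] HH →ₗ[C] HH :=
  linExt fun u => ∑ i ∈ Finset.range (u.length + 1),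
    (qShuffleHH (P * toHH (word C (u.take i)))).comp
      (LinearMap.mulRight C (toHH (psiSh (word C (u.drop i)))))

theorem fullSum_word (P : HH) (u : List Letter) (R : HH) : fullSum P (word C u) R =
    ∑ i ∈ Finset.range (u.length + 1), qShuffleHH (P * toHH (word C (u.take i)))
      (R * toHH (psiSh (word C (u.drop i)))) := by
  rw [fullSum, linExt_word, LinearMap.sum_apply]
  rfl

theorem fullSum_add_left (P P' : HH) (w : CA) (R : HH) :
    fullSum (P + P') w R = fullSum P w R + fullSum P' w R := by
  induction w using induction_word with
  | hw u => simp only [fullSum_word, add_mul, map_add, LinearMap.add_apply, Finset.sum_add_distrib]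
  | h0 => simp
  | hadd x y hx hy => simp only [map_add, LinearMap.add_apply, hx, hy]; abel
  | hsmul c x hx => simp only [map_smul, LinearMap.smul_apply, hx, smul_add]

theorem fullSum_smul_left (c : C) (P : HH) (w : CA) (R : HH) :
    fullSum (c • P) w R = c • fullSum P w R := by
  induction w using induction_word with
  | hw u =>
    simp only [fullSum_word, smul_mul_assoc, map_smul, LinearMap.smul_apply, Finset.smul_sum]
  | h0 => simp
  | hadd x y hx hy => simp only [map_add, LinearMap.add_apply, hx, hy, smul_add]
  | hsmul d x hx => simp only [map_smul, LinearMap.smul_apply, hx, smul_comm c d]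

theorem fullSum_zero_left (w : CA) (R : HH) : fullSum 0 w R = 0 := by
  have := fullSum_smul_left 0 0 w R
  rwa [zero_smul, zero_smul] at this

theorem psiSh_mul (w w' : CA) : psiSh (w * w') = psiSh w' * psiSh w := antiHom_mul _ _ _

theorem psiSh_one : psiSh 1 = 1 := antiHom_one _

theorem fullSum_one (P R : HH) : fullSum P 1 R = qShuffleHH P R := by
  rw [← word_nil, fullSum_word]
  simp [psiSh_one]

/-- The new cut is the one after the last letter `p`. For all other cuts `p` belongs to the second
part, and since `ψ` reverses products, `ψ(p)` is absorbed into `R`. -/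
theorem fullSum_mul_ι (P : HH) (w : CA) (p : Letter) (R : HH) :
    fullSum P (w * FreeAlgebra.ι C p) R =
      fullSum P w (R * toHH (psiSh (FreeAlgebra.ι C p))) +
        qShuffleHH (P * toHH (w * FreeAlgebra.ι C p)) R := by
  induction w using induction_word with
  | hw u =>
    rw [← word_snoc, fullSum_word, fullSum_word, List.length_append, List.length_singleton,
      Finset.sum_range_succ]
    congr 1
    · refine Finset.sum_congr rfl fun i hi => ?_
      rw [Finset.mem_range] at hi
      rw [List.take_append_of_le_length (by omega), List.drop_append_of_le_length (by omega),
        word_snoc, psiSh_mul, map_mul toHH, mul_assoc]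
    · rw [List.take_of_length_le (by simp), List.drop_of_length_le (by simp), word_nil, psiSh_one,
        map_one, mul_one]
  | h0 => simp
  | hadd x y hx hy =>
    simp only [add_mul, map_add, LinearMap.add_apply, hx, hy, mul_add]; abel
  | hsmul c x hx =>
    simp only [smul_mul_assoc, map_smul, LinearMap.smul_apply, hx, mul_smul_comm, smul_add]

/-- A cut lies either to the left of `p`, where `R` absorbs the image of `p v`, or to its right,
where `P` absorbs `w p`. -/
theorem fullSum_mul_ι_mul (P : HH) (w v : CA) (p : Letter) (R : HH) :
    fullSum P (w * FreeAlgebra.ι C p * v) R =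
      fullSum P w (R * toHH (psiSh (FreeAlgebra.ι C p * v))) +
        fullSum (P * toHH (w * FreeAlgebra.ι C p)) v R := by
  induction v using induction_word with
  | hw u =>
    induction u using List.reverseRecOn generalizing R with
    | nil => rw [word_nil, mul_one, mul_one, fullSum_mul_ι, fullSum_one]
    | append_singleton u q ih =>
      rw [word_snoc, ← mul_assoc, fullSum_mul_ι, ih, fullSum_mul_ι, ← mul_assoc,
        psiSh_mul (FreeAlgebra.ι C p * word C u), map_mul toHH (psiSh _), mul_assoc R, add_assoc]
      congr 4
      rw [map_mul toHH, map_mul toHH, map_mul toHH, map_mul toHH, mul_assoc, mul_assoc, mul_assoc,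
        mul_assoc]
  | h0 => simp
  | hadd x y hx hy =>
    simp only [mul_add, map_add, LinearMap.add_apply, hx, hy]; abel
  | hsmul c x hx =>
    simp only [mul_smul_comm, map_smul, LinearMap.smul_apply, hx, smul_add]

/-- Splitting at `e_k` is allowed because it is a linear combination of letters. -/
theorem fullSum_mul_mul {x : CA} (hx : x ∈ Submodule.span C (Set.range (FreeAlgebra.ι C)))
    (P : HH) (w v : CA) (R : HH) : fullSum P (w * x * v) R =
      fullSum P w (R * toHH (psiSh (x * v))) + fullSum (P * toHH (w * x)) v R := by
  induction hx using Submodule.span_induction with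
  | mem x hx => obtain ⟨p, rfl⟩ := hx; exact fullSum_mul_ι_mul P w v p R
  | zero => simp [fullSum_zero_left]
  | add x y _ _ hx hy =>
    simp only [mul_add, add_mul, map_add, LinearMap.add_apply, hx, hy, fullSum_add_left]; abel
  | smul c x _ hx =>
    simp only [mul_smul_comm, smul_mul_assoc, map_smul, LinearMap.smul_apply, hx, smul_add,
      fullSum_smul_left]

theorem toHH_wSymSh (w : CA) : toHH (wSymSh w) = fullSum 1 w 1 := by
  induction w using induction_word with
  | hw u =>
    rw [fullSum_word, wSymSh, symmetrize, linExt_word, map_sum]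
    simp only [toHH_qShuffle, one_mul]
  | h0 => simp
  | hadd x y hx hy => simp only [map_add, LinearMap.add_apply, hx, hy]
  | hsmul c x hx => simp only [map_smul, LinearMap.smul_apply, hx]

theorem psiSh_hb : psiSh hb = hb := antiHom_ι _ _

/-- `ψ` fixes `ħb`, and powers of `ħb` leave both factors. Hence the `n` cuts after the first `ħb`
or later all give the same term. -/
theorem fullSum_mul_hb_pow (P : HH) (w : CA) (n : ℕ) (R : HH) :
    fullSum P (w * hb ^ n) R = fullSum P w (R * toHH hb ^ n) +
      (n : ℚ) • (qShuffleHH (P * toHH w) R * toHH hb ^ n) := by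
  induction n generalizing R with
  | zero => simp
  | succ n ih =>
    have h := fullSum_mul_ι P (w * hb ^ n) Letter.hb R
    rw [← hb, psiSh_hb, ih, mul_assoc, ← pow_succ] at h
    have h1 := qShuffleHH_mul_hb_pow_right (P * toHH w) R 1
    rw [pow_one] at h1
    rw [h, h1, map_mul toHH, map_pow toHH, ← mul_assoc P, qShuffleHH_mul_hb_pow_left,
      mul_assoc, mul_assoc,
      ← pow_succ', add_assoc]
    push_cast
    module

/-! ### The deconcatenation sum of the generating series of `E_{1^n}` -/

section SeriesFull

open PowerSeries

/-- The extension of `fullSum` to series, for fixed `P`. -/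
abbrev fullSer (P : HH) : CA⟦X⟧ →ₗ[C] HH⟦X⟧ →ₗ[C] HH⟦X⟧ := convol (fullSum P)

/-- The coefficientwise embedding `𝒞⟨A⟩⟦t⟧ → ℌ⟦t⟧`. -/
abbrev mapHH : CA⟦X⟧ →+* HH⟦X⟧ := PowerSeries.map toHH.toRingHom

/-- The operator `x d/dx`. -/
def euler (u : ℚ⟦X⟧) : ℚ⟦X⟧ := PowerSeries.mk fun n => n * coeff n u

/-- Differentiate `xφ(x) = e^x - 1`. -/
theorem phi_add_euler : phi + euler phi = expS := by
  ext n
  rw [map_add, euler, coeff_mk, phi, coeff_mk, coeff_exp, Nat.factorial_succ]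
  have : (n.factorial : ℚ) ≠ 0 := by positivity
  have : (n : ℚ) + 1 ≠ 0 := by positivity
  simp
  field_simp
  ring

theorem fullSer_mul_sigma (P : HH) (f : CA⟦X⟧) (u : ℚ⟦X⟧) (r : HH⟦X⟧) :
    fullSer P (f * sigma hb u) r = fullSer P f (r * sigH u) +
      qSh (PowerSeries.C P * mapHH f) r * sigH (euler u) := by
  ext n
  have h : ∀ (w : CA) (j : ℕ) (R : HH), fullSum P (w * coeff j (sigma hb u)) R =
      fullSum P w (R * coeff j (sigH u)) +
        qShuffleHH (P * toHH w) R * coeff j (sigH (euler u)) := fun w j R => by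
    rw [coeff_sigma, coeff_sigma, coeff_sigma, mul_smul_comm, mul_smul_comm, mul_smul_comm,
      LinearMap.map_smul_of_tower,
      LinearMap.map_smul_of_tower, LinearMap.smul_apply, fullSum_mul_hb_pow,
      euler, coeff_mk]
    module
  have h' : ∀ i, coeff i (PowerSeries.C P * mapHH f) = P * toHH (coeff i f) := fun i => by
    rw [coeff_C_mul, coeff_map]; rfl
  rw [map_add, coeff_mul n (qSh _ _)]
  simp only [coeff_convol, h']
  simp only [coeff_mul, map_sum, LinearMap.sum_apply, Finset.sum_mul, h, Finset.sum_add_distrib]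
  congr 1
  · rw [sum_antidiagonal_right_comm (fun i j k => fullSum P (coeff i f)
      (coeff k r * coeff j (sigH u))), sum_antidiagonal_assoc (fun i k j => fullSum P
      (coeff i f) (coeff k r * coeff j (sigH u)))]
  · exact sum_antidiagonal_right_comm (fun i j k => qShuffleHH (P * toHH (coeff i f))
      (coeff k r) * coeff j (sigH (euler u))) n

theorem fullSer_mul_g_one (P : HH) (f : CA⟦X⟧) (r : HH⟦X⟧) :
    fullSer P (f * PowerSeries.C (g 1)) r =
      fullSer P f (r * PowerSeries.C (toHH (psiSh (g 1)))) +
        qSh (PowerSeries.C P * mapHH (f * PowerSeries.C (g 1))) r := by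
  ext n
  simp only [map_add, coeff_convol, coeff_mul_C, coeff_C_mul, coeff_map, g,
    fullSum_mul_ι, Finset.sum_add_distrib]
  rfl

theorem fullSer_one (P : HH) (r : HH⟦X⟧) : fullSer P 1 r = qSh (PowerSeries.C P) r := by
  ext n
  rw [coeff_convol, coeff_convol]
  refine Finset.sum_congr rfl fun p _ => ?_
  rw [coeff_one, coeff_C]
  split_ifs
  · rw [fullSum_one]
  · simp

/-- The series `∑ g₁^{sh n} t^n / n!`. -/
def gSerCA : CA⟦X⟧ := PowerSeries.mk gDiv

/-- The series `∑ E_{1^n} t^n`. -/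
def eSer : CA⟦X⟧ := PowerSeries.mk EOnes

theorem eSer_eq : eSer = gSerCA * sigma hb phi := by
  ext n
  rw [eSer, coeff_mk, EOnes_eq, coeff_mul, Finset.Nat.sum_antidiagonal_eq_sum_range_succ_mk]
  refine Finset.sum_congr rfl fun j _ => ?_
  rw [coeff_sigma, gSerCA, coeff_mk, phi, coeff_mk, mul_smul_comm]

theorem gSerCA_eq : gSerCA = 1 + eSer * PowerSeries.C (g 1) * X := by
  ext n
  cases n with
  | zero => simp [gSerCA, gDiv_zero]
  | succ n =>
    rw [map_add, coeff_succ_mul_X, coeff_mul_C, coeff_one, if_neg (Nat.succ_ne_zero n), zero_add,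
      gSerCA, coeff_mk, gDiv_succ, eSer, coeff_mk, EOnes_eq, Finset.sum_mul]
    simp only [smul_mul_assoc]

theorem mapHH_gSerCA : mapHH gSerCA = gSer 1 := by
  ext n
  rw [coeff_map, gSerCA, coeff_mk, coeff_gSer, one_pow, one_smul]
  rfl

theorem fullSer_gSerCA (P : HH) (r : HH⟦X⟧) : fullSer P gSerCA r =
    qSh (PowerSeries.C P * gSer 1) r +
      fullSer P eSer (r * PowerSeries.C (toHH (psiSh (g 1)))) * X := by
  have h1 : PowerSeries.C P * gSer 1 = PowerSeries.C P +
      PowerSeries.C P * mapHH (eSer * PowerSeries.C (g 1)) * X := by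
    rw [← mapHH_gSerCA, gSerCA_eq, map_add, map_one, map_mul mapHH _ X, PowerSeries.map_X, mul_add,
      mul_one, mul_assoc]
  rw [h1, map_add, LinearMap.add_apply, convol_mul_X_left]
  conv_lhs => rw [gSerCA_eq]
  rw [map_add, LinearMap.add_apply, convol_mul_X_left, fullSer_mul_g_one, fullSer_one, add_mul]
  abel

/-- From `∑ E_{1^n} t^n = G φ(tħb)`: the cuts inside `φ(tħb)` contribute `euler phi`, and together
with the cut before it they give `e^{tħb}`. The factor `X` makes this a recursion that determines
all coefficients. -/
theorem fullSer_eSer_rec (P : HH) (r : HH⟦X⟧) : fullSer P eSer r =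
    qSh (PowerSeries.C P * gSer 1) (r * sigH expS) +
      fullSer P eSer (r * (sigH phi * PowerSeries.C (toHH (psiSh (g 1))))) * X := by
  conv_lhs => rw [eSer_eq, fullSer_mul_sigma, fullSer_gSerCA, mapHH_gSerCA]
  rw [← phi_add_euler, map_add, mul_add, map_add, qSh_mul_sigH_right _ _ (euler phi), mul_assoc r]
  abel

theorem toHH_psiSh_g_one : toHH (psiSh (g 1)) = -toHH (g 1) - toHH hb := by
  have h : psiSh (g 1) = psiShLetter (Letter.g 1) := antiHom_ι _ _
  rw [h, toHH_psiShLetter, PNat.one_coe, pow_one, toHH_g, toHH_hb, PNat.one_coe, pow_one, mul_sub,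
    HH_mul_neg, ← Algebra.commutes, ← Algebra.smul_def]

theorem series_identity {S : Type} [Ring S] {s a b x y G : S} (hs : s * (G - 1) = -(y * a * x * G))
    (hq : y * b * x = s - 1) : G = s + y * (-a - b) * x * G := by
  have : y * (-a - b) * x * G = s * (G - 1) - (s - 1) * G := by
    rw [hs, ← hq]; noncomm_ring
  rw [this]; noncomm_ring

/-- `exp_sh(-t g₁)` obeys the recursion of `fullSer_eSer_rec`. Move the factor in its equation to
the left by `eq_one_add_mul_comm`, multiply by `e^{tħb}`, and use `e^x φ(-x) = φ(x)` and `ψ^sh(g₁) =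
-g₁ - ħb`. -/
theorem gSer_neg_one_eq_left : gSer (-1) = sigH expS +
    sigH phi * PowerSeries.C (toHH (psiSh (g 1))) * gSer (-1) * X := by
  have h1 := eq_one_add_mul_comm (gSer_eq (-1))
  have h2 : sigH phi * PowerSeries.C (toHH hb) * X = sigH expS - 1 := by
    have := congrArg sigH X_mul_phi
    rw [map_mul, sigma_X, map_sub, map_one] at this
    rw [← this, mul_assoc, mul_assoc]
    have hc : Commute (PowerSeries.C (toHH hb)) (sigH phi) := by
      ext n
      rw [coeff_mul_C, coeff_C_mul, coeff_sigma, smul_mul_assoc, mul_smul_comm, ← pow_succ,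
        ← pow_succ']
    rw [← mul_assoc, ← hc.eq, X_mul]
  have h3 : sigH expS * (gSer (-1) - 1) =
      -(sigH phi * PowerSeries.C (toHH (g 1)) * X * gSer (-1)) := by
    have h4 : gSer (-1) - 1 = sigH (neg phi) * PowerSeries.C ((-1 : ℚ) • toHH (g 1)) * X *
        gSer (-1) := by
      rw [sub_eq_iff_eq_add', ← h1]
    rw [h4, ← mul_assoc, ← mul_assoc, ← mul_assoc, ← map_mul, expS_mul_neg_phi, neg_one_smul_HH,
      map_neg]
    simp only [serHH_mul_neg, serHH_neg_mul]
  rw [toHH_psiSh_g_one, map_sub, map_neg, mul_assoc _ (gSer (-1)), ← X_mul, ← mul_assoc]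
  have h5 := series_identity (hs := h3) (hq := h2)
  exact h5

/-- Both sides satisfy the same recursion, in which `r` changes from step to step; hence the
induction on the coefficient treats all `r` at once. -/
theorem fullSer_eSer (P : HH) (r : HH⟦X⟧) :
    fullSer P eSer r = qSh (PowerSeries.C P * gSer 1) (r * gSer (-1)) := by
  have h : ∀ (n : ℕ) (r : HH⟦X⟧), coeff n (fullSer P eSer r) =
      coeff n (qSh (PowerSeries.C P * gSer 1) (r * gSer (-1))) := by
    intro n
    induction n with
    | zero =>
      intro r
      rw [fullSer_eSer_rec, gSer_neg_one_eq_left, mul_add, map_add, map_add, ← mul_assoc r _ X,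
        convol_mul_X_right, map_add, coeff_zero_mul_X, coeff_zero_mul_X]
    | succ n ih =>
      intro r
      rw [fullSer_eSer_rec]
      conv_rhs => rw [gSer_neg_one_eq_left]
      rw [mul_add, map_add, map_add, ← mul_assoc r _ X,
        convol_mul_X_right, map_add, coeff_succ_mul_X, coeff_succ_mul_X, ih, mul_assoc r]
  exact PowerSeries.ext fun n => h n r

theorem fullSum_EOnes (P R : HH) (n : ℕ) : fullSum P (EOnes n) R =
    coeff n (qSh (PowerSeries.C P * gSer 1) (PowerSeries.C R * gSer (-1))) := by
  rw [← fullSer_eSer, coeff_convol_C_right, eSer, coeff_mk]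

end SeriesFull

/-! ### The symmetrization of `E_k` lies in `ℌ⁰` -/

section SymmetrizeE

open PowerSeries

/-- The constant term of an element of `ℌ`. -/
def constHH : HH →ₐ[C] C := FreeAlgebra.lift C fun _ => 0

theorem constHH_la : constHH la = 0 := by simp [constHH, la]

theorem constHH_lb : constHH lb = 0 := by simp [constHH, lb]

/-- The image in `ℌ` of the augmentation ideal of `𝒞⟨A⟩`. -/
def augHH : Submodule C HH :=
  LinearMap.range toHH.toLinearMap ⊓ LinearMap.ker constHH.toLinearMap

/-- The image of `ℌ⁰` in `ℌ`. -/
def H0HH : Submodule C HH := H0.map toHH.toLinearMap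

theorem mem_augHH {x : HH} : x ∈ augHH ↔ (∃ w, toHH w = x) ∧ constHH x = 0 := Iff.rfl

/-- After subtraction of the constant term, only words with a last letter remain. -/
theorem mem_augHH_of_word {q : HH → Prop} (h0 : q 0) (hadd : ∀ x y, q x → q y → q (x + y))
    (hsmul : ∀ (c : C) x, q x → q (c • x)) (hw : ∀ w p, q (toHH (w * FreeAlgebra.ι C p))) {x : HH}
    (hx : x ∈ augHH) : q x := by
  obtain ⟨⟨w, rfl⟩, hc⟩ := mem_augHH.1 hx
  have key : ∀ w : CA, q (toHH w - constHH (toHH w) • 1) := by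
    intro w
    induction w using word_cases with
    | h1 => simpa using h0
    | hw u p =>
      have h : constHH (toHH (word C u * FreeAlgebra.ι C p)) = 0 := by
        rw [map_mul toHH, map_mul constHH, toHH_ι]
        cases p <;> simp [letterHH, constHH_lb]
      rw [h, zero_smul, sub_zero]
      exact hw _ _
    | h0 => simpa using h0
    | hadd x y hx hy =>
      have := hadd _ _ hx hy
      rwa [sub_add_sub_comm, ← add_smul, ← map_add, ← map_add, ← map_add] at this
    | hsmul c x hx =>
      have := hsmul c _ hx
      rwa [smul_sub, smul_smul, ← map_smul, ← smul_eq_mul, ← map_smul, ← map_smul] at this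
  have := key w
  rwa [show constHH (toHH w) = 0 from hc, zero_smul, sub_zero] at this

theorem hbar_smul_mem_H0 {w : CA} (hw : w ∈ hatH0) : hbar • w ∈ H0 :=
  Submodule.mem_sup_right (Submodule.mem_sup_right ⟨w, hw, rfl⟩)

theorem mul_g_mem_hatH0 (w : CA) (k : ℕ+) : w * g k ∈ hatH0 :=
  Submodule.subset_span (Or.inr ⟨w, k, rfl⟩)

theorem mul_g_mem_H0 (w : CA) {k : ℕ+} (hk : 2 ≤ k) : w * g k ∈ H0 :=
  Submodule.mem_sup_left (Submodule.subset_span (Or.inr ⟨w, k, hk, rfl⟩))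

theorem one_mem_H0 : (1 : CA) ∈ H0 :=
  Submodule.mem_sup_left (Submodule.subset_span (Or.inl rfl))

/-- On last letters, `ħb·a = ħ g₁` lies in `ħ hatH0`, and `g_k a = g_{k+1}` has index at least two.
-/
theorem mul_la_mem_H0HH {x : HH} (hx : x ∈ augHH) : x * la ∈ H0HH := by
  refine mem_augHH_of_word (q := fun x => x * la ∈ H0HH) ?_ ?_ ?_ ?_ hx
  · simp
  · intro x y hx hy; rw [add_mul]; exact H0HH.add_mem hx hy
  · intro c x hx; rw [smul_mul_assoc]; exact H0HH.smul_mem c hx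
  · intro w p
    cases p with
    | hb =>
      refine ⟨_, hbar_smul_mem_H0 (mul_g_mem_hatH0 w 1), ?_⟩
      rw [AlgHom.toLinearMap_apply, map_smul, map_mul, map_mul, toHH_g, toHH_ι, letterHH,
        PNat.one_coe, pow_one, mul_smul_comm, smul_mul_assoc, mul_assoc]
    | g k =>
      refine ⟨_, mul_g_mem_H0 w (k := k + 1) ?_, ?_⟩
      · rw [← PNat.coe_le_coe, PNat.add_coe]
        have := k.pos
        simp; omega
      rw [AlgHom.toLinearMap_apply, map_mul, map_mul, toHH_g, toHH_ι, letterHH, PNat.add_coe,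
        PNat.one_coe, pow_succ]
      simp only [mul_assoc]

theorem mul_mem_augHH {x : HH} (w : CA) (hx : x ∈ augHH) : toHH w * x ∈ augHH := by
  obtain ⟨⟨v, rfl⟩, hc⟩ := mem_augHH.1 hx
  refine mem_augHH.2 ⟨⟨w * v, map_mul toHH _ _⟩, ?_⟩
  rw [map_mul, hc, mul_zero]

theorem mem_augHH_mul {x : HH} (w : CA) (hx : x ∈ augHH) : x * toHH w ∈ augHH := by
  obtain ⟨⟨v, rfl⟩, hc⟩ := mem_augHH.1 hx
  refine mem_augHH.2 ⟨⟨v * w, map_mul toHH _ _⟩, ?_⟩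
  rw [map_mul, hc, zero_mul]

theorem rat_smul_mem_augHH (c : ℚ) {x : HH} (hx : x ∈ augHH) : c • x ∈ augHH := by
  have := augHH.smul_mem (Polynomial.C c) hx
  have h : (Polynomial.C c : C) • x = c • x := by
    rw [← algebraMap_smul C c x]; rfl
  rwa [h] at this

theorem constHH_qShuffleHH (x y : HH) : constHH (qShuffleHH x y) = constHH x * constHH y := by
  induction x using word_cases with
  | h1 => rw [qShuffle_one_left, map_one, one_mul]
  | hw u p =>
    induction y using word_cases with
    | h1 => rw [qShuffle_one_right, map_one, mul_one]
    | hw v q =>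
      cases p with
      | b =>
        have := qShuffle_b_left (word C u) (word C v * FreeAlgebra.ι C q)
        rw [lb] at this
        rw [this, map_mul constHH, map_mul constHH, ← lb, constHH_lb]; simp
      | a =>
        cases q with
        | b =>
          have := qShuffle_b_right (word C u * la) (word C v)
          rw [lb, la] at this
          rw [this, map_mul constHH, map_mul constHH (word C v), ← lb, constHH_lb]; simp
        | a =>
          have := qShuffle_a (word C u) (word C v)
          rw [la] at this
          rw [this, map_mul constHH, map_mul constHH (word C v), ← la, constHH_la]; simp
    | h0 => simp
    | hadd x y hx hy => simp only [map_add, hx, hy, mul_add]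
    | hsmul c x hx => simp only [map_smul, hx, mul_smul_comm]
  | h0 => simp
  | hadd x y hx hy => simp only [map_add, LinearMap.add_apply, hx, hy, add_mul]
  | hsmul c x hx => simp only [map_smul, LinearMap.smul_apply, hx, smul_mul_assoc]

theorem qShuffleHH_mem_augHH {x : HH} (w : CA) (hx : x ∈ augHH) :
    qShuffleHH x (toHH w) ∈ augHH := by
  obtain ⟨⟨v, rfl⟩, hc⟩ := mem_augHH.1 hx
  refine mem_augHH.2 ⟨⟨qShuffle v w, toHH_qShuffle v w⟩, ?_⟩
  rw [constHH_qShuffleHH, hc, zero_mul]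

/-- Elements of `𝒞 + aug · a`. -/
def IsGood (P : HH) : Prop := ∃ c : C, ∃ x ∈ augHH, P = c • 1 + x * la

theorem isGood_one : IsGood 1 := ⟨1, 0, augHH.zero_mem, by simp⟩

theorem IsGood.mem_range {P : HH} (hP : IsGood P) : ∃ w, toHH w = P := by
  obtain ⟨c, x, hx, rfl⟩ := hP
  obtain ⟨w, -, hw⟩ := mul_la_mem_H0HH hx
  exact ⟨c • 1 + w, by rw [map_add, map_smul, map_one]; congr 1⟩

theorem coeff_qSh_mem_augHH {x : HH} (hx : x ∈ augHH) {f : HH⟦X⟧}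
    (hf : ∀ n, ∃ w, toHH w = coeff n f) (n : ℕ) :
    coeff n (qSh (PowerSeries.C x) f) ∈ augHH ∧ coeff n (qSh f (PowerSeries.C x)) ∈ augHH := by
  rw [coeff_convol, coeff_convol]
  constructor <;> refine Submodule.sum_mem _ fun p _ => ?_
  · obtain ⟨w, hw⟩ := hf p.2
    rw [← hw, coeff_C]
    split_ifs
    · exact qShuffleHH_mem_augHH w hx
    · simp
  · obtain ⟨w, hw⟩ := hf p.1
    rw [← hw, coeff_C, qShuffleHH_comm]
    split_ifs
    · exact qShuffleHH_mem_augHH w hx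
    · simp

theorem coeff_mul_sigH_mem_augHH {f : HH⟦X⟧} (hf : ∀ n, coeff n f ∈ augHH) (u : ℚ⟦X⟧) (n : ℕ) :
    coeff n (f * sigH u) ∈ augHH := by
  rw [coeff_mul]
  refine Submodule.sum_mem _ fun p _ => ?_
  rw [coeff_sigma, mul_smul_comm, ← map_pow]
  exact rat_smul_mem_augHH _ (mem_augHH_mul _ (hf _))

/-- In the formula of `qSh_mul_gSer` each term in front of the last `a` contains the augmentation
part of `P` or of `Q`, so it stays in the augmentation ideal. -/
theorem coeff_qSh_gSer_mem {P Q : HH} (hP : IsGood P) (hQ : IsGood Q) (n : ℕ) :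
    coeff n (qSh (PowerSeries.C P * gSer 1) (PowerSeries.C Q * gSer (-1))) ∈ H0HH := by
  have hr : ∀ {P : HH} (s : ℚ), IsGood P → ∀ n, ∃ w, toHH w =
      coeff n (PowerSeries.C P * gSer s) := fun s hP n => by
    obtain ⟨w, rfl⟩ := hP.mem_range
    refine ⟨s ^ n • (w * gDiv n), ?_⟩
    rw [coeff_C_mul, coeff_gSer, toHH_rat_smul, map_mul, mul_smul_comm]
  have hP' := hr 1 hP
  have hQ' := hr (-1) hQ
  obtain ⟨c, x, hx, hxP⟩ := hP
  obtain ⟨d, y, hy, hyQ⟩ := hQ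
  have hC : ∀ (c : C) (x : HH), PowerSeries.C (c • 1 + x * la) =
      c • 1 + PowerSeries.C x * PowerSeries.C la := fun c x => by
    rw [map_add, map_mul]
    congr 1
    ext n
    rw [coeff_smul, coeff_C, coeff_one]
    split_ifs <;> simp
  have h := qSh_mul_gSer (P := PowerSeries.C P) (Q := PowerSeries.C Q)
    (by rw [hxP, hC]) (by rw [hyQ, hC])
  rw [h, map_add, coeff_mul_C, map_add, map_add]
  refine H0HH.add_mem ?_ (mul_la_mem_H0HH (augHH.add_mem (augHH.add_mem ?_ ?_) ?_))
  · rw [coeff_smul, coeff_one]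
    refine H0HH.smul_mem _ ?_
    split_ifs
    · exact ⟨1, one_mem_H0, map_one toHH⟩
    · exact H0HH.zero_mem
  · exact coeff_mul_sigH_mem_augHH (fun n => (coeff_qSh_mem_augHH hx hQ' n).1) _ _
  · exact coeff_mul_sigH_mem_augHH (fun n => (coeff_qSh_mem_augHH hy hP' n).2) _ _
  · rw [coeff_smul]
    refine augHH.smul_mem _ (coeff_qSh_mem_augHH hx (fun n => ?_) n).1
    obtain ⟨⟨w, rfl⟩, -⟩ := mem_augHH.1 hy
    rw [coeff_C]
    split_ifs
    · exact ⟨w, rfl⟩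
    · exact ⟨0, map_zero toHH⟩

/-- `e_{l+1} = e_l a`. -/
theorem isGood_mul_e (w : CA) {k : ℕ+} (hk : k ≠ 1) : IsGood (toHH (w * e k)) := by
  obtain ⟨l, rfl⟩ : ∃ l, k = l + 1 :=
    ⟨k - 1, (PNat.sub_add_of_lt (lt_of_le_of_ne one_le (Ne.symm hk))).symm⟩
  refine ⟨0, toHH (w * e l), mem_augHH.2 ⟨⟨_, rfl⟩, ?_⟩, ?_⟩
  · rw [map_mul toHH, toHH_e, map_mul constHH,
      map_mul constHH, map_mul constHH lb, constHH_lb]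
    simp
  · have h : (l : ℕ) + 1 - 1 = (l : ℕ) - 1 + 1 := by have := l.pos; omega
    rw [zero_smul, zero_add, map_mul, map_mul, toHH_e, toHH_e, PNat.add_coe, PNat.one_coe, h,
      pow_succ]
    simp only [mul_assoc]

/-- `ψ^sh(e_{l+1}) = b(-a-ħ)^l (-a-ħ+ħ) = -ψ^sh(g_l) a`: the summand `ħ g_l` of `e_{l+1}` is what
makes this end in `a`. -/
theorem isGood_mul_psiSh_e (w : CA) {k : ℕ+} (hk : k ≠ 1) :
    IsGood (toHH (w * psiSh (e k))) := by
  obtain ⟨l, rfl⟩ : ∃ l, k = l + 1 :=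
    ⟨k - 1, (PNat.sub_add_of_lt (lt_of_le_of_ne one_le (Ne.symm hk))).symm⟩
  have hψ : ∀ k, psiSh (g k) = psiShLetter (Letter.g k) := fun k => antiHom_ι _ _
  have h1 : toHH (psiSh (e (l + 1))) = (-1 : ℚ) • (toHH (psiSh (g l)) * la) := by
    have h2 : l + 1 - 1 = l := PNat.add_sub
    rw [e, if_neg hk, h2, map_add, map_smul, map_add, map_smul, hψ, hψ, toHH_psiShLetter,
      toHH_psiShLetter, PNat.add_coe, PNat.one_coe, pow_succ, ← mul_assoc, Algebra.smul_def,
      Algebra.commutes, ← mul_add, sub_add_cancel, neg_one_smul_HH]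
    exact HH_mul_neg _ _
  refine ⟨0, (-1 : ℚ) • toHH (w * psiSh (g l)), rat_smul_mem_augHH _ ?_, ?_⟩
  · rw [map_mul]
    refine mul_mem_augHH _ (mem_augHH.2 ⟨⟨_, rfl⟩, ?_⟩)
    rw [hψ, toHH_psiShLetter, map_mul constHH,
      constHH_lb, zero_mul]
  · rw [zero_smul, zero_add, map_mul, h1, map_mul, mul_smul_comm, smul_mul_assoc, mul_assoc]

theorem e_mem_span (k : ℕ+) : e k ∈ Submodule.span C (Set.range (FreeAlgebra.ι C)) := by
  rw [e]
  split_ifs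
  · exact Submodule.add_mem _ (Submodule.subset_span ⟨_, rfl⟩) (Submodule.subset_span ⟨_, rfl⟩)
  · exact Submodule.add_mem _ (Submodule.subset_span ⟨_, rfl⟩)
      (Submodule.smul_mem _ _ (Submodule.subset_span ⟨_, rfl⟩))

/-- Split at the first `e_a` with `a ≥ 2`. For cuts to its left, `R` is extended by a word whose
image under `ψ^sh` ends in `ψ^sh(e_a)`; for cuts to its right, `P` is extended by a product ending
in `e_a`. Both remain good, and only blocks `E_{1^s}` are left. -/
theorem fullSum_EAux_mem (k : Index) : ∀ (s : ℕ) {P R : HH}, IsGood P → IsGood R →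
    fullSum P (EAux s k) R ∈ H0HH := by
  induction k with
  | nil =>
    intro s P R hP hR
    rw [EAux, fullSum_EOnes]
    exact coeff_qSh_gSer_mem hP hR s
  | cons a k ih =>
    intro s P R hP hR
    rw [EAux]
    split_ifs with ha
    · exact ih (s + 1) hP hR
    · rw [fullSum_mul_mul (e_mem_span a)]
      obtain ⟨p, rfl⟩ := hP.mem_range
      obtain ⟨r, rfl⟩ := hR.mem_range
      refine H0HH.add_mem ?_ (ih 0 ?_ hR)
      · rw [fullSum_EOnes]
        refine coeff_qSh_gSer_mem hP ?_ s
        rw [psiSh_mul, ← map_mul, ← mul_assoc]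
        exact isGood_mul_psiSh_e _ ha
      · rw [← map_mul, ← mul_assoc]
        exact isGood_mul_e _ ha

theorem wSymSh_EIndex_mem_H0 (k : Index) : wSymSh (EIndex k) ∈ H0 := by
  obtain ⟨w, hw, h⟩ := fullSum_EAux_mem k 0 isGood_one isGood_one
  rw [← EIndex, ← toHH_wSymSh] at h
  rwa [← toHH_injective h]

end SymmetrizeE

/-! ### Convergence of `Z_q` -/

section ConvergenceZq

theorem truncZq_add (q : ℂ) (M : ℕ) (w w' : CA) :
    truncZq q M (w + w') = truncZq q M w + truncZq q M w' := by
  rw [truncZq, map_add, Finsupp.sum_add_index']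
  · rfl
  · simp
  · intro u c c'; rw [map_add, add_mul]

theorem truncZq_smul (q : ℂ) (M : ℕ) (c : C) (w : CA) :
    truncZq q M (c • w) = evalHbar q c * truncZq q M w := by
  rw [truncZq, map_smul, Finsupp.sum_smul_index, truncZq, Finsupp.mul_sum]
  · refine Finsupp.sum_congr fun u _ => ?_
    rw [map_mul, mul_assoc]
  · simp

theorem truncZq_zero (q : ℂ) (M : ℕ) : truncZq q M 0 = 0 := by simp [truncZq]

/-- Uses `|1 - q^m| ≥ 1 - |q|`, uniformly in `m ≥ 1`. -/
theorem Fq_bound {q : ℂ} (hq : ‖q‖ < 1) (m : ℕ) (hm : 0 < m) (k : ℕ) :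
    ‖q ^ (k * m) / qInt q m ^ k‖ ≤ (‖1 - q‖ / (1 - ‖q‖)) ^ k * (‖q‖ ^ m) ^ k := by
  have h0 : 0 < 1 - ‖q‖ := by linarith
  have h1 : 1 - ‖q‖ ≤ ‖1 - q ^ m‖ := by
    have h2 : ‖q‖ ^ m ≤ ‖q‖ := by
      simpa using pow_le_pow_of_le_one (norm_nonneg q) hq.le (show 1 ≤ m from hm)
    have h3 := norm_sub_norm_le (1 : ℂ) (q ^ m)
    rw [norm_one, norm_pow] at h3
    linarith
  rw [mul_comm k, pow_mul, ← div_pow, norm_pow, ← mul_pow]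
  refine pow_le_pow_left₀ (norm_nonneg _) ?_ k
  rw [qInt, div_div_eq_mul_div, norm_div, norm_mul, norm_pow, mul_comm, mul_div_right_comm]
  gcongr

theorem exists_norm_Fq_le {q : ℂ} (hq : ‖q‖ < 1) (a : Letter) :
    ∃ c, 0 ≤ c ∧ ∀ m, 0 < m → ‖Fq q m a‖ ≤ c := by
  have h0 : 0 < 1 - ‖q‖ := by linarith
  cases a with
  | hb => exact ⟨_, norm_nonneg (1 - q), fun m _ => le_rfl⟩
  | g k =>
    refine ⟨(‖1 - q‖ / (1 - ‖q‖)) ^ (k : ℕ), by positivity, fun m hm => ?_⟩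
    refine (Fq_bound hq m hm k).trans (mul_le_of_le_one_right (by positivity) ?_)
    exact pow_le_one₀ (by positivity) (pow_le_one₀ (norm_nonneg q) hq.le)

theorem exists_norm_nestedSum_le {q : ℂ} (hq : ‖q‖ < 1) (u : List Letter) :
    ∃ c, 0 ≤ c ∧ ∀ M : ℕ, ‖nestedSum (Fq q) M u‖ ≤ c * (M : ℝ) ^ u.length := by
  induction u using List.reverseRecOn with
  | nil => exact ⟨1, zero_le_one, fun M => by rw [nestedSum_nil]; simp⟩
  | append_singleton u a ih =>
    obtain ⟨c, hc, h⟩ := ih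
    obtain ⟨d, hd, h'⟩ := exists_norm_Fq_le hq a
    refine ⟨c * d, mul_nonneg hc hd, fun M => ?_⟩
    rw [nestedSum_snoc]
    calc ‖∑ m ∈ Finset.Ioo 0 M, nestedSum (Fq q) m u * Fq q m a‖
        ≤ ∑ m ∈ Finset.Ioo 0 M, c * (M : ℝ) ^ u.length * d := by
          refine norm_sum_le_of_le _ fun m hm => ?_
          rw [Finset.mem_Ioo] at hm
          rw [norm_mul]
          have hmM : (m : ℝ) ≤ M := by exact_mod_cast hm.2.le
          refine mul_le_mul ((h m).trans ?_) (h' m hm.1) (norm_nonneg _) (by positivity)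
          gcongr
      _ ≤ M * (c * (M : ℝ) ^ u.length * d) := by
          rw [Finset.sum_const, nsmul_eq_mul, Nat.card_Ioo]
          refine mul_le_mul_of_nonneg_right ?_ (by positivity)
          exact_mod_cast (by omega : M - 0 - 1 ≤ M)
      _ = c * d * (M : ℝ) ^ (u ++ [a]).length := by
          rw [List.length_append, List.length_singleton, pow_succ]; ring

/-- The inner nested sum grows at most polynomially in `m`, while the last letter `g_k` decays like
`|q|^m`. -/
theorem summable_snoc_g {q : ℂ} (hq : ‖q‖ < 1) (u : List Letter) (k : ℕ+) :
    Summable fun m : ℕ => if m = 0 then 0 else nestedSum (Fq q) m u * Fq q m (Letter.g k) := by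
  obtain ⟨c, hc, h⟩ := exists_norm_nestedSum_le hq u
  have h0 : 0 < 1 - ‖q‖ := by linarith
  refine Summable.of_norm_bounded (g := fun m : ℕ =>
    (c * (‖1 - q‖ / (1 - ‖q‖)) ^ (k : ℕ)) * ((m : ℝ) ^ u.length * ‖q‖ ^ m)) ?_ fun m => ?_
  · refine Summable.mul_left _ (summable_pow_mul_geometric_of_norm_lt_one _ ?_)
    rwa [norm_norm]
  · split_ifs with hm
    · rw [norm_zero]; positivity
    · have h1 := Fq_bound hq m (Nat.pos_of_ne_zero hm) k
      have h2 : (‖q‖ ^ m) ^ (k : ℕ) ≤ ‖q‖ ^ m := by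
        simpa using pow_le_pow_of_le_one (by positivity) (pow_le_one₀ (norm_nonneg q) hq.le)
          (show 1 ≤ (k : ℕ) from k.pos)
      rw [norm_mul]
      calc _ ≤ (c * (m : ℝ) ^ u.length) * ((‖1 - q‖ / (1 - ‖q‖)) ^ (k : ℕ) * ‖q‖ ^ m) :=
            mul_le_mul (h m) (h1.trans (by gcongr)) (norm_nonneg _) (by positivity)
        _ = _ := by ring

theorem exists_tendsto_truncZq {w : CA} (hw : w ∈ hatH0) (q : QParam) :
    ∃ L, Tendsto (fun M => truncZq q M w) atTop (𝓝 L) := by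
  induction hw using Submodule.span_induction with
  | mem x hx =>
    rcases hx with rfl | ⟨w, k, rfl⟩
    · refine ⟨1, ?_⟩
      have : ∀ M, truncZq q M 1 = 1 := fun M => by
        rw [← word_nil, truncZq_word, nestedSum_nil]
      simp only [this, tendsto_const_nhds]
    · induction w using induction_word with
      | hw u =>
        have h := (summable_snoc_g q.2.2 u k).hasSum.tendsto_sum_nat
        refine ⟨_, h.congr fun M => ?_⟩
        rw [g, ← word_snoc, truncZq_word, nestedSum_snoc_eq_range]
      | h0 => exact ⟨0, by simp [truncZq_zero]⟩
      | hadd x y hx hy =>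
        obtain ⟨L, hL⟩ := hx
        obtain ⟨L', hL'⟩ := hy
        exact ⟨L + L', by simpa only [add_mul, truncZq_add] using hL.add hL'⟩
      | hsmul c x hx =>
        obtain ⟨L, hL⟩ := hx
        exact ⟨evalHbar q c * L, by
          simpa only [smul_mul_assoc, truncZq_smul] using hL.const_mul (evalHbar q c)⟩
  | zero => exact ⟨0, by simp [truncZq_zero]⟩
  | add x y _ _ hx hy =>
    obtain ⟨L, hL⟩ := hx
    obtain ⟨L', hL'⟩ := hy
    exact ⟨L + L', by simpa only [truncZq_add] using hL.add hL'⟩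
  | smul c x _ hx =>
    obtain ⟨L, hL⟩ := hx
    exact ⟨evalHbar q c * L, by simpa only [truncZq_smul] using hL.const_mul (evalHbar q c)⟩

theorem tendsto_truncZq {w : CA} (hw : w ∈ hatH0) (q : QParam) :
    Tendsto (fun M => truncZq q M w) atTop (𝓝 (Zq w q)) :=
  tendsto_nhds_limUnder (exists_tendsto_truncZq hw q)

theorem Zq_add {w w' : CA} (hw : w ∈ hatH0) (hw' : w' ∈ hatH0) : Zq (w + w') = Zq w + Zq w' := by
  funext q
  refine tendsto_nhds_unique (tendsto_truncZq (hatH0.add_mem hw hw') q) ?_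
  simpa only [truncZq_add, Pi.add_apply] using (tendsto_truncZq hw q).add (tendsto_truncZq hw' q)

theorem Zq_smul (c : C) {w : CA} (hw : w ∈ hatH0) (q : QParam) :
    Zq (c • w) q = evalHbar q c * Zq w q := by
  refine tendsto_nhds_unique (tendsto_truncZq (hatH0.smul_mem c hw) q) ?_
  simpa only [truncZq_smul] using (tendsto_truncZq hw q).const_mul (evalHbar q c)

theorem Zq_zero : Zq 0 = 0 := by
  funext q
  refine tendsto_nhds_unique (tendsto_truncZq hatH0.zero_mem q) ?_
  simp only [truncZq_zero]
  exact tendsto_const_nhds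

theorem Zq_one : Zq 1 = 1 := by
  funext q
  refine tendsto_nhds_unique (tendsto_truncZq (Submodule.subset_span (Or.inl rfl)) q) ?_
  have : ∀ M, truncZq q M 1 = 1 := fun M => by
    rw [← word_nil, truncZq_word, nestedSum_nil]
  simp only [this, Pi.one_apply, tendsto_const_nhds]

theorem Zq_word_snoc_g (u : List Letter) (k : ℕ+) (q : QParam) :
    Zq (word C (u ++ [Letter.g k])) q =
      ∑' m : ℕ, if m = 0 then 0 else nestedSum (Fq q) m u * Fq q m (Letter.g k) := by
  have h := (summable_snoc_g q.2.2 u k).hasSum.tendsto_sum_nat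
  refine tendsto_nhds_unique (tendsto_truncZq ?_ q) (h.congr fun M => ?_)
  · rw [word_snoc]; exact mul_g_mem_hatH0 _ k
  · rw [truncZq_word, nestedSum_snoc_eq_range]

end ConvergenceZq

/-! ### Real parameters -/

section RealParameter

theorem tendsto_re_qToOne : Tendsto (fun q : QParam => (q : ℂ).re) qToOne (𝓝[<] 1) := by
  have h : Tendsto Complex.re (map (fun x : ℝ => (x : ℂ)) (𝓝[<] 1)) (𝓝[<] 1) := by
    rw [tendsto_map'_iff]
    exact tendsto_id
  exact h.comp tendsto_comap

theorem eventually_real : ∀ᶠ q : QParam in qToOne,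
    (q : ℂ).re ∈ Set.Ioo (0 : ℝ) 1 ∧ (q : ℂ) = ((q : ℂ).re : ℂ) := by
  have h1 : ∀ᶠ q : QParam in qToOne, (q : ℂ).re ∈ Set.Ioo (0 : ℝ) 1 :=
    tendsto_re_qToOne.eventually (Ioo_mem_nhdsLT one_pos)
  have h2 : ∀ᶠ z in map (fun x : ℝ => (x : ℂ)) (𝓝[<] (1 : ℝ)), z = (z.re : ℂ) := by
    rw [eventually_map]
    exact Eventually.of_forall fun x => by simp
  exact h1.and (tendsto_comap.eventually h2)

/-- `F_q(m; u)` for a real parameter. -/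
def Fr (x : ℝ) (m : ℕ) : Letter → ℝ
  | Letter.hb => 1 - x
  | Letter.g k => (x ^ m / ∑ i ∈ Finset.range m, x ^ i) ^ (k : ℕ)

/-- The form of `[m]` as a geometric sum is continuous at `x = 1`, where the quotient defining
`qInt` has the form `0/0`. -/
theorem Fq_ofReal {x : ℝ} (hx : x ≠ 1) (m : ℕ) (a : Letter) :
    Fq (x : ℂ) m a = ((Fr x m a : ℝ) : ℂ) := by
  cases a with
  | hb => simp [Fq, Fr]
  | g k =>
    have h1 : (x : ℂ) ≠ 1 := by exact_mod_cast hx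
    have h2 : qInt (x : ℂ) m = ∑ i ∈ Finset.range m, (x : ℂ) ^ i := by
      rw [geom_sum_eq h1, qInt, ← neg_sub, ← neg_sub (x : ℂ), neg_div_neg_eq]
    rw [Fq, Fr, h2, mul_comm (k : ℕ), pow_mul, ← div_pow]
    push_cast
    rfl

theorem nestedSum_Fq_ofReal {x : ℝ} (hx : x ≠ 1) (M : ℕ) (u : List Letter) :
    nestedSum (Fq (x : ℂ)) M u = ((nestedSum (Fr x) M u : ℝ) : ℂ) := by
  have := nestedSum_map Complex.ofRealHom (Fr x) M u
  rw [Complex.ofRealHom_eq_coe] at this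
  rw [this]
  exact nestedSum_congr M u fun m _ a _ => Fq_ofReal hx m a

/-- Pair the exponents `i` and `m - 1 - i`: their geometric mean is `p^{m-1}`. -/
theorem mul_sqrt_pow_le_geom_sum (p : ℝ) (m : ℕ) :
    m * p ^ (m - 1) ≤ ∑ i ∈ Finset.range m, (p ^ 2) ^ i := by
  have h1 : ∀ i ∈ Finset.range m, 2 * p ^ (m - 1) ≤ (p ^ 2) ^ i + (p ^ 2) ^ (m - 1 - i) := by
    intro i hi
    rw [Finset.mem_range] at hi
    have h : p ^ (m - 1) = p ^ i * p ^ (m - 1 - i) := by rw [← pow_add]; congr 1; omega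
    rw [h, pow_right_comm, pow_right_comm p 2]
    nlinarith [sq_nonneg (p ^ i - p ^ (m - 1 - i))]
  have h2 := Finset.sum_le_sum h1
  rw [Finset.sum_add_distrib, Finset.sum_range_reflect (fun i => (p ^ 2) ^ i) m, Finset.sum_const,
    Finset.card_range, nsmul_eq_mul] at h2
  linarith

theorem ratio_nonneg {x : ℝ} (hx : 0 < x) (m : ℕ) :
    0 ≤ x ^ m / ∑ i ∈ Finset.range m, x ^ i := by positivity

theorem geom_sum_pos_of_pos {x : ℝ} (hx : 0 < x) {m : ℕ} (hm : 0 < m) :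
    0 < ∑ i ∈ Finset.range m, x ^ i :=
  Finset.sum_pos (fun i _ => by positivity) ⟨0, Finset.mem_range.mpr hm⟩

/-- With `x = p²` the geometric sum is at least `m p^{m-1}`. This gains `1/m` while keeping the
decay `p^m = √x^m`. -/
theorem ratio_sq_le {p : ℝ} (hp : 0 < p) (hp1 : p < 1) {m : ℕ} (hm : 0 < m) :
    (p ^ 2) ^ m / ∑ i ∈ Finset.range m, (p ^ 2) ^ i ≤ p ^ m * (1 / m) := by
  have h := mul_sqrt_pow_le_geom_sum p m
  have hm' : (0 : ℝ) < m := by exact_mod_cast hm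
  rw [div_le_iff₀ (geom_sum_pos_of_pos (by positivity) hm)]
  have h1 : (p ^ 2) ^ m = p ^ m * (1 / m) * (m * p ^ (m - 1)) * p := by
    have : p ^ (m - 1) * p = p ^ m := by rw [← pow_succ]; congr 1; omega
    rw [mul_assoc, mul_assoc (m : ℝ), this]
    field_simp
    ring
  calc (p ^ 2) ^ m = p ^ m * (1 / m) * (m * p ^ (m - 1)) * p := h1
    _ ≤ p ^ m * (1 / m) * (m * p ^ (m - 1)) * 1 := by gcongr
    _ ≤ _ := by rw [mul_one]; gcongr

theorem ratio_le {x : ℝ} (hx : 0 < x) (hx1 : x < 1) {m : ℕ} (hm : 0 < m) :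
    x ^ m / ∑ i ∈ Finset.range m, x ^ i ≤ 1 / m := by
  have h := ratio_sq_le (p := √x) (Real.sqrt_pos.mpr hx)
    (by rw [Real.sqrt_lt' one_pos]; simpa using hx1) hm
  rw [Real.sq_sqrt hx.le] at h
  refine h.trans (mul_le_of_le_one_left (by positivity) (pow_le_one₀ (Real.sqrt_nonneg x) ?_))
  exact Real.sqrt_le_one.mpr hx1.le

theorem Fr_nonneg {x : ℝ} (hx : 0 < x) (hx1 : x < 1) (m : ℕ) (a : Letter) : 0 ≤ Fr x m a := by
  cases a with
  | hb => exact (sub_pos.mpr hx1).le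
  | g k => exact pow_nonneg (ratio_nonneg hx m) _

/-! ### Multiple zeta values as limits -/

theorem tendsto_Fr_g (m : ℕ) (k : ℕ+) :
    Tendsto (fun x : ℝ => Fr x m (Letter.g k)) (𝓝 1) (𝓝 (1 / (m : ℝ) ^ (k : ℕ))) := by
  rcases Nat.eq_zero_or_pos m with rfl | hm
  · simp [Fr]
  · have hm' : (m : ℝ) ≠ 0 := by exact_mod_cast hm.ne'
    have h : ContinuousAt (fun x : ℝ => (x ^ m / ∑ i ∈ Finset.range m, x ^ i) ^ (k : ℕ)) 1 := by
      refine ContinuousAt.pow (ContinuousAt.div (by fun_prop) (by fun_prop) ?_) _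
      simpa using hm'
    have h2 := h.tendsto
    simp only [one_pow, Finset.sum_const, Finset.card_range, nsmul_eq_mul, mul_one, one_div,
      inv_pow] at h2
    simpa [Fr] using h2

theorem tendsto_nestedSum_Fr (M : ℕ) (k : Index) :
    Tendsto (fun x : ℝ => nestedSum (Fr x) M (k.map Letter.g)) (𝓝 1) (𝓝 (truncMZV M k)) := by
  have h : ∀ x : ℝ, nestedSum (Fr x) M (k.map Letter.g) =
      nestedSum (fun m a => Fr x m (Letter.g a)) M k := fun x => nestedSum_map_list _ _ _ _
  simp only [h]
  simp only [truncMZV, nestedSum]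
  exact tendsto_finsetSum _ fun m _ => tendsto_finsetProd _ fun i _ => tendsto_Fr_g (m i) (k.get i)

theorem Fr_g_le {x : ℝ} (hx : 0 < x) (hx1 : x < 1) {m : ℕ} (hm : 0 < m) (k : ℕ+) :
    Fr x m (Letter.g k) ≤ 1 / (m : ℝ) ^ (k : ℕ) := by
  rw [← one_div_pow]
  exact pow_le_pow_left₀ (ratio_nonneg hx m) (ratio_le hx hx1 hm) _

theorem nestedSum_Fr_le {x : ℝ} (hx : 0 < x) (hx1 : x < 1) (M : ℕ) (k : Index) :
    nestedSum (Fr x) M (k.map Letter.g) ≤ truncMZV M k := by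
  rw [nestedSum_map_list]
  exact nestedSum_mono (fun m _ a _ => Fr_nonneg hx hx1 m _) (fun m hm a _ => Fr_g_le hx hx1 hm a) M

/-- Dominated convergence in the largest variable. Since `x^m/[m] ≤ 1/m`, the terms of the MZV form
a majorant, summable because `k` is admissible. -/
theorem tendsto_Zq_admissible {k : Index} (hk : Admissible k) :
    Tendsto (Zq (word C (k.map Letter.g))) qToOne (𝓝 ((mzv k : ℝ) : ℂ)) := by
  rcases List.eq_nil_or_concat' k with rfl | ⟨k, a, rfl⟩
  · rw [List.map_nil, word_nil, Zq_one]
    have : mzv [] = 1 := by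
      have := congrArg Subtype.val (zetaEl_word admissible_nil)
      rw [word_nil, zetaEl_one] at this
      exact this.symm
    rw [this, Complex.ofReal_one]
    exact tendsto_const_nhds
  set f : ℝ → ℕ → ℝ := fun x m =>
    if m = 0 then 0 else nestedSum (Fr x) m (k.map Letter.g) * Fr x m (Letter.g a) with hf
  set b : ℕ → ℝ := fun m => if m = 0 then 0 else truncMZV m k * (1 / (m : ℝ) ^ (a : ℕ)) with hb
  have hb0 : ∀ m, 0 ≤ b m := fun m => by
    rw [hb]
    have : 0 ≤ truncMZV m k := nestedSum_nonneg (fun m _ a _ => by positivity) m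
    dsimp only
    split_ifs <;> positivity
  have hpartial : ∀ M, ∑ m ∈ Finset.range M, b m = truncMZV M (k ++ [a]) := fun M => by
    rw [truncMZV, nestedSum_snoc_eq_range]
    rfl
  have hsum : HasSum b (mzv (k ++ [a])) := by
    rw [hasSum_iff_tendsto_nat_of_nonneg hb0]
    simpa only [hpartial] using tendsto_truncMZV hk
  have hlim : Tendsto (fun q : QParam => ∑' m, f (q : ℂ).re m) qToOne (𝓝 (∑' m, b m)) := by
    refine tendsto_tsum_of_dominated_convergence hsum.summable ?_ ?_
    · intro m
      have h1 : Tendsto (fun x : ℝ => f x m) (𝓝 1) (𝓝 (b m)) := by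
        rw [hf, hb]
        dsimp only
        split_ifs
        · exact tendsto_const_nhds
        · exact (tendsto_nestedSum_Fr m k).mul (tendsto_Fr_g m a)
      exact h1.comp (tendsto_re_qToOne.mono_right nhdsWithin_le_nhds)
    · filter_upwards [eventually_real] with q hq m
      obtain ⟨⟨h0, h1⟩, -⟩ := hq
      rw [hf, hb]
      dsimp only
      split_ifs with hm
      · simp
      · have hm' := Nat.pos_of_ne_zero hm
        have h2 := nestedSum_nonneg (F := Fr (q : ℂ).re) (u := k.map Letter.g)
          (fun m _ a _ => Fr_nonneg h0 h1 m a) m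
        have h3 := Fr_nonneg h0 h1 m (Letter.g a)
        have h4 := nestedSum_Fr_le h0 h1 m k
        rw [Real.norm_of_nonneg (mul_nonneg h2 h3)]
        exact mul_le_mul h4 (Fr_g_le h0 h1 hm' a) h3 (h2.trans h4)
  rw [hsum.tsum_eq] at hlim
  refine ((Complex.continuous_ofReal.tendsto _).comp hlim).congr' ?_
  filter_upwards [eventually_real] with q hq
  obtain ⟨⟨h0, h1⟩, h⟩ := hq
  rw [List.map_append, List.map_singleton, Zq_word_snoc_g, Function.comp_apply, Complex.ofReal_tsum]
  refine tsum_congr fun m => ?_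
  rw [hf]
  dsimp only
  split_ifs
  · simp
  · rw [h, nestedSum_Fq_ofReal h1.ne, Fq_ofReal h1.ne, Complex.ofReal_mul, Complex.ofReal_re]

end RealParameter

/-! ### Growth of `Z_q` as `q → 1` -/

section Growth

/-- A bound for the sums `(1 - x) ∑ s^m` and `∑ s^m / m` with `s = x^{1/N}`. -/
def growth (N : ℕ) (x : ℝ) : ℝ := N - Real.log ((1 - x) / N)

/-- `1 - x = N e^N e^{-growth}`, and `growth` tends to infinity, so the exponential beats every
power. -/
theorem tendsto_mul_growth_pow {N : ℕ} (hN : 0 < N) (r : ℕ) :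
    Tendsto (fun x => (1 - x) * growth N x ^ r) (𝓝[<] 1) (𝓝 0) := by
  have hN' : (0 : ℝ) < N := by exact_mod_cast hN
  have h1 : Tendsto (fun x : ℝ => (1 - x) / N) (𝓝[<] 1) (𝓝[>] 0) := by
    refine tendsto_nhdsWithin_iff.mpr ⟨?_, ?_⟩
    · have : ContinuousAt (fun x : ℝ => (1 - x) / N) 1 := by fun_prop
      have h := this.tendsto
      rw [sub_self, zero_div] at h
      exact h.mono_left nhdsWithin_le_nhds
    · filter_upwards [self_mem_nhdsWithin] with x hx
      exact div_pos (sub_pos.mpr hx) hN'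
  have h2 : Tendsto (growth N) (𝓝[<] 1) atTop := by
    have := tendsto_neg_atBot_atTop.comp (Real.tendsto_log_nhdsGT_zero.comp h1)
    exact tendsto_atTop_add_const_left _ (N : ℝ) this
  have h3 := ((Real.tendsto_pow_mul_exp_neg_atTop_nhds_zero r).comp h2).const_mul
    (N * Real.exp N)
  rw [mul_zero] at h3
  refine h3.congr' ?_
  filter_upwards [self_mem_nhdsWithin] with x hx
  have hx' : 0 < (1 - x) / N := div_pos (sub_pos.mpr hx) hN'
  have h4 : Real.exp (-growth N x) = Real.exp (-N) * ((1 - x) / N) := by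
    rw [growth, neg_sub, sub_eq_add_neg, Real.exp_add, Real.exp_log hx', mul_comm]
  rw [Function.comp_apply, h4, Real.exp_neg]
  field_simp

variable {N : ℕ} {x s : ℝ}

/-- Bernoulli's inequality for `s^N = x`. -/
theorem one_sub_le_mul_of_pow_eq (hs0 : 0 < s) (hsN : s ^ N = x) : 1 - x ≤ N * (1 - s) := by
  have := one_add_mul_le_pow (show (-2 : ℝ) ≤ s - 1 by linarith) N
  rw [add_sub_cancel, hsN] at this
  linarith

theorem log_nonpos_of_growth (hN : 0 < N) (hx0 : 0 < x) (hx1 : x < 1) :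
    Real.log ((1 - x) / N) ≤ 0 := by
  have hN' : (1 : ℝ) ≤ N := by exact_mod_cast hN
  refine Real.log_nonpos (by have := sub_pos.mpr hx1; positivity) ?_
  rw [div_le_one (by linarith)]
  linarith

theorem sum_mul_pow_le_growth (hN : 0 < N) (hx0 : 0 < x) (hx1 : x < 1) (hs0 : 0 < s) (hs1 : s < 1)
    (hsN : s ^ N = x) (M : ℕ) : ∑ m ∈ Finset.Ioo 0 M, (1 - x) * s ^ m ≤ growth N x := by
  rw [← Finset.mul_sum]
  have h1 : ∑ m ∈ Finset.Ioo 0 M, s ^ m ≤ (1 - s)⁻¹ :=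
    sum_le_hasSum _ (fun m _ => by positivity) (hasSum_geometric_of_lt_one hs0.le hs1)
  have h2 : 0 < 1 - s := sub_pos.mpr hs1
  calc (1 - x) * ∑ m ∈ Finset.Ioo 0 M, s ^ m ≤ N * (1 - s) * (1 - s)⁻¹ :=
        mul_le_mul (one_sub_le_mul_of_pow_eq hs0 hsN) h1
          (Finset.sum_nonneg fun m _ => by positivity) (by positivity)
    _ = N := by rw [mul_assoc, mul_inv_cancel₀ h2.ne', mul_one]
    _ ≤ growth N x := by
        rw [growth]
        have := log_nonpos_of_growth hN hx0 hx1
        linarith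

/-- The full series is `-log(1 - s)`, and `1 - s ≥ (1 - x)/N`. -/
theorem sum_div_mul_pow_le_growth (hN : 0 < N) (hx1 : x < 1) (hs0 : 0 < s)
    (hs1 : s < 1) (hsN : s ^ N = x) (M : ℕ) :
    ∑ m ∈ Finset.Ioo 0 M, 1 / (m : ℝ) * s ^ m ≤ growth N x := by
  have h1 : HasSum (fun m : ℕ => 1 / (m : ℝ) * s ^ m) (-Real.log (1 - s)) := by
    rw [← hasSum_nat_add_iff' 1]
    have := Real.hasSum_pow_div_log_of_abs_lt_one (x := s) (by rwa [abs_of_pos hs0])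
    simp only [Finset.range_one, Finset.sum_singleton, Nat.cast_zero, div_zero, zero_mul, sub_zero]
    refine this.congr_fun ?_
    intro n
    push_cast
    ring
  have h2 : ∑ m ∈ Finset.Ioo 0 M, 1 / (m : ℝ) * s ^ m ≤ -Real.log (1 - s) :=
    sum_le_hasSum _ (fun m _ => by positivity) h1
  have hN' : (0 : ℝ) < N := by exact_mod_cast hN
  have h3 : Real.log ((1 - x) / N) ≤ Real.log (1 - s) := by
    refine Real.log_le_log (div_pos (sub_pos.mpr hx1) hN') ?_
    rw [div_le_iff₀ hN', mul_comm]
    exact one_sub_le_mul_of_pow_eq hs0 hsN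
  rw [growth]
  linarith

theorem Fr_g_le_div (hx0 : 0 < x) (hx1 : x < 1) {m : ℕ} (hm : 0 < m) (k : ℕ+) :
    Fr x m (Letter.g k) ≤ 1 / m := by
  have hm' : (1 : ℝ) ≤ m := by exact_mod_cast hm
  refine (Fr_g_le hx0 hx1 hm k).trans ?_
  rw [← one_div_pow]
  exact pow_le_of_le_one (by positivity) (by rw [div_le_one (by linarith)]; exact hm') k.ne_zero

theorem Fr_g_le_mul_sqrt (hx0 : 0 < x) (hx1 : x < 1) {m : ℕ} (hm : 0 < m) (k : ℕ+) :
    Fr x m (Letter.g k) ≤ 1 / m * √x ^ m ∧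
      (k ≠ 1 → Fr x m (Letter.g k) ≤ 1 / m * (1 / m) * √x ^ m) := by
  have h := ratio_sq_le (p := √x) (Real.sqrt_pos.mpr hx0)
    (by rw [Real.sqrt_lt' one_pos]; simpa using hx1) hm
  rw [Real.sq_sqrt hx0.le, mul_comm] at h
  have h' := ratio_le hx0 hx1 hm
  have h0 := ratio_nonneg hx0 m
  have hm' : (1 : ℝ) ≤ m := by exact_mod_cast hm
  have h1 : x ^ m / ∑ i ∈ Finset.range m, x ^ i ≤ 1 :=
    h'.trans (by rw [div_le_one (by linarith)]; exact hm')
  refine ⟨(pow_le_of_le_one h0 h1 k.ne_zero).trans h, fun hk => ?_⟩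
  have h2 : 2 ≤ (k : ℕ) := by
    have := k.pos
    have : (k : ℕ) ≠ 1 := fun h => hk (PNat.eq h)
    omega
  calc Fr x m (Letter.g k) ≤ (x ^ m / ∑ i ∈ Finset.range m, x ^ i) ^ 2 :=
        pow_le_pow_of_le_one h0 h1 h2
    _ = (x ^ m / ∑ i ∈ Finset.range m, x ^ i) * (x ^ m / ∑ i ∈ Finset.range m, x ^ i) := sq _
    _ ≤ 1 / m * (1 / m * √x ^ m) := mul_le_mul h' h h0 (by positivity)
    _ = _ := by ring

theorem Fr_g_le_div_sq (hx0 : 0 < x) (hx1 : x < 1) {m : ℕ} (hm : 0 < m) {k : ℕ+} (hk : k ≠ 1) :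
    Fr x m (Letter.g k) ≤ 1 / m * (1 / m) := by
  refine ((Fr_g_le_mul_sqrt hx0 hx1 hm k).2 hk).trans (mul_le_of_le_one_right (by positivity) ?_)
  exact pow_le_one₀ (Real.sqrt_nonneg x) (Real.sqrt_le_one.mpr hx1.le)

/-- The common growth estimate. `D` is the bound for each letter that is summed; `E` collects
correction factors, which only need to be bounded jointly by `κ`. Since `m_L` is the largest
variable, its damping `√x^{m_L}` can be shared among all variables, and the sums separate. -/
theorem nestedSum_Fr_le_growth (hx0 : 0 < x) (hx1 : x < 1) {u : List Letter} (L : Fin u.length)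
    (hL : ∀ l, l ≤ L) {κ : ℝ} (hκ : 0 ≤ κ) (D : Fin u.length → ℕ → ℝ)
    (hD : ∀ l, D l = (fun _ => 1 - x) ∨ D l = fun m : ℕ => 1 / (m : ℝ))
    (E : (Fin u.length → ℕ) → Fin u.length → ℝ)
    (hF : ∀ m : Fin u.length → ℕ, (∀ i, 0 < m i) → ∀ l,
      Fr x (m l) (u.get l) ≤ D l (m l) * E m l * (if l = L then √x ^ m l else 1))
    (hE : ∀ m : Fin u.length → ℕ, (∀ i, 0 < m i) → StrictMono m → ∏ l, E m l ≤ κ) (M : ℕ) :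
    nestedSum (Fr x) M u ≤ κ * growth (2 * u.length) x ^ u.length := by
  have hr : 0 < u.length := L.pos
  have hN : 0 < 2 * u.length := by omega
  -- With `r` letters, `s = x^{1/(2r)}` gives `√x = s^r`, so `√x^{m_L} = s^{r m_L} ≤ s^{∑ m_l}`.
  set s : ℝ := x ^ (((2 * u.length : ℕ) : ℝ)⁻¹) with hs
  have hs0 : 0 < s := Real.rpow_pos_of_pos hx0 _
  have hsN : s ^ (2 * u.length) = x := Real.rpow_inv_natCast_pow hx0.le hN.ne'
  have hs1 : s < 1 := by
    by_contra h
    have := one_le_pow₀ (not_lt.mp h) (n := 2 * u.length)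
    rw [hsN] at this
    linarith
  have hsr : √x = s ^ u.length := by
    rw [← hsN, mul_comm, pow_mul]
    exact Real.sqrt_sq (by positivity)
  have hD0 : ∀ l m, 0 ≤ D l m := fun l m => by
    rcases hD l with h | h <;> rw [h]
    · exact (sub_pos.mpr hx1).le
    · positivity
  -- The majorant must be a product over the variables, so `κ` is assigned to the factor of `L`.
  refine (nestedSum_le_prod (fun l m => (if l = L then κ else 1) * (D l m * s ^ m))
    ?_ M ?_).trans ?_
  · intro l m
    have := hD0 l m
    split_ifs <;> positivity
  · intro m hm hmono
    have h1 : ∏ l, (if l = L then √x ^ m l else 1) ≤ ∏ l, s ^ m l := by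
      rw [Finset.prod_ite_eq' Finset.univ L fun l => √x ^ m l, if_pos (Finset.mem_univ L), hsr,
        ← pow_mul, Finset.prod_pow_eq_pow_sum]
      refine pow_le_pow_of_le_one hs0.le hs1.le ?_
      have := Finset.sum_le_card_nsmul Finset.univ m (m L) fun l _ => hmono.monotone (hL l)
      simpa using this
    calc ∏ l, Fr x (m l) (u.get l)
        ≤ ∏ l, D l (m l) * E m l * (if l = L then √x ^ m l else 1) :=
          Finset.prod_le_prod (fun l _ => Fr_nonneg hx0 hx1 _ _) fun l _ => hF m hm l
      _ = (∏ l, E m l) * ((∏ l, D l (m l)) * ∏ l, (if l = L then √x ^ m l else 1)) := by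
          rw [Finset.prod_mul_distrib, Finset.prod_mul_distrib]; ring
      _ ≤ κ * ((∏ l, D l (m l)) * ∏ l, s ^ m l) := by
          have h2 : 0 ≤ ∏ l, D l (m l) := Finset.prod_nonneg fun l _ => hD0 l _
          have h3 : 0 ≤ ∏ l, (if l = L then √x ^ m l else 1) :=
            Finset.prod_nonneg fun l _ => by split_ifs <;> positivity
          exact mul_le_mul (hE m hm hmono) (mul_le_mul_of_nonneg_left h1 h2) (by positivity) hκ
      _ = _ := by
          rw [Finset.prod_mul_distrib, Finset.prod_mul_distrib,
            Finset.prod_ite_eq' Finset.univ L fun _ => κ, if_pos (Finset.mem_univ L)]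
  · simp only [← Finset.mul_sum]
    rw [Finset.prod_mul_distrib, Finset.prod_ite_eq' Finset.univ L fun _ => κ,
      if_pos (Finset.mem_univ L)]
    refine mul_le_mul_of_nonneg_left ?_ hκ
    have h4 : ∀ l ∈ Finset.univ, ∑ m ∈ Finset.Ioo 0 M, D l m * s ^ m ≤ growth (2 * u.length) x := by
      intro l _
      rcases hD l with h | h <;> rw [h]
      · exact sum_mul_pow_le_growth hN hx0 hx1 hs0 hs1 hsN M
      · exact sum_div_mul_pow_le_growth hN hx1 hs0 hs1 hsN M
    simpa using Finset.prod_le_prod (fun l _ => Finset.sum_nonneg fun m _ => by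
      have := hD0 l m; positivity) h4

/-- The bound `1 - x` or `1 / m` for `F_x(m; u)`. -/
def letterBound (x : ℝ) : Letter → ℕ → ℝ
  | Letter.hb => fun _ => 1 - x
  | Letter.g _ => fun m => 1 / (m : ℝ)

theorem letterBound_cases (x : ℝ) (a : Letter) :
    letterBound x a = (fun _ => 1 - x) ∨ letterBound x a = fun m : ℕ => 1 / (m : ℝ) := by
  cases a
  · exact Or.inl rfl
  · exact Or.inr rfl

theorem Fr_le_letterBound (hx0 : 0 < x) (hx1 : x < 1) {m : ℕ} (hm : 0 < m) (a : Letter) :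
    Fr x m a ≤ letterBound x a m := by
  cases a with
  | hb => exact le_rfl
  | g k => exact Fr_g_le_div hx0 hx1 hm k

theorem nestedSum_Fr_le_of_last (hx0 : 0 < x) (hx1 : x < 1) {u : List Letter} (L : Fin u.length)
    (hL : ∀ l, l ≤ L) {k : ℕ+} (hk : u.get L = Letter.g k) (M : ℕ) :
    nestedSum (Fr x) M u ≤ growth (2 * u.length) x ^ u.length := by
  have := nestedSum_Fr_le_growth hx0 hx1 L hL zero_le_one (fun l => letterBound x (u.get l))
    (fun l => letterBound_cases x _) (fun _ _ => 1) ?_ (fun m _ _ => by simp) M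
  · rwa [one_mul] at this
  · intro m hm l
    rw [mul_one]
    split_ifs with h
    · subst h
      rw [hk]
      exact (Fr_g_le_mul_sqrt hx0 hx1 (hm l) k).1
    · rw [mul_one]
      exact Fr_le_letterBound hx0 hx1 (hm l) _

/-- Write the factor of the letter `ħb` at `i` as `1 - x = (1/m_i)·((1 - x) m_i)`. The letter at `j`
has a spare `1/m_j`, and `m_i < m_j` gives `(1 - x) m_i / m_j ≤ 1 - x`. The gain `1 - x` outweighs
the logarithms. -/
theorem nestedSum_Fr_le_of_hb (hx0 : 0 < x) (hx1 : x < 1) {u : List Letter} (L : Fin u.length)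
    (hL : ∀ l, l ≤ L) {k : ℕ+} (hk : u.get L = Letter.g k) {i j : Fin u.length} (hij : i < j)
    (hi : u.get i = Letter.hb) {k' : ℕ+} (hj : u.get j = Letter.g k') (hk' : k' ≠ 1) (M : ℕ) :
    nestedSum (Fr x) M u ≤ (1 - x) * growth (2 * u.length) x ^ u.length := by
  have hx : 0 < 1 - x := sub_pos.mpr hx1
  refine nestedSum_Fr_le_growth hx0 hx1 L hL hx.le
    (fun l => if l = i then fun m : ℕ => 1 / (m : ℝ) else letterBound x (u.get l))
    (fun l => ?_)
    (fun m l => (if l = i then (1 - x) * m l else 1) * (if l = j then 1 / (m l : ℝ) else 1))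
    ?_ ?_ M
  · split_ifs
    · exact Or.inr rfl
    · exact letterBound_cases x _
  · intro m hm l
    have hm' : (0 : ℝ) < m l := by exact_mod_cast hm l
    by_cases h1 : l = i
    · subst h1
      have h2 : l ≠ j := hij.ne
      have h3 : l ≠ L := fun h => by
        have := hL j
        rw [← h] at this
        exact absurd hij (not_lt.mpr this)
      simp only [if_true, if_neg h2, if_neg h3, hi, mul_one]
      rw [Fr]
      field_simp
      exact le_rfl
    · simp only [if_neg h1, one_mul]
      by_cases h2 : l = j
      · subst h2
        simp only [if_true, hj]
        -- If `j` is the last position, the same letter must supply both `1/m²` and the damping.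
        split_ifs
        · exact (Fr_g_le_mul_sqrt hx0 hx1 (hm l) k').2 hk'
        · rw [mul_one]
          exact Fr_g_le_div_sq hx0 hx1 (hm l) hk'
      · simp only [if_neg h2, mul_one]
        split_ifs with h
        · subst h
          rw [hk]
          exact (Fr_g_le_mul_sqrt hx0 hx1 (hm l) k).1
        · rw [mul_one]
          exact Fr_le_letterBound hx0 hx1 (hm l) _
  · intro m hm hmono
    rw [Finset.prod_mul_distrib, Finset.prod_ite_eq' Finset.univ i fun l => (1 - x) * (m l : ℝ),
      Finset.prod_ite_eq' Finset.univ j fun l => 1 / (m l : ℝ), if_pos (Finset.mem_univ _),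
      if_pos (Finset.mem_univ _), mul_assoc]
    refine mul_le_of_le_one_right hx.le ?_
    have hm' : (0 : ℝ) < m j := by exact_mod_cast hm j
    rw [mul_one_div, div_le_one hm']
    exact_mod_cast (hmono hij).le

theorem norm_Zq_word_le {u : List Letter} (hu : word C u ∈ hatH0) {q : QParam}
    (h0 : 0 < (q : ℂ).re) (h1 : (q : ℂ).re < 1) (hq : (q : ℂ) = ((q : ℂ).re : ℂ)) {B : ℝ}
    (hB : ∀ M, nestedSum (Fr (q : ℂ).re) M u ≤ B) : ‖Zq (word C u) q‖ ≤ B := by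
  refine le_of_tendsto (tendsto_truncZq hu q).norm (Eventually.of_forall fun M => ?_)
  rw [truncZq_word, hq, nestedSum_Fq_ofReal h1.ne, Complex.norm_real, Real.norm_of_nonneg
    (nestedSum_nonneg (fun m _ a _ => Fr_nonneg h0 h1 m a) M)]
  exact hB M

theorem word_mem_hatH0 {u : List Letter} (L : Fin u.length)
    (hL : ∀ l, l ≤ L) {k : ℕ+} (hk : u.get L = Letter.g k) : word C u ∈ hatH0 := by
  rcases List.eq_nil_or_concat' u with rfl | ⟨v, a, rfl⟩
  · exact absurd L.2 (by simp)
  · have h : (L : ℕ) = v.length := by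
      have h1 := hL ⟨v.length, by simp⟩
      have h2 := L.2
      rw [Fin.le_def] at h1
      simp only [List.length_append, List.length_singleton] at h1 h2
      omega
    have h2 : a = Letter.g k := by
      rw [← hk, List.get_eq_getElem]
      simp [h]
    rw [h2, word_snoc]
    exact mul_g_mem_hatH0 _ k

theorem tendsto_one_sub_mul_Zq_word {u : List Letter} (L : Fin u.length)
    (hL : ∀ l, l ≤ L) {k : ℕ+} (hk : u.get L = Letter.g k) :
    Tendsto (fun q : QParam => (1 - (q : ℂ)) * Zq (word C u) q) qToOne (𝓝 0) := by
  have hr : 0 < u.length := L.pos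
  have h := (tendsto_mul_growth_pow (N := 2 * u.length) (by omega) u.length).comp tendsto_re_qToOne
  refine squeeze_zero_norm' ?_ h
  filter_upwards [eventually_real] with q hq
  obtain ⟨⟨h0, h1⟩, h⟩ := hq
  have h2 := norm_Zq_word_le (word_mem_hatH0 L hL hk) h0 h1 h
    (nestedSum_Fr_le_of_last h0 h1 L hL hk)
  have h3 : ‖1 - (q : ℂ)‖ = 1 - (q : ℂ).re := by
    conv_lhs => rw [h, ← Complex.ofReal_one, ← Complex.ofReal_sub, Complex.norm_real]
    exact Real.norm_of_nonneg (sub_pos.mpr h1).le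
  rw [norm_mul, h3]
  exact mul_le_mul_of_nonneg_left h2 (sub_pos.mpr h1).le

theorem tendsto_Zq_word_of_hb {u : List Letter} (L : Fin u.length)
    (hL : ∀ l, l ≤ L) {k : ℕ+} (hk : u.get L = Letter.g k) {i j : Fin u.length} (hij : i < j)
    (hi : u.get i = Letter.hb) {k' : ℕ+} (hj : u.get j = Letter.g k') (hk' : k' ≠ 1) :
    Tendsto (Zq (word C u)) qToOne (𝓝 0) := by
  have hr : 0 < u.length := L.pos
  have h := (tendsto_mul_growth_pow (N := 2 * u.length) (by omega) u.length).comp tendsto_re_qToOne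
  refine squeeze_zero_norm' ?_ h
  filter_upwards [eventually_real] with q hq
  obtain ⟨⟨h0, h1⟩, h⟩ := hq
  exact norm_Zq_word_le (word_mem_hatH0 L hL hk) h0 h1 h
    (nestedSum_Fr_le_of_hb h0 h1 L hL hk hij hi hj hk')

end Growth

/-! ### The limit of `Z_q(w)` for `w ∈ ℌ⁰` -/

section LimitH0

theorem tendsto_one_sub_mul_Zq_word_snoc (v : List Letter) (k : ℕ+) :
    Tendsto (fun q : QParam => (1 - (q : ℂ)) * Zq (word C (v ++ [Letter.g k])) q) qToOne (𝓝 0) := by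
  refine tendsto_one_sub_mul_Zq_word (u := v ++ [Letter.g k]) ⟨v.length, by simp⟩ (fun l => ?_)
    (k := k) (by simp)
  have := l.2
  simp only [List.length_append, List.length_singleton] at this
  rw [Fin.le_def]
  dsimp only
  omega

theorem tendsto_Zq_word_of_append {u v : List Letter} {k : ℕ+} (hv : u = v ++ [Letter.g k])
    {u₁ u₂ u₃ : List Letter} {k' : ℕ+} (hu : u = u₁ ++ Letter.hb :: (u₂ ++ Letter.g k' :: u₃))
    (hk' : k' ≠ 1) : Tendsto (Zq (word C u)) qToOne (𝓝 0) := by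
  have h1 : u.length = v.length + 1 := by rw [hv]; simp
  have h2 : u.length = u₁.length + (u₂.length + (u₃.length + 1) + 1) := by rw [hu]; simp
  refine tendsto_Zq_word_of_hb (u := u) ⟨v.length, by omega⟩ (fun l => ?_) (k := k) ?_
    (i := ⟨u₁.length, by omega⟩) (j := ⟨u₁.length + (u₂.length + 1), by omega⟩) ?_ ?_
    (k' := k') ?_ hk'
  · have := l.2
    rw [Fin.le_def]
    dsimp only
    omega
  · rw [List.get_eq_getElem]
    simp [hv]
  · rw [Fin.lt_def]
    dsimp only
    omega
  · rw [List.get_eq_getElem]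
    simp [hu]
  · rw [List.get_eq_getElem]
    simp only [hu]
    rw [List.getElem_append_right (by omega)]
    simp

/-- The word of a `basisMonomial`. -/
def monomialWord (l : List (ℕ × ℕ)) : List Letter :=
  l.flatMap fun p => List.replicate p.1 Letter.hb ++ [Letter.g p.2.succPNat]

theorem monomialWord_cons (p : ℕ × ℕ) (l : List (ℕ × ℕ)) : monomialWord (p :: l) =
    List.replicate p.1 Letter.hb ++ [Letter.g p.2.succPNat] ++ monomialWord l := by
  simp [monomialWord]

theorem monomialWord_append (l l' : List (ℕ × ℕ)) :
    monomialWord (l ++ l') = monomialWord l ++ monomialWord l' := by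
  simp [monomialWord]

theorem word_monomialWord (l : List (ℕ × ℕ)) : word C (monomialWord l) = basisMonomial l := by
  induction l with
  | nil => rfl
  | cons p l ih =>
    rw [monomialWord_cons, word_append, word_append, ih, basisMonomial, basisMonomial,
      List.map_cons, List.prod_cons]
    simp [word, hb, g]

theorem exists_monomialWord_eq_snoc {l : List (ℕ × ℕ)} (hl : l ≠ []) :
    ∃ v k, monomialWord l = v ++ [Letter.g k] := by
  rcases List.eq_nil_or_concat' l with rfl | ⟨l, p, rfl⟩
  · exact absurd rfl hl
  · refine ⟨monomialWord l ++ List.replicate p.1 Letter.hb, p.2.succPNat, ?_⟩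
    rw [monomialWord_append, monomialWord_cons]
    simp [monomialWord]

/-- Within one block the letters `ħb` precede the `g`, so `s = t` is allowed as well; `β_t ≥ 1`
makes the index of that `g` at least two. -/
theorem exists_monomialWord_eq_append {l : List (ℕ × ℕ)} {s t : Fin l.length} (hst : s ≤ t)
    (hs : 1 ≤ (l.get s).1) (ht : 1 ≤ (l.get t).2) : ∃ u₁ u₂ u₃ k', k' ≠ 1 ∧
      monomialWord l = u₁ ++ Letter.hb :: (u₂ ++ Letter.g k' :: u₃) := by
  have h1 : l = l.take s ++ l.get s :: l.drop (s + 1) := by simp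
  have h2 : l.get t ∈ l.get s :: l.drop (s + 1) := by
    rcases hst.eq_or_lt with h | h
    · rw [h]; exact List.mem_cons_self
    · refine List.mem_cons_of_mem _ (List.mem_iff_getElem.mpr ⟨t - (s + 1), ?_, ?_⟩)
      · rw [List.length_drop]
        have := t.2
        rw [Fin.lt_def] at h
        omega
      · rw [List.getElem_drop, List.get_eq_getElem]
        congr 1
        rw [Fin.lt_def] at h
        omega
  have h3 : Letter.g (l.get t).2.succPNat ∈ monomialWord (l.get s :: l.drop (s + 1)) :=
    List.mem_flatMap.mpr ⟨_, h2, by simp⟩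
  obtain ⟨n, hn⟩ : ∃ n, (l.get s).1 = n + 1 := ⟨_, (Nat.sub_add_cancel hs).symm⟩
  rw [monomialWord_cons, hn, List.replicate_succ, List.cons_append, List.cons_append,
    List.mem_cons] at h3
  have h4 := h3.resolve_left (by simp)
  obtain ⟨u₂, u₃, h5⟩ := List.append_of_mem h4
  refine ⟨monomialWord (l.take s), u₂, u₃, (l.get t).2.succPNat, ?_, ?_⟩
  · intro h
    have := congrArg PNat.val h
    simp only [Nat.succPNat, PNat.mk_coe, PNat.val_ofNat] at this
    omega
  · conv_lhs => rw [h1]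
    rw [monomialWord_append, monomialWord_cons, hn, List.replicate_succ, List.cons_append,
      List.cons_append, h5]

theorem basisMonomial_mem_hatH0 {l : List (ℕ × ℕ)} (hl : l ≠ []) : basisMonomial l ∈ hatH0 := by
  obtain ⟨v, k, h⟩ := exists_monomialWord_eq_snoc hl
  rw [← word_monomialWord, h, word_snoc]
  exact mul_g_mem_hatH0 _ k

theorem tendsto_coe_qToOne : Tendsto (fun q : QParam => (q : ℂ)) qToOne (𝓝 1) := by
  have h := (Complex.continuous_ofReal.tendsto 1).comp
    (tendsto_re_qToOne.mono_right nhdsWithin_le_nhds)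
  rw [Complex.ofReal_one] at h
  refine h.congr' ?_
  filter_upwards [eventually_real] with q hq
  exact hq.2.symm

theorem tendsto_evalHbar (c : C) :
    Tendsto (fun q : QParam => evalHbar q c) qToOne (𝓝 (algebraMap ℚ ℂ (c.coeff 0))) := by
  have h1 : Continuous fun z : ℂ => evalHbar z c := by
    simp only [evalHbar, Polynomial.coe_eval₂RingHom, Polynomial.eval₂_eq_sum_range]
    fun_prop
  have h2 : evalHbar 1 c = algebraMap ℚ ℂ (c.coeff 0) := by
    rw [evalHbar, Polynomial.coe_eval₂RingHom, sub_self, Polynomial.eval₂_at_zero]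
  have := (h1.tendsto 1).comp tendsto_coe_qToOne
  rwa [h2] at this

theorem evalHbar_hbar (q : ℂ) : evalHbar q hbar = 1 - q := by
  simp [evalHbar, hbar]

/-- On `hatH0` the growth is at most a power of a logarithm, which the factor `1 - q` suppresses. -/
theorem tendsto_hbar_mul_Zq {w : CA} (hw : w ∈ hatH0) :
    Tendsto (fun q : QParam => (1 - (q : ℂ)) * Zq w q) qToOne (𝓝 0) := by
  have h0 : Tendsto (fun q : QParam => 1 - (q : ℂ)) qToOne (𝓝 0) := by
    simpa using tendsto_coe_qToOne.const_sub 1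
  induction hw using Submodule.span_induction with
  | mem x hx =>
    rcases hx with rfl | ⟨w, k, rfl⟩
    · simpa only [Zq_one, Pi.one_apply, mul_one] using h0
    · induction w using induction_word with
      | hw u =>
        rw [g, ← word_snoc]
        exact tendsto_one_sub_mul_Zq_word_snoc u k
      | h0 => simp [Zq_zero]
      | hadd x y hx hy =>
        rw [add_mul, Zq_add (mul_g_mem_hatH0 _ _) (mul_g_mem_hatH0 _ _)]
        simpa only [Pi.add_apply, mul_add, add_zero] using hx.add hy
      | hsmul c x hx =>
        have := (tendsto_evalHbar c).mul hx
        rw [mul_zero] at this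
        refine this.congr fun q => ?_
        rw [smul_mul_assoc, Zq_smul c (mul_g_mem_hatH0 _ _)]
        ring
  | zero => simp [Zq_zero]
  | add x y hx' hy' hx hy =>
    rw [Zq_add hx' hy']
    simpa only [Pi.add_apply, mul_add, add_zero] using hx.add hy
  | smul c x hx' hx =>
    have := (tendsto_evalHbar c).mul hx
    rw [mul_zero] at this
    refine this.congr fun q => ?_
    rw [Zq_smul c hx']
    ring

theorem tendsto_zero_qToOne :
    Tendsto (0 : QParam → ℂ) qToOne (𝓝 (((0 : MZVAlg) : ℝ) : ℂ)) := by
  rw [ZeroMemClass.coe_zero, Complex.ofReal_zero]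
  exact tendsto_const_nhds

theorem tendsto_rat_smul {f : QParam → ℂ} {z : MZVAlg}
    (h : Tendsto f qToOne (𝓝 ((z : ℝ) : ℂ))) (c : ℚ) :
    Tendsto (c • f) qToOne (𝓝 (((c • z : MZVAlg) : ℝ) : ℂ)) := by
  have h1 : (((c • z : MZVAlg) : ℝ) : ℂ) = (c : ℂ) * ((z : ℝ) : ℂ) := by
    rw [Subalgebra.coe_smul, Rat.smul_def, Complex.ofReal_mul, Complex.ofReal_ratCast]
  rw [h1]
  refine (h.const_mul (c : ℂ)).congr fun q => ?_
  rw [Pi.smul_apply, Rat.smul_def]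

/-- `Z_q(w)` converges to the value of `zetaEl` at the reduction of `w`. -/
def HasLimit (w : CA) : Prop :=
  w ∈ hatH0 ∧ Tendsto (Zq w) qToOne (𝓝 (((zetaEl (toH1 w) : MZVAlg) : ℝ) : ℂ))

theorem HasLimit.zero : HasLimit 0 := by
  refine ⟨hatH0.zero_mem, ?_⟩
  rw [Zq_zero, map_zero, map_zero]
  exact tendsto_zero_qToOne

theorem HasLimit.add {w w' : CA} (h : HasLimit w) (h' : HasLimit w') : HasLimit (w + w') := by
  refine ⟨hatH0.add_mem h.1 h'.1, ?_⟩
  have := h.2.add h'.2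
  rw [Zq_add h.1 h'.1, map_add, map_add]
  push_cast
  exact this

theorem HasLimit.smul (c : C) {w : CA} (h : HasLimit w) : HasLimit (c • w) := by
  refine ⟨hatH0.smul_mem c h.1, ?_⟩
  have h1 := (tendsto_evalHbar c).mul h.2
  have h2 : (((zetaEl (toH1 (c • w)) : MZVAlg) : ℝ) : ℂ) =
      algebraMap ℚ ℂ (c.coeff 0) * (((zetaEl (toH1 w) : MZVAlg) : ℝ) : ℂ) := by
    rw [toH1_smul, map_smul, Subalgebra.coe_smul, Algebra.smul_def, Complex.ofReal_mul]
    rfl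
  rw [h2]
  exact h1.congr fun q => (Zq_smul c h.1 q).symm

theorem hasLimit_one : HasLimit 1 := by
  refine ⟨Submodule.subset_span (Or.inl rfl), ?_⟩
  rw [Zq_one, toH1_one, zetaEl_one, OneMemClass.coe_one, Complex.ofReal_one]
  exact tendsto_const_nhds

/-- If `ħb` occurs, it precedes the last letter `g_k` with `k ≥ 2`, and both limit and reduction are
`0`. Otherwise the word comes from an admissible index. -/
theorem hasLimit_mul_g (w : CA) {k : ℕ+} (hk : k ≠ 1) : HasLimit (w * g k) := by
  induction w using induction_word with
  | hw u =>
    refine ⟨mul_g_mem_hatH0 _ _, ?_⟩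
    rw [g, ← word_snoc]
    by_cases hu : Letter.hb ∈ u
    · obtain ⟨u₁, u₂, rfl⟩ := List.append_of_mem hu
      rw [toH1_word_of_hb_mem (List.mem_append_left _ hu), map_zero, ZeroMemClass.coe_zero,
        Complex.ofReal_zero]
      exact tendsto_Zq_word_of_append rfl (u₁ := u₁) (u₂ := u₂) (u₃ := []) (k' := k) (by simp) hk
    · obtain ⟨l, rfl⟩ := exists_map_g hu
      have h : l.map Letter.g ++ [Letter.g k] = (l ++ [k]).map Letter.g := by simp
      have hadm : Admissible (l ++ [k]) := admissible_snoc.mpr hk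
      rw [h, toH1_word_map_g, zetaEl_word hadm]
      exact tendsto_Zq_admissible hadm
  | h0 => rw [zero_mul]; exact HasLimit.zero
  | hadd x y hx hy => rw [add_mul]; exact hx.add hy
  | hsmul c x hx => rw [smul_mul_assoc]; exact hx.smul c

theorem hasLimit_nMod {w : CA} (hw : w ∈ nMod) : HasLimit w ∧ toH1 w = 0 := by
  obtain ⟨x, hx, y, hy, rfl⟩ := Submodule.mem_sup.mp hw
  have h1 : HasLimit x ∧ toH1 x = 0 := by
    clear hw
    induction hx using Submodule.span_induction with
    | mem x hx =>
      obtain ⟨l, ⟨s, t, hst, hs, ht⟩, rfl⟩ := hx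
      have hl : l ≠ [] := by
        rintro rfl
        exact absurd s.2 (by simp)
      obtain ⟨v, k, hv⟩ := exists_monomialWord_eq_snoc hl
      obtain ⟨u₁, u₂, u₃, k', hk', hu⟩ := exists_monomialWord_eq_append hst hs ht
      have h0 : toH1 (basisMonomial l) = 0 := by
        rw [← word_monomialWord, hu]
        exact toH1_word_of_hb_mem (by simp)
      refine ⟨⟨basisMonomial_mem_hatH0 hl, ?_⟩, h0⟩
      rw [h0, map_zero, ZeroMemClass.coe_zero, Complex.ofReal_zero, ← word_monomialWord]
      exact tendsto_Zq_word_of_append hv hu hk'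
    | zero => exact ⟨HasLimit.zero, map_zero _⟩
    | add x y _ _ hx hy => exact ⟨hx.1.add hy.1, by rw [map_add, hx.2, hy.2, add_zero]⟩
    | smul c x _ hx => exact ⟨hx.1.smul c, by rw [toH1_smul, hx.2, smul_zero]⟩
  obtain ⟨z, hz, rfl⟩ := hy
  have h2 : HasLimit (hbar • z) := by
    refine ⟨hatH0.smul_mem _ hz, ?_⟩
    rw [toH1_hbar_smul, map_zero, ZeroMemClass.coe_zero, Complex.ofReal_zero]
    refine (tendsto_hbar_mul_Zq hz).congr fun q => ?_
    rw [Zq_smul _ hz, evalHbar_hbar]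
  exact ⟨h1.1.add h2, by rw [map_add, h1.2, zero_add]; exact toH1_hbar_smul z⟩

theorem hasLimit_H0 {w : CA} (hw : w ∈ H0) : HasLimit w := by
  obtain ⟨x, hx, y, hy, rfl⟩ := Submodule.mem_sup.mp hw
  refine HasLimit.add ?_ (hasLimit_nMod hy).1
  clear hw
  induction hx using Submodule.span_induction with
  | mem x hx =>
    rcases hx with rfl | ⟨w, k, hk, rfl⟩
    · exact hasLimit_one
    · refine hasLimit_mul_g w ?_
      rintro rfl
      exact absurd hk (by decide)
  | zero => exact HasLimit.zero
  | add x y _ _ hx hy => exact hx.add hy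
  | smul c x _ hx => exact hx.smul c

end LimitH0

/-! ### The limit map -/

section LimitMap

theorem hasSum_mzv_singleton {a : ℕ+} (ha : a ≠ 1) :
    HasSum (fun n : ℕ => 1 / (n : ℝ) ^ (a : ℕ)) (mzv [a]) := by
  have hadm : Admissible [a] := admissible_snoc (k := []).mpr ha
  rw [hasSum_iff_tendsto_nat_of_nonneg fun n => by positivity]
  refine (tendsto_truncMZV hadm).congr fun M => ?_
  have := nestedSum_snoc_eq_range (fun m (a : ℕ+) => 1 / (m : ℝ) ^ (a : ℕ)) M [] a
  rw [List.nil_append] at this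
  rw [truncMZV, this]
  refine Finset.sum_congr rfl fun m _ => ?_
  split_ifs with h
  · rw [h]
    simp
  · rw [nestedSum_nil, one_mul]

theorem two_mul_ne_one (k : ℕ+) : 2 * k ≠ 1 := by
  intro h
  have := congrArg PNat.val h
  change 2 * (k : ℕ) = 1 at this
  omega

/-- Euler's formula expresses `ζ(2k)` as a rational multiple of `π^{2k}`, and `π² = 6 ζ(2)`. -/
theorem mzv_even (k : ℕ+) : ∃ c : ℚ, mzv [2 * k] = c * mzv [2] ^ (k : ℕ) := by
  have h1 : mzv [2 * k] = (-1 : ℝ) ^ ((k : ℕ) + 1) * 2 ^ (2 * (k : ℕ) - 1) *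
      Real.pi ^ (2 * (k : ℕ)) * bernoulli (2 * k) / (2 * (k : ℕ)).factorial :=
    (hasSum_mzv_singleton (two_mul_ne_one k)).unique (hasSum_zeta_nat k.ne_zero)
  have h3 : mzv [2] = Real.pi ^ 2 / 6 :=
    (hasSum_mzv_singleton (a := 2) (by decide)).unique hasSum_zeta_two
  have hpi : Real.pi ^ (2 * (k : ℕ)) = 6 ^ (k : ℕ) * mzv [2] ^ (k : ℕ) := by
    rw [h3, ← mul_pow, pow_mul, mul_div_cancel₀ _ (by norm_num : (6 : ℝ) ≠ 0)]
  refine ⟨(-1 : ℚ) ^ ((k : ℕ) + 1) * 2 ^ (2 * (k : ℕ) - 1) * 6 ^ (k : ℕ) *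
      bernoulli (2 * k) / (2 * (k : ℕ)).factorial, ?_⟩
  rw [h1, hpi]
  push_cast
  ring

theorem mzvEl_even_mem (k : ℕ+) (hk : Admissible [2 * k]) : mzvEl [2 * k] hk ∈ zetaTwoIdeal := by
  obtain ⟨c, hc⟩ := mzv_even k
  have h4 : mzvEl [2 * k] hk = c • zetaTwo ^ (k : ℕ) := by
    refine Subtype.ext ?_
    rw [Subalgebra.coe_smul, SubmonoidClass.coe_pow, Rat.smul_def]
    exact hc
  rw [h4, ← Nat.sub_add_cancel (show 1 ≤ (k : ℕ) from k.pos), pow_succ, Algebra.smul_def]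
  exact Ideal.mul_mem_left _ _ (Ideal.mul_mem_left _ _ (Ideal.subset_span rfl))

theorem exists_limit (f : ZqSpace) :
    ∃ z : MZVAlg, Tendsto (f : QParam → ℂ) qToOne (𝓝 ((z : ℝ) : ℂ)) := by
  obtain ⟨f, hf⟩ := f
  dsimp only
  induction hf using Submodule.span_induction with
  | mem f hf =>
    obtain ⟨w, hw, rfl⟩ := hf
    exact ⟨_, (hasLimit_H0 hw).2⟩
  | zero => exact ⟨0, tendsto_zero_qToOne⟩
  | add f f' _ _ hf hf' =>
    obtain ⟨z, hz⟩ := hf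
    obtain ⟨z', hz'⟩ := hf'
    refine ⟨z + z', ?_⟩
    have := hz.add hz'
    push_cast
    exact this
  | smul c f _ hf =>
    obtain ⟨z, hz⟩ := hf
    exact ⟨c • z, tendsto_rat_smul hz c⟩

/-- Makes the choice of a limit in `limitMap` canonical, hence linear. -/
theorem limit_unique {f : QParam → ℂ} {z z' : MZVAlg}
    (h : Tendsto f qToOne (𝓝 ((z : ℝ) : ℂ))) (h' : Tendsto f qToOne (𝓝 ((z' : ℝ) : ℂ))) : z = z' :=
  Subtype.ext (Complex.ofReal_injective (tendsto_nhds_unique h h'))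

/-- The map `𝒵_q → 𝒵`, `f ↦ lim_{q → 1} f(q)`. -/
def limitMap : ZqSpace →ₗ[ℚ] MZVAlg where
  toFun f := (exists_limit f).choose
  map_add' f f' := by
    refine limit_unique (exists_limit (f + f')).choose_spec ?_
    have := (exists_limit f).choose_spec.add (exists_limit f').choose_spec
    push_cast
    exact this
  map_smul' c f := by
    exact limit_unique (exists_limit (c • f)).choose_spec
      (tendsto_rat_smul (exists_limit f).choose_spec c)

theorem tendsto_limitMap (f : ZqSpace) :
    Tendsto (f : QParam → ℂ) qToOne (𝓝 ((limitMap f : ℝ) : ℂ)) := (exists_limit f).choose_spec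

theorem limitMap_eq {f : ZqSpace} {z : MZVAlg}
    (h : Tendsto (f : QParam → ℂ) qToOne (𝓝 ((z : ℝ) : ℂ))) : limitMap f = z :=
  limit_unique (tendsto_limitMap f) h

/-- The functions of `q` with a limit in `ζ(2)𝒵`. -/
def idealLimits : Submodule ℚ (QParam → ℂ) where
  carrier := {f | ∃ z ∈ zetaTwoIdeal, Tendsto f qToOne (𝓝 (((z : MZVAlg) : ℝ) : ℂ))}
  add_mem' := by
    rintro f f' ⟨z, hz, h⟩ ⟨z', hz', h'⟩
    refine ⟨z + z', Ideal.add_mem _ hz hz', ?_⟩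
    have := h.add h'
    push_cast
    exact this
  zero_mem' := ⟨0, Ideal.zero_mem _, tendsto_zero_qToOne⟩
  smul_mem' := by
    rintro c f ⟨z, hz, h⟩
    exact ⟨c • z, by rw [Algebra.smul_def]; exact Ideal.mul_mem_left _ _ hz, tendsto_rat_smul h c⟩

/-- Elements of `𝔫` reduce to `0`. A generator of `𝒫_q` tends to `ζ(2k)` times an element of `𝒵`,
and `ζ(2k) ∈ ζ(2)𝒵`. -/
theorem Nq_sup_Pq_le : Nq ⊔ Pq ≤ idealLimits := by
  refine sup_le (Submodule.span_le.mpr ?_) (Submodule.span_le.mpr ?_)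
  · rintro _ ⟨w, hw, rfl⟩
    obtain ⟨h1, h2⟩ := hasLimit_nMod hw
    have := h1.2
    rw [h2, map_zero] at this
    exact ⟨0, Ideal.zero_mem _, this⟩
  · rintro _ ⟨k, f, hf, rfl⟩
    have h2 := two_mul_ne_one k
    have hadm : Admissible [2 * k] := admissible_snoc (k := []).mpr h2
    have h3 := (hasLimit_mul_g 1 h2).2
    have h4 : toH1 (g (2 * k)) = word ℚ [2 * k] := by
      rw [toH1_g]; simp [word]
    rw [one_mul, h4, zetaEl_word hadm] at h3
    obtain ⟨z, hz⟩ := exists_limit ⟨f, hf⟩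
    refine ⟨mzvEl _ hadm * z, Ideal.mul_mem_right _ _ (mzvEl_even_mem k hadm), ?_⟩
    have := h3.mul hz
    push_cast
    exact this

/-- The map `𝒵_q / (𝒩_q + 𝒫_q) → 𝒵 / ζ(2)𝒵` induced by the limit. -/
def limitMapQuotient : (ZqSpace ⧸ NPq) →ₗ[ℚ] (MZVAlg ⧸ zetaTwoIdeal) :=
  NPq.liftQ ((Ideal.Quotient.mkₐ ℚ zetaTwoIdeal).toLinearMap ∘ₗ limitMap) (by
    intro f hf
    obtain ⟨z, hz, h⟩ := Nq_sup_Pq_le (show (f : QParam → ℂ) ∈ Nq ⊔ Pq from hf)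
    rw [LinearMap.mem_ker, LinearMap.comp_apply, limitMap_eq h]
    exact Ideal.Quotient.eq_zero_iff_mem.mpr hz)

theorem limitMapQuotient_mk (f : ZqSpace) : limitMapQuotient (Submodule.Quotient.mk f) =
    Ideal.Quotient.mk zetaTwoIdeal (limitMap f) := rfl

theorem Zq_mem_ZqSpace {w : CA} (hw : w ∈ H0) : Zq w ∈ ZqSpace :=
  Submodule.subset_span ⟨w, hw, rfl⟩

theorem tendsto_ZqSymStar (k : Index) :
    Tendsto (ZqSymStar (gIndex k)) qToOne (𝓝 (((symMZVStar k : MZVAlg) : ℝ) : ℂ)) := by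
  have h := (hasLimit_H0 (wSymStar_gIndex_mem_H0 k)).2
  rw [wSymStar_gIndex, toH1_ofH1, ← isRegularizable_harmonic.symMZV_eq, ← wSymStar_gIndex] at h
  exact h

theorem tendsto_ZqSymSh (k : Index) :
    Tendsto (ZqSymSh (EIndex k)) qToOne (𝓝 (((symMZVSh k : MZVAlg) : ℝ) : ℂ)) := by
  have h := (hasLimit_H0 (wSymSh_EIndex_mem_H0 k)).2
  rw [toH1_wSymSh_EIndex, ← isRegularizable_shuffle.symMZV_eq] at h
  exact h

end LimitMap

end

end QSMZV

open QSMZV in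
theorem mainTheorem3 :
    -- multiple zeta values converge, they span the algebra `𝒵`, and both regularizations exist
    -- and are unique
    (∀ k : Index, Admissible k → Tendsto (fun M => truncMZV M k) atTop (𝓝 (mzv k))) ∧
    Subalgebra.toSubmodule MZVAlg = Submodule.span ℚ {x | ∃ k, Admissible k ∧ x = mzv k} ∧
    (∃! Φ, IsRegularization harmonic Φ) ∧
    (∃! Φ, IsRegularization shuffle Φ) ∧
    -- the limits defining `Z_q` exist, and the symmetrized elements lie in `ℌ⁰`
    (∀ w ∈ hatH0, ∀ q : QParam, Tendsto (fun M => truncZq q M w) atTop (𝓝 (Zq w q))) ∧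
    (∀ k : Index, wSymStar (gIndex k) ∈ H0 ∧ wSymSh (EIndex k) ∈ H0) ∧
    -- the limits as `q → 1 - 0`
    (∀ k : Index,
      Tendsto (ZqSymStar (gIndex k)) qToOne (𝓝 (((symMZVStar k : MZVAlg) : ℝ) : ℂ)) ∧
      Tendsto (ZqSymSh (EIndex k)) qToOne (𝓝 (((symMZVSh k : MZVAlg) : ℝ) : ℂ))) ∧
    -- the map `𝒵_q / (𝒩_q + 𝒫_q) → 𝒵 / ζ(2)𝒵`, `f ↦ lim f`, is well defined and sends
    -- the `q`-analogue of the symmetric multiple zeta value to the symmetric multiple zeta value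
    ∃ Φ : (ZqSpace ⧸ NPq) →ₗ[ℚ] (MZVAlg ⧸ zetaTwoIdeal),
      (∀ f : ZqSpace, ∃ z : MZVAlg,
        Tendsto (f : QParam → ℂ) qToOne (𝓝 ((z : ℝ) : ℂ)) ∧
          Φ (Submodule.Quotient.mk f) = Ideal.Quotient.mk zetaTwoIdeal z) ∧
      ∀ k : Index,
        (∃ h : ZqSymStar (gIndex k) ∈ ZqSpace,
          Φ (Submodule.Quotient.mk ⟨ZqSymStar (gIndex k), h⟩) =
            Ideal.Quotient.mk zetaTwoIdeal (symMZVStar k)) ∧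
        (∃ h : ZqSymSh (EIndex k) ∈ ZqSpace,
          Φ (Submodule.Quotient.mk ⟨ZqSymSh (EIndex k), h⟩) =
            Ideal.Quotient.mk zetaTwoIdeal (symMZVSh k)) := by
  refine ⟨fun k hk => tendsto_truncMZV hk, toSubmodule_MZVAlg, isRegularizable_harmonic.existsUnique,
    isRegularizable_shuffle.existsUnique, fun w hw q => tendsto_truncZq hw q,
    fun k => ⟨wSymStar_gIndex_mem_H0 k, wSymSh_EIndex_mem_H0 k⟩,
    fun k => ⟨tendsto_ZqSymStar k, tendsto_ZqSymSh k⟩, limitMapQuotient,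
    fun f => ⟨limitMap f, tendsto_limitMap f, limitMapQuotient_mk f⟩, fun k => ⟨?_, ?_⟩⟩
  · refine ⟨Zq_mem_ZqSpace (wSymStar_gIndex_mem_H0 k), ?_⟩
    rw [limitMapQuotient_mk, limitMap_eq (tendsto_ZqSymStar k)]
  · refine ⟨Zq_mem_ZqSpace (wSymSh_EIndex_mem_H0 k), ?_⟩
    rw [limitMapQuotient_mk, limitMap_eq (tendsto_ZqSymSh k)]
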